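/- **System.** On a probability space let $y_k\in\mathbb R^n$, $u_k\in\mathbb R^l$, $w_k\in\mathbb R^n$ ($k\in\mathbb Z$) be random vectors with $$y_{k+1}+\sum_{i=1}^pA_iy_{k+1-i}=\sum_{j=1}^qB_ju_{k+1-j}+w_{k+1}+\sum_{\nu=1}^rC_\nu w_{k+1-\nu},\qquad k\ge 0,$$ where $p,q,r\ge1$ are known and the real matrices $A_i,B_j,C_\nu$ are unknown. Put $d=np+lq+nr$, $\Theta=[-A_1,\dots,-A_p,B_1,\dots,B_q,C_1,\dots,C_r]^\top\in\mathbb R^{d\times n}$, $C(z)=I_n+C_1z+\dots+C_rz^r$ and $\mathcal F_k=\sigma\{y_k,\dots,y_0,u_{k-1},\dots,u_0,w_k,\dots,w_1\}$. Let $\|\cdot\|$ be the Frobenius norm, $\mathcal A(X)=\{(s,t):X(s,t)=0\}$, and $\operatorname{sgn}(x)=1$ for $x\ge0$, $\operatorname{sgn}(x)=-1$ for $x<0$. **Algorithm.** Let $\mu>0$, let $\bar p>p$, $\bar q>q$, $\bar r>r$ be integers and let $\{\lambda_N\}_{N\ge1}$ be positive (possibly random). In the algorithm set $y_j=0$, $u_j=0$,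 $\widehat w_j=0$ for $j\le0$, $\bar P_0=\mu^{-1}I$, $\alpha_0=0$, $P_0=\mu^{-1}I_d$, $\Theta_0=\Xi_0=\Xi_{-1}=0$. *Step 1.* For $N\ge1$, with $\psi_{N-1}=[y_{N-1}^\top,\dots,y_{N-\bar p}^\top,u_{N-1}^\top,\dots,u_{N-\bar q}^\top,\widehat w_{N-1}^\top,\dots,\widehat w_{N-\bar r}^\top]^\top$ and $b_{N-1}=(1+\psi_{N-1}^\top\bar P_{N-1}\psi_{N-1})^{-1}$, put $\bar P_N=\bar P_{N-1}-b_{N-1}\bar P_{N-1}\psi_{N-1}\psi_{N-1}^\top\bar P_{N-1}$, $\ \alpha_N=\alpha_{N-1}+b_{N-1}\bar P_{N-1}\psi_{N-1}(y_N^\top-\psi_{N-1}^\top\alpha_{N-1})$, $\ \widehat w_N=y_N-\alpha_N^\top\psi_{N-1}$. *Step 2.* For $N\ge0$, with $\varphi_N=[y_N^\top,\dots,y_{N-p+1}^\top,u_N^\top,\dots,u_{N-q+1}^\top,\widehat w_N^\top,\dots,\widehat w_{N-r+1}^\top]^\top$ and $a_N=(1+\varphi_N^\top P_N\varphi_N)^{-1}$,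 put $P_{N+1}=P_N-a_NP_N\varphi_N\varphi_N^\top P_N$, $\ \Theta_{N+1}=\Theta_N+a_NP_N\varphi_N(y_{N+1}^\top-\varphi_N^\top\Theta_N)+\mu P_{N+1}(\Xi_N-\Xi_{N-1})$. *Step 3.* Let $\lambda_{\max}(N)$, $\lambda_{\min}(N)$ be the largest and smallest eigenvalues of $\mu I_d+\sum_{k=1}^N\varphi_k\varphi_k^\top$. Put $\widehat\Theta_{N+1}(s,t)=\Theta_{N+1}(s,t)+\operatorname{sgn}(\Theta_{N+1}(s,t))\sqrt{\log\lambda_{\max}(N)/\lambda_{\min}(N)}$ and $$\Xi_{N+1}(s,t)=\operatorname{sgn}(\Theta_{N+1}(s,t))\max\Big\{|\Theta_{N+1}(s,t)|-\frac{\lambda_N}{\mu|\widehat\Theta_{N+1}(s,t)|},0\Big\}.$$ **Theorem.** Assume: 1. $\{w_k,\mathcal F_k\}$ is a martingale difference sequence, $\mathbb E[w_{k+1}\mid\mathcal F_k]=0$ for $k\ge1$, and for some $\beta>2$, $\sup_{k\ge1}\mathbb E[\|w_{k+1}\|^\beta\mid\mathcal F_k]<\infty$ a.s.; 2. $\varphi_k$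 is $\mathcal F_k$-measurable for each $k\ge1$; 3. $\det C(z)\ne0$ for all complex $|z|\le1$; 4. $\lambda_{\min}(N)\to\infty$ and $\log\lambda_{\max}(N)/\lambda_{\min}(N)\to0$ as $N\to\infty$, a.s.; 5. $\lambda_N=O\big(\sqrt{\log\lambda_{\max}(N)/\lambda_{\min}(N)}\big)$ and $\log\lambda_{\max}(N)/\lambda_{\min}(N)=o(\lambda_N)$ as $N\to\infty$, a.s.; 6. $\bar p=p+h$, $\bar q=q+h$, $\bar r=r+h$ for a positive integer $$h>\frac{\log\big[\|C(z)\|_\infty^{-1}K^{-1}(1-\rho)\big]}{\log\rho}-1,$$ where $\|C(z)\|_\infty^2=\max_{|z|=1}\lambda_{\max}\{C(z)C^\top(z^{-1})\}$, and $K>0$, $\rho\in(0,1)$ are such that the coefficients in $C^{-1}(z)=\sum_{i\ge0}D_iz^i$ ($|z|\le1$) satisfy $\|D_i\|\le K\rho^i$ for all $i\ge0$. Then $$\|\Xi_{N+1}-\Theta\|=O\Big(\sqrt{\tfrac{\log\lambda_{\max}(N)}{\lambda_{\min}(N)}}\Big)\quad(N\to\infty)\quad\text{a.s.,}$$ and,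 almost surely, there is a (random) integer $N_0$ with $\mathcal A(\Xi_{N+1})=\mathcal A(\Theta)$ for all $N\ge N_0$. -/

import Mathlib

open MeasureTheory Filter Topology Asymptotics
open scoped ENNReal

noncomputable section

namespace SparseARMAX

/-! ### Matrices -/

/-- The Frobenius norm of a real matrix. -/
def frobNorm {ι κ : Type*} [Fintype ι] [Fintype κ] (X : Matrix ι κ ℝ) : ℝ :=
  Real.sqrt (∑ s, ∑ t, X s t ^ 2)

/-- The largest eigenvalue of a symmetric (or Hermitian) matrix. -/
def eigMax {𝕜 ι : Type*} [RCLike 𝕜] [Fintype ι] [DecidableEq ι] (M : Matrix ι ι 𝕜) : ℝ :=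
  sSup (spectrum ℝ M)

/-- The smallest eigenvalue of a symmetric (or Hermitian) matrix. -/
def eigMin {𝕜 ι : Type*} [RCLike 𝕜] [Fintype ι] [DecidableEq ι] (M : Matrix ι ι 𝕜) : ℝ :=
  sInf (spectrum ℝ M)

/-- The set of positions of the zero entries of a matrix. -/
def zeroSet {ι κ : Type*} (X : Matrix ι κ ℝ) : Set (ι × κ) :=
  {st | X st.1 st.2 = 0}

/-- The sign function with the convention `sgn 0 = 1`. -/
def sgn (x : ℝ) : ℝ := if 0 ≤ x then 1 else -1

/-! ### The ARMAX system

Signals are two-sided sequences indexed by `ℤ`. The coefficient `A i` with `i : Fin p` is the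
coefficient `A_{i+1}` of `z^{i+1}` in `A(z)`, the coefficient `B j` is the coefficient `B_{j+1}`
of `z^j` in `B(z)`, and `C ν` is the coefficient `C_{ν+1}` of `z^{ν+1}` in `C(z)`. -/

/-- The row indices of the parameter matrix: `p` blocks of size `n`, then `q` blocks of size `l`,
then `r` blocks of size `n`, altogether `n p + l q + n r` indices. -/
abbrev Idx (n l p q r : ℕ) : Type :=
  (Fin p × Fin n) ⊕ ((Fin q × Fin l) ⊕ (Fin r × Fin n))

/-- The parameter matrix `[-A_1, …, -A_p, B_1, …, B_q, C_1, …, C_r]ᵀ`. -/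
def paramMatrix {n l p q r : ℕ} (A : Fin p → Matrix (Fin n) (Fin n) ℝ)
    (B : Fin q → Matrix (Fin n) (Fin l) ℝ) (C : Fin r → Matrix (Fin n) (Fin n) ℝ) :
    Matrix (Idx n l p q r) (Fin n) ℝ :=
  fun s t =>
    match s with
    | .inl (i, a) => -(A i t a)
    | .inr (.inl (j, b)) => B j t b
    | .inr (.inr (ν, c)) => C ν t c

/-- The stacked vector
`[y_kᵀ, …, y_{k-p+1}ᵀ, u_kᵀ, …, u_{k-q+1}ᵀ, e_kᵀ, …, e_{k-r+1}ᵀ]ᵀ`. -/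
def regressor {n l : ℕ} (p q r : ℕ) (y : ℤ → EuclideanSpace ℝ (Fin n))
    (u : ℤ → EuclideanSpace ℝ (Fin l)) (e : ℤ → EuclideanSpace ℝ (Fin n)) (k : ℤ) :
    Idx n l p q r → ℝ :=
  fun s =>
    match s with
    | .inl (i, a) => y (k - (i : ℕ)) a
    | .inr (.inl (j, b)) => u (k - (j : ℕ)) b
    | .inr (.inr (ν, c)) => e (k - (ν : ℕ)) c

/-- The system equation `A(z) y_{k+1} = B(z) u_k + C(z) w_{k+1}` for all `k ≥ 0`. -/
def IsSystem {n l p q r : ℕ} (A : Fin p → Matrix (Fin n) (Fin n) ℝ)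
    (B : Fin q → Matrix (Fin n) (Fin l) ℝ) (C : Fin r → Matrix (Fin n) (Fin n) ℝ)
    (y : ℤ → EuclideanSpace ℝ (Fin n)) (u : ℤ → EuclideanSpace ℝ (Fin l))
    (w : ℤ → EuclideanSpace ℝ (Fin n)) : Prop :=
  ∀ k : ℤ, 0 ≤ k → ∀ t : Fin n,
    y (k + 1) t + ∑ i : Fin p, ((A i).mulVec (y (k - (i : ℕ)))) t =
      ∑ j : Fin q, ((B j).mulVec (u (k - (j : ℕ)))) t +
        (w (k + 1) t + ∑ ν : Fin r, ((C ν).mulVec (w (k - (ν : ℕ)))) t)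

/-- The matrix polynomial `C(z) = I + C_1 z + ⋯ + C_r z^r` at a complex number `z`. -/
def noisePoly {n r : ℕ} (C : Fin r → Matrix (Fin n) (Fin n) ℝ) (z : ℂ) :
    Matrix (Fin n) (Fin n) ℂ :=
  1 + ∑ ν : Fin r, z ^ ((ν : ℕ) + 1) • (C ν).map (fun x : ℝ => (x : ℂ))

/-- The norm `‖C(z)‖_∞`, whose square is the maximum over `|z| = 1` of the largest eigenvalue of
`C(z) Cᵀ(z⁻¹)`. -/
def noisePolySupNorm {n r : ℕ} (C : Fin r → Matrix (Fin n) (Fin n) ℝ) : ℝ :=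
  Real.sqrt (⨆ z : {z : ℂ // ‖z‖ = 1},
    eigMax (noisePoly C (z : ℂ) * (noisePoly C ((z : ℂ)⁻¹)).transpose))

/-- `D_0, D_1, …` are the coefficients of the expansion `C(z)⁻¹ = ∑ D_i z^i` on `|z| ≤ 1`. -/
def IsInverseExpansion {n r : ℕ} (C : Fin r → Matrix (Fin n) (Fin n) ℝ)
    (D : ℕ → Matrix (Fin n) (Fin n) ℝ) : Prop :=
  ∀ z : ℂ, ‖z‖ ≤ 1 →
    HasSum (fun i : ℕ => z ^ i • (D i).map (fun x : ℝ => (x : ℂ))) (noisePoly C z)⁻¹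

/-- The σ-algebra generated by `y_k, …, y_0, u_{k-1}, …, u_0, w_k, …, w_1`. -/
abbrev sigmaAlg {Ω : Type*} {n l : ℕ} (y : ℤ → Ω → EuclideanSpace ℝ (Fin n))
    (u : ℤ → Ω → EuclideanSpace ℝ (Fin l)) (w : ℤ → Ω → EuclideanSpace ℝ (Fin n)) (k : ℕ) :
    MeasurableSpace Ω :=
  (⨆ j ∈ Set.Icc (0 : ℤ) k, MeasurableSpace.comap (y j) inferInstance) ⊔
    ((⨆ j ∈ Set.Icc (0 : ℤ) (k - 1), MeasurableSpace.comap (u j) inferInstance) ⊔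
      (⨆ j ∈ Set.Icc (1 : ℤ) k, MeasurableSpace.comap (w j) inferInstance))

/-! ### The algorithm

The algorithm acts on sample paths `y`, `u`. It starts with `y_j = 0`, `u_j = 0`, `ŵ_j = 0` for
`j ≤ 0`, whatever the values of the system before time `1` are. -/

/-- The data that the algorithm uses: the signal at times `j ≥ 1`, and zero at times `j ≤ 0`. -/
def dataOf {m : ℕ} (x : ℤ → EuclideanSpace ℝ (Fin m)) : ℤ → EuclideanSpace ℝ (Fin m) :=
  fun j => if 1 ≤ j then x j else 0

/-- What Step 1 of the algorithm has computed up to time `N`: the matrices `P̄_N` and `α_N`, and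
the estimates `ŵ_j` for `j ≤ N` (with value `0` at `j > N`). -/
structure NoiseState (n l p' q' r' : ℕ) where
  P : Matrix (Idx n l p' q' r') (Idx n l p' q' r') ℝ
  α : Matrix (Idx n l p' q' r') (Fin n) ℝ
  what : ℤ → EuclideanSpace ℝ (Fin n)

/-- Step 1 of the algorithm, from time `N` to time `N + 1`. -/
def noiseStep {n l p' q' r' : ℕ} (y : ℤ → EuclideanSpace ℝ (Fin n))
    (u : ℤ → EuclideanSpace ℝ (Fin l)) (N : ℕ) (S : NoiseState n l p' q' r') :
    NoiseState n l p' q' r' :=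
  let ψ : Idx n l p' q' r' → ℝ := regressor p' q' r' (dataOf y) (dataOf u) S.what N
  let b : ℝ := (1 + ψ ⬝ᵥ S.P.mulVec ψ)⁻¹
  let y1 : EuclideanSpace ℝ (Fin n) := dataOf y (N + 1)
  let P1 := S.P - b • (S.P * Matrix.vecMulVec ψ ψ * S.P)
  let α1 := S.α +
    b • Matrix.vecMulVec (S.P.mulVec ψ) (fun t => y1 t - (S.α.transpose.mulVec ψ) t)
  { P := P1
    α := α1
    what := Function.update S.what (N + 1)
      (WithLp.toLp 2 (fun t => y1 t - (α1.transpose.mulVec ψ) t)) }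

/-- Step 1 of the algorithm, started from `P̄_0 = μ⁻¹ I`, `α_0 = 0` and `ŵ_j = 0`. -/
def noiseState {n l : ℕ} (p' q' r' : ℕ) (μ : ℝ) (y : ℤ → EuclideanSpace ℝ (Fin n))
    (u : ℤ → EuclideanSpace ℝ (Fin l)) : ℕ → NoiseState n l p' q' r'
  | 0 => { P := μ⁻¹ • (1 : Matrix _ _ ℝ), α := 0, what := fun _ => 0 }
  | N + 1 => noiseStep y u N (noiseState p' q' r' μ y u N)

/-- The a posteriori estimate `ŵ_j` of the noise. -/
def noiseEst {n l : ℕ} (p' q' r' : ℕ) (μ : ℝ) (y : ℤ → EuclideanSpace ℝ (Fin n))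
    (u : ℤ → EuclideanSpace ℝ (Fin l)) (j : ℤ) : EuclideanSpace ℝ (Fin n) :=
  (noiseState p' q' r' μ y u j.toNat).what j

/-- The regression vector
`φ_k = [y_kᵀ, …, y_{k-p+1}ᵀ, u_kᵀ, …, u_{k-q+1}ᵀ, ŵ_kᵀ, …, ŵ_{k-r+1}ᵀ]ᵀ`,
where the estimates `ŵ_j` come from Step 1 with the enlarged orders `p'`, `q'`, `r'`. -/
def phi {n l : ℕ} (p q r p' q' r' : ℕ) (μ : ℝ) (y : ℤ → EuclideanSpace ℝ (Fin n))
    (u : ℤ → EuclideanSpace ℝ (Fin l)) (k : ℕ) : Idx n l p q r → ℝ :=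
  regressor p q r (dataOf y) (dataOf u) (noiseEst p' q' r' μ y u) k

/-- The matrix `μ I + ∑_{k=1}^N φ_k φ_kᵀ`. -/
def infoMatrix {ι : Type*} [Fintype ι] [DecidableEq ι] (μ : ℝ) (φ : ℕ → ι → ℝ) (N : ℕ) :
    Matrix ι ι ℝ :=
  μ • (1 : Matrix ι ι ℝ) + ∑ k ∈ Finset.Icc 1 N, Matrix.vecMulVec (φ k) (φ k)

/-- `λ_max(N)`, the largest eigenvalue of `μ I + ∑_{k=1}^N φ_k φ_kᵀ`. -/
def lamMax {ι : Type*} [Fintype ι] [DecidableEq ι] (μ : ℝ) (φ : ℕ → ι → ℝ) (N : ℕ) : ℝ :=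
  eigMax (infoMatrix μ φ N)

/-- `λ_min(N)`, the smallest eigenvalue of `μ I + ∑_{k=1}^N φ_k φ_kᵀ`. -/
def lamMin {ι : Type*} [Fintype ι] [DecidableEq ι] (μ : ℝ) (φ : ℕ → ι → ℝ) (N : ℕ) : ℝ :=
  eigMin (infoMatrix μ φ N)

/-- What Steps 2 and 3 of the algorithm carry at time `N`: `P_N`, `Θ_N`, `Ξ_N`, `Ξ_{N-1}`. -/
structure SparseState (ι κ : Type*) where
  P : Matrix ι ι ℝ
  Θ : Matrix ι κ ℝ
  Ξ : Matrix ι κ ℝ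
  Ξprev : Matrix ι κ ℝ

/-- Steps 2 and 3 of the algorithm, from time `N` to time `N + 1`. The arguments are the tuning
parameter `μ`, the coefficients `lam N`, the regression vectors `φ` and the outputs `y`. -/
def sparseStep {ι : Type*} [Fintype ι] [DecidableEq ι] {n : ℕ} (μ : ℝ) (lam : ℕ → ℝ)
    (φ : ℕ → ι → ℝ) (y : ℤ → EuclideanSpace ℝ (Fin n)) (N : ℕ) (S : SparseState ι (Fin n)) :
    SparseState ι (Fin n) :=
  let a : ℝ := (1 + φ N ⬝ᵥ S.P.mulVec (φ N))⁻¹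
  let P1 := S.P - a • (S.P * Matrix.vecMulVec (φ N) (φ N) * S.P)
  let y1 : EuclideanSpace ℝ (Fin n) := dataOf y (N + 1)
  let Θ1 := S.Θ +
    a • Matrix.vecMulVec (S.P.mulVec (φ N)) (fun t => y1 t - (S.Θ.transpose.mulVec (φ N)) t) +
    μ • (P1 * (S.Ξ - S.Ξprev))
  let Θhat : Matrix ι (Fin n) ℝ := fun s t =>
    Θ1 s t + sgn (Θ1 s t) * Real.sqrt (Real.log (lamMax μ φ N) / lamMin μ φ N)
  { P := P1
    Θ := Θ1
    Ξ := fun s t => sgn (Θ1 s t) * max (|Θ1 s t| - lam N / (μ * |Θhat s t|)) 0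
    Ξprev := S.Ξ }

/-- Steps 2 and 3 of the algorithm, started from `P_0 = μ⁻¹ I`, `Θ_0 = Ξ_0 = Ξ_{-1} = 0`. -/
def sparseState {ι : Type*} [Fintype ι] [DecidableEq ι] {n : ℕ} (μ : ℝ) (lam : ℕ → ℝ)
    (φ : ℕ → ι → ℝ) (y : ℤ → EuclideanSpace ℝ (Fin n)) : ℕ → SparseState ι (Fin n)
  | 0 => { P := μ⁻¹ • (1 : Matrix ι ι ℝ), Θ := 0, Ξ := 0, Ξprev := 0 }
  | N + 1 => sparseStep μ lam φ y N (sparseState μ lam φ y N)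

/-- The sparse estimate `Ξ_N` that the algorithm produces from the sample paths `y`, `u`. -/
def sparseEst {n l : ℕ} (p q r p' q' r' : ℕ) (μ : ℝ) (lam : ℕ → ℝ)
    (y : ℤ → EuclideanSpace ℝ (Fin n)) (u : ℤ → EuclideanSpace ℝ (Fin l)) (N : ℕ) :
    Matrix (Idx n l p q r) (Fin n) ℝ :=
  (sparseState μ lam (phi p q r p' q' r' μ y u) y N).Ξ

end SparseARMAX

end

noncomputable section

namespace SparseARMAX

/-! ### Summation lemmas -/

/-! Write `φ` for the regressors of Step 2, `ψ` for the longer ones of Step 1, `v` for the true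
noise and `ξ = ŵ - w` for the error of the noise estimates. Two facts about predictable multipliers
of `v` replace the law of large numbers. First, `∑ ⟪g_k, v_k⟫` is at most `ε ∑ ‖g_k‖² + C` on almost
every path (`IsNoise.ae_abs_sum_inner_le`). Second, `∑ a_k ‖v_k‖²` is at most a multiple of `1 + ∑
a_k` when `0 ≤ a_k ≤ 1` (`IsNoise.ae_sum_mul_sq_le`); this is where `β > 2` does its work.

For least squares whose noise is `v + e` with `e` predictable, the quadratic form of the parameter
error in the information matrix is a Lyapunov function. The leverages sum to at most a
log-determinant. Together with the two facts this gives an energy inequality with a logarithmic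
right-hand side, `ae_columnForm_add_sum_le`, in which the a posteriori prediction errors `g` and the
perturbation `e` enter through `‖g‖² + 2⟪g, e⟫`.

In Step 1 the system is multiplied by the truncated inverse `F(z) = ∑_{i ≤ h} D_i z^i`. The enlarged
orders hold the product, whose noise polynomial `F C` is close to the identity. Here `ξ = g + e`,
where `e` is the moving average of past values of `ξ` with symbol `I - F C`. The energy term is then
`‖ξ‖² - ‖e‖²`. By Parseval `e` has `ℓ²` norm at most `γ` times that of `ξ`, and the condition on `h`
says precisely that `γ < 1` (`residual_gain_lt_one`). So `∑ ‖ξ_k‖²` is logarithmic, without any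
positive real condition on `C` (`ae_sum_noiseError_sq_le`).

In Step 2, subtracting `μ P_N Ξ_{N-1}` from `Θ_N` leaves ordinary least squares with the regressors
`φ` (`isLeastSquares_sparseState`). The perturbation is now `(I - C)` applied to `ξ`, whose energy
is already known, so the Lyapunov function is `O(log λ_max)` and the error of these estimates is
`O(ρ)` with `ρ = √(log λ_max / λ_min)`. Passing from `ψ` back to `φ` in the logarithm is a
comparison of traces (`exists_log_det_le`).

The term that was subtracted has norm at most `μ / λ_min` times that of the previous estimate,
because thresholding only shrinks. Hence the estimates stay bounded and the term is `O(ρ)`. Finally,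
each entry is thresholded separately (`isBigO_threshold`). A zero entry has `|x| (|x| + ρ) = O(ρ²)`,
negligible against `λ_N`, and is removed. A nonzero entry moves by `O(λ_N) = O(ρ)` and survives. -/

lemma one_sub_le_rpow_neg {η : ℝ} (hη : 0 < η) {s t : ℝ} (hs : 0 < s) (hst : s ≤ t) :
    (t - s) * t ^ (-(1 + η)) ≤ η⁻¹ * (s ^ (-η) - t ^ (-η)) := by
  have ht : 0 < t := hs.trans_le hst
  -- With `x = s / t`: `x ^ (-η) = exp (-η log x) ≥ 1 - η log x ≥ 1 + η (1 - x)`. The lemma compares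
  -- the integral of `τ ^ (-(1 + η))` over `[s, t]` with its value at the right end.
  have h1 : η * (1 - s / t) ≤ (s / t) ^ (-η) - 1 := by
    have hx : 0 < s / t := div_pos hs ht
    have h2 : Real.log (s / t) ≤ s / t - 1 := Real.log_le_sub_one_of_pos hx
    have h3 : Real.log (s / t) * (-η) + 1 ≤ Real.exp (Real.log (s / t) * (-η)) :=
      Real.add_one_le_exp _
    rw [Real.rpow_def_of_pos hx]
    nlinarith
  have h4 : (s / t) ^ (-η) = s ^ (-η) * t ^ η := by
    rw [Real.div_rpow hs.le ht.le, Real.rpow_neg ht.le, div_inv_eq_mul]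
  have h5 : t ^ (-(1 + η)) = t⁻¹ * t ^ (-η) := by
    rw [neg_add, Real.rpow_add ht, Real.rpow_neg_one]
  have h6 : t ^ η * t ^ (-η) = 1 := by
    rw [← Real.rpow_add ht]; simp
  have h7 : 0 < t ^ (-η) := Real.rpow_pos_of_pos ht _
  rw [h4] at h1
  rw [h5, ← mul_le_mul_iff_right₀ hη, mul_inv_cancel_left₀ hη.ne']
  calc η * ((t - s) * (t⁻¹ * t ^ (-η))) = η * (1 - s / t) * t ^ (-η) := by
        field_simp
    _ ≤ (s ^ (-η) * t ^ η - 1) * t ^ (-η) := by gcongr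
    _ = s ^ (-η) * (t ^ η * t ^ (-η)) - t ^ (-η) := by ring
    _ = s ^ (-η) - t ^ (-η) := by rw [h6, mul_one]

/-- If `S_k = 1 + a_0 + ⋯ + a_k` then `∑ a_k / S_k ^ (1 + η)` is bounded by `η⁻¹`. -/
lemma sum_mul_rpow_neg_le {η : ℝ} (hη : 0 < η) (a : ℕ → ℝ) (ha : ∀ k, 0 ≤ a k) (N : ℕ) :
    ∑ k ∈ Finset.range N, a k * (1 + ∑ j ∈ Finset.range (k + 1), a j) ^ (-(1 + η)) ≤ η⁻¹ := by
  set S : ℕ → ℝ := fun k => 1 + ∑ j ∈ Finset.range k, a j with hS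
  have hpos : ∀ k, 0 < S k := fun k =>
    add_pos_of_pos_of_nonneg one_pos (Finset.sum_nonneg fun j _ => ha j)
  have hstep : ∀ k, S (k + 1) = S k + a k := fun k => by
    simp only [hS, Finset.sum_range_succ]; ring
  have key : ∑ k ∈ Finset.range N, a k * S (k + 1) ^ (-(1 + η)) ≤
      η⁻¹ * (1 - S N ^ (-η)) := by
    induction N with
    | zero => simp [hS]
    | succ N ih =>
      rw [Finset.sum_range_succ]
      have := one_sub_le_rpow_neg hη (hpos N) (t := S (N + 1)) (by rw [hstep]; linarith [ha N])
      have h2 : S (N + 1) - S N = a N := by rw [hstep]; ring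
      rw [h2] at this
      linarith
  refine key.trans ?_
  have : 0 < S N ^ (-η) := Real.rpow_pos_of_pos (hpos N) _
  have h3 : 0 < η⁻¹ := inv_pos.2 hη
  nlinarith

/-- **Kronecker's lemma**, in the form of a bound. -/
lemma kronecker_bound {x : ℕ → ℝ} {c : ℝ}
    (hx : Tendsto (fun N => ∑ k ∈ Finset.range N, x k) atTop (𝓝 c))
    {b : ℕ → ℝ} (hb : Monotone b) (hb0 : ∀ k, 0 ≤ b k) {ε : ℝ} (hε : 0 < ε) :
    ∃ C : ℝ, ∀ N, |∑ k ∈ Finset.range N, b (k + 1) * x k| ≤ ε * b N + C := by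
  set y : ℕ → ℝ := fun N => ∑ k ∈ Finset.range N, x k - c with hy
  have hy0 : Tendsto y atTop (𝓝 0) := by simpa [hy] using hx.sub_const c
  have hxy : ∀ k, x k = y (k + 1) - y k := fun k => by
    simp only [hy, Finset.sum_range_succ]; ring
  obtain ⟨Y, hY⟩ := hy0.abs.bddAbove_range
  have hY : ∀ k, |y k| ≤ Y := fun k => hY ⟨k, rfl⟩
  have hY0 : 0 ≤ Y := (abs_nonneg _).trans (hY 0)
  obtain ⟨K, hK⟩ : ∃ K, ∀ k, K ≤ k → |y k| ≤ ε / 2 := by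
    have := hy0.abs
    rw [abs_zero] at this
    exact eventually_atTop.1 (this.eventually_le_const (half_pos hε))
  have hbd : ∀ N, b N * |y N| ≤ Y * b K + ε / 2 * b N := fun N => by
    rcases le_total K N with h | h
    · nlinarith [mul_le_mul_of_nonneg_left (hK N h) (hb0 N), mul_nonneg hY0 (hb0 K)]
    · nlinarith [mul_le_mul (hb h) (hY N) (abs_nonneg _) (hb0 K), mul_nonneg hε.le (hb0 N)]
  -- Summation by parts against the remainders `y`. The increments of `b` up to the index `K` are
  -- charged at the global bound `Y`, the later ones at `ε / 2`; hence the `min`.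
  have key : ∀ N, |∑ k ∈ Finset.range N, b (k + 1) * x k - b N * y N| ≤
      Y * b (min N K) + ε / 2 * b N + Y * b 0 := by
    intro N
    induction N with
    | zero =>
      simp only [Finset.range_zero, Finset.sum_empty, zero_sub, abs_neg, abs_mul,
        abs_of_nonneg (hb0 0)]
      nlinarith [mul_le_mul_of_nonneg_left (hY 0) (hb0 0), mul_nonneg hε.le (hb0 0),
        mul_nonneg hY0 (hb0 (min 0 K))]
    | succ N ih =>
      have e : ∑ k ∈ Finset.range (N + 1), b (k + 1) * x k - b (N + 1) * y (N + 1) =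
          (∑ k ∈ Finset.range N, b (k + 1) * x k - b N * y N) - (b (N + 1) - b N) * y N := by
        rw [Finset.sum_range_succ, hxy N]; ring
      have hd : 0 ≤ b (N + 1) - b N := sub_nonneg.2 (hb N.le_succ)
      rw [e]
      refine (abs_sub _ _).trans ?_
      rw [abs_mul, abs_of_nonneg hd]
      rcases le_or_gt K N with h | h
      · rw [min_eq_right h] at ih
        rw [min_eq_right (h.trans N.le_succ)]
        nlinarith [mul_le_mul_of_nonneg_left (hK N h) hd]
      · rw [min_eq_left h.le] at ih
        rw [min_eq_left h]
        nlinarith [mul_le_mul_of_nonneg_left (hY N) hd, mul_nonneg hε.le hd]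
  refine ⟨2 * Y * b K + Y * b 0, fun N => ?_⟩
  have h1 := key N
  have h2 := hbd N
  have h3 : Y * b (min N K) ≤ Y * b K := mul_le_mul_of_nonneg_left (hb (min_le_right _ _)) hY0
  have h4 := abs_add_le (∑ k ∈ Finset.range N, b (k + 1) * x k - b N * y N) (b N * y N)
  rw [sub_add_cancel, abs_mul, abs_of_nonneg (hb0 N)] at h4
  linarith

/-! ### Convergence of square integrable martingales -/

variable {Ω : Type*} {m m0 : MeasurableSpace Ω} {ℙ : Measure Ω}

/-- Martingale differences are orthogonal, so the second moments of the partial sums are the sums of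
those of the increments. A bound in `L²` gives one in `L¹`, and Doob's convergence theorem applies.
-/
lemma ae_exists_tendsto_sum [IsProbabilityMeasure ℙ] (ℱ : Filtration ℕ m0) (x : ℕ → Ω → ℝ)
    (hm : ∀ k, StronglyMeasurable[ℱ (k + 1)] (x k)) (hL : ∀ k, MemLp (x k) 2 ℙ)
    (h0 : ∀ k, ℙ[x k | ℱ k] =ᵐ[ℙ] 0) (B : ℝ)
    (hB : ∀ N, ∑ k ∈ Finset.range N, ∫ ω, x k ω ^ 2 ∂ℙ ≤ B) :
    ∀ᵐ ω ∂ℙ, ∃ c, Tendsto (fun N => ∑ k ∈ Finset.range N, x k ω) atTop (𝓝 c) := by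
  set f : ℕ → Ω → ℝ := fun N ω => ∑ k ∈ Finset.range N, x k ω with hf
  have hsucc : ∀ N, f (N + 1) = f N + x N := fun N => by
    ext ω; simp [hf, Finset.sum_range_succ]
  have hfL : ∀ N, MemLp (f N) 2 ℙ := fun N => memLp_finsetSum _ fun k _ => hL k
  have hadp : StronglyAdapted ℱ f := fun N =>
    Finset.stronglyMeasurable_fun_sum _ fun k hk =>
      (hm k).mono (ℱ.mono (Finset.mem_range.1 hk))
  have hint : ∀ N, Integrable (f N) ℙ := fun N => (hfL N).integrable one_le_two
  have hmart : Martingale f ℱ ℙ := martingale_of_condExp_sub_eq_zero_nat hadp hint fun N => by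
    rw [hsucc, add_sub_cancel_left]; exact h0 N
  have horth : ∀ N, ∫ ω, f N ω * x N ω ∂ℙ = 0 := fun N => by
    have hi : Integrable (f N * x N) ℙ := (hfL N).integrable_mul (hL N)
    have h1 : ℙ[f N * x N | ℱ N] =ᵐ[ℙ] f N * ℙ[x N | ℱ N] :=
      condExp_mul_of_stronglyMeasurable_left (hadp N) hi ((hL N).integrable one_le_two)
    have h2 : ℙ[f N * x N | ℱ N] =ᵐ[ℙ] 0 := by
      filter_upwards [h1, h0 N] with ω h1 h2
      rw [h1, Pi.mul_apply, h2]; simp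
    calc ∫ ω, f N ω * x N ω ∂ℙ = ∫ ω, (ℙ[f N * x N | ℱ N]) ω ∂ℙ :=
          (integral_condExp (ℱ.le N)).symm
      _ = 0 := by rw [integral_congr_ae h2]; simp
  have hsq : ∀ N, ∫ ω, f N ω ^ 2 ∂ℙ ≤ B := fun N => by
    refine le_trans (le_of_eq ?_) (hB N)
    induction N with
    | zero => simp [hf]
    | succ N ih =>
      rw [Finset.sum_range_succ, ← ih]
      have e : ∀ ω, f (N + 1) ω ^ 2 = f N ω ^ 2 + 2 * (f N ω * x N ω) + x N ω ^ 2 := fun ω => by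
        rw [hsucc, Pi.add_apply]; ring
      have hi : Integrable (fun ω => f N ω * x N ω) ℙ := (hfL N).integrable_mul (hL N)
      simp_rw [e]
      have h1 : Integrable (fun ω => f N ω ^ 2 + 2 * (f N ω * x N ω)) ℙ :=
        (hfL N).integrable_sq.add (hi.const_mul 2)
      rw [integral_add h1 (hL N).integrable_sq,
        integral_add (hfL N).integrable_sq (hi.const_mul 2), integral_const_mul, horth]
      ring
  refine hmart.submartingale.exists_ae_tendsto_of_bdd (R := (1 + B).toNNReal) fun N => ?_
  rw [eLpNorm_one_eq_lintegral_enorm, ← ofReal_integral_norm_eq_lintegral_enorm (hint N)]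
  refine ENNReal.ofReal_le_ofReal ?_
  calc ∫ ω, ‖f N ω‖ ∂ℙ ≤ ∫ ω, (1 + f N ω ^ 2) ∂ℙ := by
        refine integral_mono (hint N).norm ((integrable_const 1).add (hfL N).integrable_sq)
          fun ω => ?_
        simp only [Real.norm_eq_abs]
        nlinarith [sq_abs (f N ω), sq_nonneg (|f N ω| - 1)]
    _ = 1 + ∫ ω, f N ω ^ 2 ∂ℙ := by
        rw [integral_add (integrable_const 1) (hfL N).integrable_sq]; simp
    _ ≤ 1 + B := by gcongr; exact hsq N

/-! ### The conditional Lebesgue expectation -/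

/-- The measures with densities `X` and its conditional expectation agree on `m`, hence give every
`m`-measurable `f` the same integral. No integrability is needed. -/
lemma lintegral_mul_condLExp (hm : m ≤ m0) [IsFiniteMeasure ℙ]
    {f X : Ω → ℝ≥0∞} (hf : Measurable[m] f) (hX : Measurable X) :
    ∫⁻ ω, f ω * condLExp m ℙ X ω ∂ℙ = ∫⁻ ω, f ω * X ω ∂ℙ := by
  have hc : Measurable (condLExp m ℙ X) := measurable_condLExp' m ℙ X
  have hEq : (ℙ.withDensity X).trim hm = (ℙ.withDensity (condLExp m ℙ X)).trim hm := by
    refine @Measure.ext _ m _ _ fun s hs => ?_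
    rw [trim_measurableSet_eq hm hs, trim_measurableSet_eq hm hs, withDensity_apply _ (hm s hs),
      withDensity_apply _ (hm s hs), setLIntegral_condLExp hm ℙ X hs]
  have hf' : Measurable f := hf.mono hm le_rfl
  calc ∫⁻ ω, f ω * condLExp m ℙ X ω ∂ℙ = ∫⁻ ω, f ω ∂(ℙ.withDensity (condLExp m ℙ X)) := by
        rw [lintegral_withDensity_eq_lintegral_mul _ hc hf']
        simp [mul_comm]
    _ = ∫⁻ ω, f ω ∂(ℙ.withDensity X) := by
        rw [← lintegral_trim hm hf, ← hEq, lintegral_trim hm hf]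
    _ = ∫⁻ ω, f ω * X ω ∂ℙ := by
        rw [lintegral_withDensity_eq_lintegral_mul _ hX hf']
        simp [mul_comm]

lemma condLExp_mul_left (hm : m ≤ m0) [IsFiniteMeasure ℙ]
    {f X : Ω → ℝ≥0∞} (hf : Measurable[m] f) (hX : Measurable X) :
    condLExp m ℙ (fun ω => f ω * X ω) =ᵐ[ℙ] fun ω => f ω * condLExp m ℙ X ω := by
  refine (ae_eq_condLExp hm ℙ _ (hf.mul (measurable_condLExp m ℙ X)) fun s hs => ?_).symm
  have h := lintegral_mul_condLExp (ℙ := ℙ) hm (hf.indicator hs) hX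
  rw [← lintegral_indicator (hm s hs), ← lintegral_indicator (hm s hs)]
  convert h using 2 <;> · ext ω; by_cases hω : ω ∈ s <;> simp [hω]

/-- The integral of `f X` when `f` is measurable with respect to `m` and vanishes where the
conditional expectation of `X` exceeds `L`. -/
lemma lintegral_mul_le_of_condLExp_le (hm : m ≤ m0) [IsFiniteMeasure ℙ]
    {f X : Ω → ℝ≥0∞} (hf : Measurable[m] f) (hX : Measurable X) (L : ℝ≥0∞)
    (h : ∀ ω, f ω ≠ 0 → condLExp m ℙ X ω ≤ L) :
    ∫⁻ ω, f ω * X ω ∂ℙ ≤ L * ∫⁻ ω, f ω ∂ℙ := by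
  rw [← lintegral_mul_condLExp hm hf hX, ← lintegral_const_mul _ (hf.mono hm le_rfl)]
  refine lintegral_mono fun ω => ?_
  rcases eq_or_ne (f ω) 0 with h0 | h0
  · simp [h0]
  · rw [mul_comm]; gcongr; exact h ω h0

/-! ### Almost sure bounds for sums driven by martingale difference noise. -/

variable {Ω : Type*} {m m0 : MeasurableSpace Ω} {ℙ : Measure Ω}

/-- With extended integrals, membership in `L²` is part of the bound and needs no separate check. -/
lemma ae_exists_tendsto_sum_of_lintegral_le [IsProbabilityMeasure ℙ] (ℱ : Filtration ℕ m0)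
    (x : ℕ → Ω → ℝ) (hm : ∀ k, Measurable[ℱ (k + 1)] (x k))
    (h0 : ∀ k, ℙ[x k | ℱ k] =ᵐ[ℙ] 0) {B : ℝ≥0∞} (hB : B ≠ ∞)
    (h : ∀ N, ∑ k ∈ Finset.range N, ∫⁻ ω, ‖x k ω‖ₑ ^ 2 ∂ℙ ≤ B) :
    ∀ᵐ ω ∂ℙ, ∃ c, Tendsto (fun N => ∑ k ∈ Finset.range N, x k ω) atTop (𝓝 c) := by
  have hmeas : ∀ k, Measurable (x k) := fun k => (hm k).mono (ℱ.le _) le_rfl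
  have hle : ∀ k, ∫⁻ ω, ‖x k ω‖ₑ ^ 2 ∂ℙ ≤ B := fun k =>
    (Finset.single_le_sum (f := fun k => ∫⁻ ω, ‖x k ω‖ₑ ^ 2 ∂ℙ) (fun _ _ => zero_le)
      (Finset.mem_range.2 k.lt_succ_self)).trans (h (k + 1))
  have hL : ∀ k, MemLp (x k) 2 ℙ := fun k => by
    refine ⟨(hmeas k).aestronglyMeasurable, ?_⟩
    rw [eLpNorm_lt_top_iff_lintegral_rpow_enorm_lt_top two_ne_zero ENNReal.ofNat_ne_top]
    simpa using (hle k).trans_lt hB.lt_top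
  have hint : ∀ k, ENNReal.ofReal (∫ ω, x k ω ^ 2 ∂ℙ) = ∫⁻ ω, ‖x k ω‖ₑ ^ 2 ∂ℙ := fun k => by
    rw [ofReal_integral_eq_lintegral_ofReal (hL k).integrable_sq
      (ae_of_all _ fun ω => sq_nonneg _)]
    refine lintegral_congr fun ω => ?_
    rw [← sq_abs, ENNReal.ofReal_pow (abs_nonneg _), Real.enorm_eq_ofReal_abs]
  refine ae_exists_tendsto_sum ℱ x (fun k => (hm k).stronglyMeasurable) hL h0 B.toReal fun N => ?_
  rw [← ENNReal.ofReal_le_iff_le_toReal hB, ENNReal.ofReal_sum_of_nonneg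
    fun k _ => integral_nonneg fun ω => sq_nonneg _]
  simpa only [hint] using h N

variable {n : ℕ}

/-- A martingale difference sequence `v_0, v_1, …` (with `v_k` measurable at time `k + 1`) whose
conditional moments of order `β` are almost surely bounded. -/
structure IsNoise (ℙ : Measure Ω) (ℱ : Filtration ℕ m0) (β : ℝ)
    (v : ℕ → Ω → EuclideanSpace ℝ (Fin n)) : Prop where
  meas : ∀ k, Measurable[ℱ (k + 1)] (v k)
  integrable : ∀ k, Integrable (v k) ℙ
  condExp_eq_zero : ∀ k, ℙ[v k | ℱ k] =ᵐ[ℙ] 0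
  moment : ∀ᵐ ω ∂ℙ, ⨆ k, condLExp (ℱ k) ℙ (fun ω' => ‖v k ω'‖ₑ ^ β) ω < ∞

lemma sq_le_one_add_rpow {β : ℝ} (hβ : 2 < β) (t : ℝ≥0∞) : t ^ 2 ≤ 1 + t ^ β := by
  rcases le_total t 1 with h | h
  · exact (pow_le_one₀ zero_le h).trans le_self_add
  · refine le_trans ?_ le_add_self
    rw [← ENNReal.rpow_natCast]
    exact ENNReal.rpow_le_rpow_of_exponent_le h (by exact_mod_cast hβ.le)

namespace IsNoise

variable {ℱ : Filtration ℕ m0} {β : ℝ} {v : ℕ → Ω → EuclideanSpace ℝ (Fin n)}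

lemma measurable (hv : IsNoise ℙ ℱ β v) (k : ℕ) : Measurable (v k) :=
  (hv.meas k).mono (ℱ.le _) le_rfl

lemma measurable_moment (hv : IsNoise ℙ ℱ β v) (k : ℕ) :
    Measurable fun ω => 1 + ‖v k ω‖ₑ ^ β :=
  measurable_const.add ((hv.measurable k).enorm.pow_const _)

/-- The conditional moments have only a random bound. The later arguments truncate at a
deterministic integer level `L` and use that almost every path is untouched by some level. The added
`1` lets the same bound dominate second moments. -/
lemma ae_exists_condLExp_le [IsProbabilityMeasure ℙ] (hv : IsNoise ℙ ℱ β v) :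
    ∀ᵐ ω ∂ℙ, ∃ L : ℕ, ∀ k, condLExp (ℱ k) ℙ (fun ω' => 1 + ‖v k ω'‖ₑ ^ β) ω ≤ L := by
  have h1 : ∀ᵐ ω ∂ℙ, ∀ k, condLExp (ℱ k) ℙ (fun ω' => 1 + ‖v k ω'‖ₑ ^ β) ω =
      1 + condLExp (ℱ k) ℙ (fun ω' => ‖v k ω'‖ₑ ^ β) ω := by
    refine ae_all_iff.2 fun k => ?_
    have := condLExp_add_left (mΩ := ℱ k) (P := ℙ) (X := fun _ => (1 : ℝ≥0∞))
      (fun ω' => ‖v k ω'‖ₑ ^ β) aemeasurable_const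
    rw [condLExp_const (ℱ.le k)] at this
    exact this
  filter_upwards [h1, hv.moment] with ω h1 h2
  obtain ⟨L, hL⟩ := ENNReal.exists_nat_gt h2.ne
  refine ⟨1 + L, fun k => ?_⟩
  rw [h1 k]
  push_cast
  gcongr
  exact (le_iSup (fun k => condLExp (ℱ k) ℙ (fun ω' => ‖v k ω'‖ₑ ^ β) ω) k).trans hL.le

/-- A sum of predictable multiples of the noise is small compared with the sum of the squares of
the multipliers. -/
theorem ae_abs_sum_inner_le [IsProbabilityMeasure ℙ] (hβ : 2 < β) (hv : IsNoise ℙ ℱ β v)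
    (g : ℕ → Ω → EuclideanSpace ℝ (Fin n)) (hg : ∀ k, Measurable[ℱ k] (g k)) :
    ∀ᵐ ω ∂ℙ, ∀ ε : ℝ, 0 < ε → ∃ C : ℝ, ∀ N,
      |∑ k ∈ Finset.range N, inner ℝ (g k ω) (v k ω)| ≤
        ε * ∑ k ∈ Finset.range N, ‖g k ω‖ ^ 2 + C := by
  -- `S (k + 1)` already contains `g k` and is still known at time `k`. Dividing by it makes the
  -- squares of the multipliers sum to at most `1`, by `sum_mul_rpow_neg_le` with `η = 1`.
  set S : ℕ → Ω → ℝ := fun k ω => 1 + ∑ j ∈ Finset.range k, ‖g j ω‖ ^ 2 with hS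
  have hSpos : ∀ k ω, 0 < S k ω := fun k ω =>
    add_pos_of_pos_of_nonneg one_pos (Finset.sum_nonneg fun j _ => sq_nonneg _)
  have hSm : ∀ k, Measurable[ℱ k] (S (k + 1)) := fun k => by
    refine measurable_const.add (Finset.measurable_fun_sum _ fun j hj => ?_)
    exact (measurable_norm.comp ((hg j).mono
      (ℱ.mono (Nat.lt_succ_iff.1 (Finset.mem_range.1 hj))) le_rfl)).pow_const 2
  set q : ℕ → Ω → ℝ≥0∞ := fun k => condLExp (ℱ k) ℙ (fun ω' => 1 + ‖v k ω'‖ₑ ^ β) with hq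
  have hqm : ∀ k, Measurable[ℱ k] (q k) := fun k => measurable_condLExp _ _ _
  -- The multiplier is set to zero where the conditional moment exceeds `L`, an event known at time
  -- `k`; the variances then sum to at most `L`.
  have hconv : ∀ L : ℕ, ∀ᵐ ω ∂ℙ, ∃ c, Tendsto (fun N => ∑ k ∈ Finset.range N,
      inner ℝ ((if q k ω ≤ L then (S (k + 1) ω)⁻¹ else 0) • g k ω) (v k ω)) atTop (𝓝 c) := by
    intro L
    set c : ℕ → Ω → EuclideanSpace ℝ (Fin n) := fun k ω =>
      (if q k ω ≤ L then (S (k + 1) ω)⁻¹ else 0) • g k ω with hc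
    have hcm : ∀ k, Measurable[ℱ k] (c k) := fun k =>
      (Measurable.ite ((hqm k) measurableSet_Iic) (hSm k).inv measurable_const).smul (hg k)
    have hcle : ∀ k ω, ‖c k ω‖ₑ ^ 2 ≤
        ENNReal.ofReal (‖g k ω‖ ^ 2 * S (k + 1) ω ^ (-(1 + 1) : ℝ)) := fun k ω => by
      rw [← ofReal_norm, ← ENNReal.ofReal_pow (norm_nonneg _)]
      refine ENNReal.ofReal_le_ofReal ?_
      have h1 : S (k + 1) ω ^ (-(1 + 1) : ℝ) = ((S (k + 1) ω)⁻¹) ^ 2 := by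
        rw [Real.rpow_neg (hSpos _ _).le, inv_pow]
        norm_num
      rw [hc, norm_smul, mul_pow, mul_comm, h1]
      gcongr
      split_ifs
      · rw [Real.norm_of_nonneg (inv_nonneg.2 (hSpos _ _).le)]
      · simpa using (hSpos _ _).le
    have hxle : ∀ k, ∫⁻ ω, ‖(inner ℝ (c k ω) (v k ω) : ℝ)‖ₑ ^ 2 ∂ℙ ≤
        L * ∫⁻ ω, ‖c k ω‖ₑ ^ 2 ∂ℙ := fun k => by
      refine le_trans (lintegral_mono fun ω => ?_)
        (lintegral_mul_le_of_condLExp_le (ℱ.le k) ((measurable_enorm.comp (hcm k)).pow_const 2)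
          (hv.measurable_moment k) L fun ω hω => ?_)
      · have h1 : ‖(inner ℝ (c k ω) (v k ω) : ℝ)‖ₑ ≤ ‖c k ω‖ₑ * ‖v k ω‖ₑ := by
          rw [← ofReal_norm, ← ofReal_norm, ← ofReal_norm, ← ENNReal.ofReal_mul (norm_nonneg _)]
          exact ENNReal.ofReal_le_ofReal (norm_inner_le_norm _ _)
        calc ‖(inner ℝ (c k ω) (v k ω) : ℝ)‖ₑ ^ 2 ≤ (‖c k ω‖ₑ * ‖v k ω‖ₑ) ^ 2 := by gcongr
          _ = ‖c k ω‖ₑ ^ 2 * ‖v k ω‖ₑ ^ 2 := mul_pow _ _ _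
          _ ≤ _ := mul_le_mul' le_rfl (sq_le_one_add_rpow hβ _)
      · by_contra hcon
        have hcon' : ¬ q k ω ≤ L := hcon
        exact hω (by simp [hc, hcon'])
    have hsum : ∀ N, ∑ k ∈ Finset.range N, ∫⁻ ω, ‖(inner ℝ (c k ω) (v k ω) : ℝ)‖ₑ ^ 2 ∂ℙ ≤ L :=
      fun N => by
      calc _ ≤ ∑ k ∈ Finset.range N, L * ∫⁻ ω, ‖c k ω‖ₑ ^ 2 ∂ℙ :=
            Finset.sum_le_sum fun k _ => hxle k
        _ = L * ∫⁻ ω, ∑ k ∈ Finset.range N, ‖c k ω‖ₑ ^ 2 ∂ℙ := by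
            rw [← Finset.mul_sum, lintegral_finsetSum]
            exact fun k _ => ((hcm k).mono (ℱ.le k) le_rfl).enorm.pow_const 2
        _ ≤ L * ∫⁻ _, 1 ∂ℙ := by
            gcongr with ω
            refine (Finset.sum_le_sum fun k _ => hcle k ω).trans ?_
            rw [← ENNReal.ofReal_sum_of_nonneg fun k _ => mul_nonneg (sq_nonneg _)
              (Real.rpow_nonneg (hSpos _ _).le _), ← ENNReal.ofReal_one]
            refine ENNReal.ofReal_le_ofReal ?_
            simpa using sum_mul_rpow_neg_le one_pos (fun k => ‖g k ω‖ ^ 2)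
              (fun k => sq_nonneg _) N
        _ = L := by simp
    refine ae_exists_tendsto_sum_of_lintegral_le ℱ _ (fun k => ?_) (fun k => ?_)
      (ENNReal.natCast_ne_top L) hsum
    · exact ((hcm k).mono (ℱ.mono k.le_succ) le_rfl).inner (hv.meas k)
    · have hL1 : Integrable (fun ω => (inner ℝ (c k ω) (v k ω) : ℝ)) ℙ := by
        have hmeas : Measurable fun ω => (inner ℝ (c k ω) (v k ω) : ℝ) :=
          ((hcm k).mono (ℱ.le k) le_rfl).inner (hv.measurable k)
        refine MemLp.integrable (q := 2) one_le_two ⟨hmeas.aestronglyMeasurable, ?_⟩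
        rw [eLpNorm_lt_top_iff_lintegral_rpow_enorm_lt_top two_ne_zero ENNReal.ofNat_ne_top]
        have := (Finset.single_le_sum
          (f := fun k => ∫⁻ ω, ‖(inner ℝ (c k ω) (v k ω) : ℝ)‖ₑ ^ 2 ∂ℙ) (fun _ _ => zero_le)
          (Finset.mem_range.2 k.lt_succ_self)).trans (hsum (k + 1))
        simpa using this.trans_lt (ENNReal.natCast_lt_top L)
      have h1 := condExp_bilin_of_stronglyMeasurable_left (innerSL ℝ)
        (hcm k).stronglyMeasurable hL1 (hv.integrable k)
      filter_upwards [h1, hv.condExp_eq_zero k] with ω h1 h2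
      refine h1.trans ?_
      rw [h2]
      simp
  filter_upwards [ae_all_iff.2 hconv, hv.ae_exists_condLExp_le] with ω h1 ⟨L, hL⟩ ε hε
  obtain ⟨c, hc⟩ := h1 L
  -- Kronecker's lemma with weights `S` undoes the normalisation, since no term is cut off on this
  -- path.
  obtain ⟨C, hC⟩ := kronecker_bound hc (b := fun k => S k ω)
    (monotone_nat_of_le_succ fun k => by
      simp only [hS, Finset.sum_range_succ]
      nlinarith [sq_nonneg ‖g k ω‖]) (fun k => (hSpos k ω).le) hε
  refine ⟨ε + C, fun N => ?_⟩
  have h2 := hC N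
  have h3 : ∀ k, S (k + 1) ω * inner ℝ ((if q k ω ≤ L then (S (k + 1) ω)⁻¹ else 0) • g k ω)
      (v k ω) = inner ℝ (g k ω) (v k ω) := fun k => by
    rw [if_pos (hL k), real_inner_smul_left, mul_inv_cancel_left₀ (hSpos _ _).ne']
  simp only [h3] at h2
  refine h2.trans (le_of_eq ?_)
  simp only [hS]
  ring

/-- A weighted sum of the squares of the noise, with predictable weights in `[0, 1]`, is bounded by
a multiple of the sum of the weights. -/
theorem ae_sum_mul_sq_le [IsProbabilityMeasure ℙ] (hβ : 2 < β) (hv : IsNoise ℙ ℱ β v)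
    (a : ℕ → Ω → ℝ) (ha : ∀ k, Measurable[ℱ k] (a k)) (ha0 : ∀ k ω, 0 ≤ a k ω)
    (ha1 : ∀ k ω, a k ω ≤ 1) :
    ∀ᵐ ω ∂ℙ, ∃ C : ℝ, ∀ N, ∑ k ∈ Finset.range N, a k ω * ‖v k ω‖ ^ 2 ≤
        C * (1 + ∑ k ∈ Finset.range N, a k ω) := by
  set S : ℕ → Ω → ℝ := fun k ω => 1 + ∑ j ∈ Finset.range k, a j ω with hS
  have hS1 : ∀ k ω, 1 ≤ S k ω := fun k ω =>
    le_add_of_nonneg_right (Finset.sum_nonneg fun j _ => ha0 j ω)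
  have hSpos : ∀ k ω, 0 < S k ω := fun k ω => one_pos.trans_le (hS1 k ω)
  have hSmono : ∀ ω, Monotone fun k => S k ω := fun ω => monotone_nat_of_le_succ fun k => by
    simp only [hS, Finset.sum_range_succ]
    linarith [ha0 k ω]
  have hSm : ∀ k, Measurable[ℱ k] (S (k + 1)) := fun k => by
    refine measurable_const.add (Finset.measurable_fun_sum _ fun j hj => ?_)
    exact (ha j).mono (ℱ.mono (Nat.lt_succ_iff.1 (Finset.mem_range.1 hj))) le_rfl
  set q : ℕ → Ω → ℝ≥0∞ := fun k => condLExp (ℱ k) ℙ (fun ω' => 1 + ‖v k ω'‖ₑ ^ β) with hq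
  have hqm : ∀ k, Measurable[ℱ k] (q k) := fun k => measurable_condLExp _ _ _
  have hvm : ∀ k, Measurable[ℱ (k + 1)] fun ω => ‖v k ω‖ ^ 2 := fun k =>
    (measurable_norm.comp (hv.meas k)).pow_const 2
  have hTm : ∀ k, Measurable[ℱ (k + 1)] fun ω => S (k + 1) ω ^ (1 / 2 : ℝ) := fun k =>
    ((hSm k).pow_const _).mono (ℱ.mono k.le_succ) le_rfl
  -- weights of the form `a_k / S_k ^ (1 + η)`
  have hweight : ∀ (η : ℝ), 0 < η → ∀ (L : ℕ) (z : ℕ → Ω → ℝ≥0∞),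
      (∀ k ω, z k ω ≤ (if q k ω ≤ L then ENNReal.ofReal (a k ω * S (k + 1) ω ^ (-(1 + η)))
        else 0) * (1 + ‖v k ω‖ₑ ^ β)) →
      ∀ N, ∑ k ∈ Finset.range N, ∫⁻ ω, z k ω ∂ℙ ≤ L * ENNReal.ofReal η⁻¹ := by
    intro η hη L z hz N
    have hfm : ∀ k, Measurable[ℱ k] fun ω =>
        if q k ω ≤ L then ENNReal.ofReal (a k ω * S (k + 1) ω ^ (-(1 + η))) else 0 := fun k =>
      Measurable.ite ((hqm k) measurableSet_Iic)
        (((ha k).mul ((hSm k).pow_const _)).ennreal_ofReal) measurable_const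
    calc ∑ k ∈ Finset.range N, ∫⁻ ω, z k ω ∂ℙ
        ≤ ∑ k ∈ Finset.range N, L * ∫⁻ ω, (if q k ω ≤ L then
            ENNReal.ofReal (a k ω * S (k + 1) ω ^ (-(1 + η))) else 0) ∂ℙ := by
          refine Finset.sum_le_sum fun k _ => (lintegral_mono (hz k)).trans ?_
          refine lintegral_mul_le_of_condLExp_le (ℱ.le k) (hfm k) (hv.measurable_moment k) L
            fun ω hω => ?_
          by_contra hcon
          exact hω (if_neg hcon)
      _ = L * ∫⁻ ω, ∑ k ∈ Finset.range N, (if q k ω ≤ L then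
            ENNReal.ofReal (a k ω * S (k + 1) ω ^ (-(1 + η))) else 0) ∂ℙ := by
          rw [← Finset.mul_sum, lintegral_finsetSum]
          exact fun k _ => (hfm k).mono (ℱ.le k) le_rfl
      _ ≤ L * ∫⁻ _, ENNReal.ofReal η⁻¹ ∂ℙ := by
          gcongr with ω
          calc _ ≤ ∑ k ∈ Finset.range N, ENNReal.ofReal (a k ω * S (k + 1) ω ^ (-(1 + η))) := by
                gcongr with k
                split_ifs <;> simp
            _ ≤ _ := by
                rw [← ENNReal.ofReal_sum_of_nonneg fun k _ => mul_nonneg (ha0 _ _)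
                  (Real.rpow_nonneg (hSpos _ _).le _)]
                exact ENNReal.ofReal_le_ofReal
                  (sum_mul_rpow_neg_le hη (fun k => a k ω) (fun k => ha0 k ω) N)
      _ = L * ENNReal.ofReal η⁻¹ := by simp
  -- The noise is split at `‖v‖² = S ^ (1 / 2)`. Above this level `S ^ η = (S ^ (1 / 2)) ^ (β / 2 -
  -- 1)` is at most `‖v‖ ^ (β - 2)`, so the surplus moment pays for the summable weight `a / S ^ (1
  -- + η)`.
  set η : ℝ := (β / 2 - 1) / 2 with hη
  have hη0 : 0 < η := by rw [hη]; linarith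
  -- the large values of the noise
  have hlarge : ∀ L : ℕ, ∀ᵐ ω ∂ℙ, ∃ C : ℝ, ∀ N, ∑ k ∈ Finset.range N,
      (if q k ω ≤ L ∧ S (k + 1) ω ^ (1 / 2 : ℝ) < ‖v k ω‖ ^ 2 then
        a k ω * ‖v k ω‖ ^ 2 / S (k + 1) ω else 0) ≤ C := by
    intro L
    set X : ℕ → Ω → ℝ := fun k ω =>
      if q k ω ≤ L ∧ S (k + 1) ω ^ (1 / 2 : ℝ) < ‖v k ω‖ ^ 2 then
        a k ω * ‖v k ω‖ ^ 2 / S (k + 1) ω else 0 with hX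
    have hX0 : ∀ k ω, 0 ≤ X k ω := fun k ω => by
      simp only [hX]
      split_ifs
      · exact div_nonneg (mul_nonneg (ha0 _ _) (sq_nonneg _)) (hSpos _ _).le
      · exact le_rfl
    have hXm : ∀ k, Measurable (X k) := fun k => by
      refine Measurable.mono (Measurable.ite (m := ℱ (k + 1)) (MeasurableSet.inter ?_ ?_)
        ?_ measurable_const) (ℱ.le _) le_rfl
      · exact ℱ.mono k.le_succ _ ((hqm k) measurableSet_Iic)
      · exact measurableSet_lt (hTm k) (hvm k)
      · exact ((((ha k).mono (ℱ.mono k.le_succ) le_rfl).mul (hvm k)).div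
          ((hSm k).mono (ℱ.mono k.le_succ) le_rfl))
    have hb := hweight η hη0 L (fun k ω => ENNReal.ofReal (X k ω)) fun k ω => by
      simp only [hX]
      by_cases h1 : q k ω ≤ L
      swap
      · simp [h1]
      by_cases h2 : S (k + 1) ω ^ (1 / 2 : ℝ) < ‖v k ω‖ ^ 2
      swap
      · rw [if_neg fun h => h2 h.2]; simp
      rw [if_pos ⟨h1, h2⟩, if_pos h1]
      have hs := hSpos (k + 1) ω
      have ht : 0 < ‖v k ω‖ ^ 2 := (Real.rpow_pos_of_pos hs _).trans h2
      have h3 : S (k + 1) ω ^ η * ‖v k ω‖ ^ 2 ≤ ‖v k ω‖ ^ β := by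
        have e1 : S (k + 1) ω ^ η = (S (k + 1) ω ^ (1 / 2 : ℝ)) ^ (β / 2 - 1) := by
          rw [← Real.rpow_mul hs.le, hη]; ring_nf
        have e2 : ‖v k ω‖ ^ β = (‖v k ω‖ ^ 2) ^ (β / 2 - 1) * ‖v k ω‖ ^ 2 := by
          rw [← Real.rpow_add_one ht.ne', ← Real.rpow_natCast, ← Real.rpow_mul (norm_nonneg _)]
          congr 1
          push_cast
          ring
        rw [e1, e2]
        gcongr
        linarith
      have h4 : a k ω * ‖v k ω‖ ^ 2 / S (k + 1) ω ≤
          a k ω * S (k + 1) ω ^ (-(1 + η)) * ‖v k ω‖ ^ β := by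
        have e3 : S (k + 1) ω ^ (-(1 + η)) * (S (k + 1) ω ^ η * ‖v k ω‖ ^ 2) =
            ‖v k ω‖ ^ 2 / S (k + 1) ω := by
          rw [← mul_assoc, ← Real.rpow_add hs, show -(1 + η) + η = -1 by ring, Real.rpow_neg_one]
          ring
        rw [mul_div_assoc, ← e3, mul_assoc]
        gcongr
        exact ha0 k ω
      refine (ENNReal.ofReal_le_ofReal h4).trans ?_
      rw [ENNReal.ofReal_mul (mul_nonneg (ha0 _ _) (Real.rpow_nonneg hs.le _)),
        ← ENNReal.ofReal_rpow_of_nonneg (norm_nonneg _) (by linarith), ofReal_norm]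
      gcongr
      exact le_add_self
    have hlt : ∫⁻ ω, ∑' k, ENNReal.ofReal (X k ω) ∂ℙ ≠ ∞ := by
      rw [lintegral_tsum fun k => (hXm k).ennreal_ofReal.aemeasurable]
      refine ne_top_of_le_ne_top (b := L * ENNReal.ofReal η⁻¹)
        (ENNReal.mul_ne_top (ENNReal.natCast_ne_top L) ENNReal.ofReal_ne_top) ?_
      exact ENNReal.tsum_le_of_sum_range_le hb
    filter_upwards [ae_lt_top (Measurable.tsum fun k => (hXm k).ennreal_ofReal) hlt] with ω hω
    refine ⟨(∑' k, ENNReal.ofReal (X k ω)).toReal, fun N => ?_⟩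
    rw [← ENNReal.ofReal_le_iff_le_toReal hω.ne, ENNReal.ofReal_sum_of_nonneg fun k _ => hX0 k ω]
    exact ENNReal.sum_le_tsum _
  -- the small values of the noise
  have hsmall : ∀ L : ℕ, ∀ᵐ ω ∂ℙ, ∃ C : ℝ, ∀ N, ∑ k ∈ Finset.range N, S (k + 1) ω *
      (if q k ω ≤ L ∧ ‖v k ω‖ ^ 2 ≤ S (k + 1) ω ^ (1 / 2 : ℝ) then
        a k ω * ‖v k ω‖ ^ 2 / S (k + 1) ω else 0) ≤ C * S N ω := by
    intro L
    set z : ℕ → Ω → ℝ := fun k ω =>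
      if q k ω ≤ L ∧ ‖v k ω‖ ^ 2 ≤ S (k + 1) ω ^ (1 / 2 : ℝ) then
        a k ω * ‖v k ω‖ ^ 2 / S (k + 1) ω else 0 with hz
    have hz0 : ∀ k ω, 0 ≤ z k ω := fun k ω => by
      simp only [hz]
      split_ifs
      · exact div_nonneg (mul_nonneg (ha0 _ _) (sq_nonneg _)) (hSpos _ _).le
      · exact le_rfl
    have hT : ∀ k ω, S (k + 1) ω ^ (1 / 2 : ℝ) ≤ S (k + 1) ω := fun k ω => by
      conv_rhs => rw [← Real.rpow_one (S (k + 1) ω)]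
      exact Real.rpow_le_rpow_of_exponent_le (hS1 _ _) (by norm_num)
    have hz1 : ∀ k ω, z k ω ≤ 1 := fun k ω => by
      simp only [hz]
      split_ifs with h
      · rw [div_le_one (hSpos _ _)]
        nlinarith [h.2, hT k ω, ha0 k ω, ha1 k ω, hSpos (k + 1) ω, sq_nonneg ‖v k ω‖]
      · exact zero_le_one
    have hzm : ∀ k, Measurable[ℱ (k + 1)] (z k) := fun k => by
      refine Measurable.ite (m := ℱ (k + 1)) (MeasurableSet.inter ?_ ?_) ?_ measurable_const
      · exact ℱ.mono k.le_succ _ ((hqm k) measurableSet_Iic)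
      · exact measurableSet_le (hvm k) (hTm k)
      · exact ((((ha k).mono (ℱ.mono k.le_succ) le_rfl).mul (hvm k)).div
          ((hSm k).mono (ℱ.mono k.le_succ) le_rfl))
    have hzi : ∀ k, Integrable (z k) ℙ := fun k => by
      refine Integrable.of_bound ((hzm k).mono (ℱ.le _) le_rfl).aestronglyMeasurable 1
        (ae_of_all _ fun ω => ?_)
      rw [Real.norm_of_nonneg (hz0 k ω)]
      exact hz1 k ω
    have hc0 : ∀ k, ∀ᵐ ω ∂ℙ, 0 ≤ (ℙ[z k | ℱ k]) ω := fun k =>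
      condExp_nonneg (ae_of_all _ (hz0 k))
    -- The compensator of the small part is bounded by the conditional second moment, hence by `L`
    -- times the predictable weight.
    have hcle : ∀ k, ∀ᵐ ω ∂ℙ, (ℙ[z k | ℱ k]) ω ≤ L * (a k ω / S (k + 1) ω) := by
      intro k
      set f : Ω → ℝ≥0∞ := fun ω =>
        if q k ω ≤ L then ENNReal.ofReal (a k ω / S (k + 1) ω) else 0 with hf
      have hfm : Measurable[ℱ k] f := Measurable.ite ((hqm k) measurableSet_Iic)
        (((ha k).div (hSm k)).ennreal_ofReal) measurable_const
      have hzf : ∀ ω, ENNReal.ofReal (z k ω) ≤ f ω * (1 + ‖v k ω‖ₑ ^ β) := fun ω => by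
        simp only [hz, hf]
        by_cases h1 : q k ω ≤ L
        swap
        · simp [h1]
        by_cases h2 : ‖v k ω‖ ^ 2 ≤ S (k + 1) ω ^ (1 / 2 : ℝ)
        swap
        · rw [if_neg fun h => h2 h.2]; simp
        rw [if_pos ⟨h1, h2⟩, if_pos h1, mul_div_right_comm,
          ENNReal.ofReal_mul (div_nonneg (ha0 _ _) (hSpos _ _).le),
          ENNReal.ofReal_pow (norm_nonneg _), ofReal_norm]
        gcongr
        exact sq_le_one_add_rpow hβ _
      have h1 := condLExp_ofReal (ℱ k) (hzi k) (ae_of_all _ (hz0 k))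
      have h2 := condLExp_mono (mΩ := ℱ k) (P := ℙ) (ae_of_all _ hzf)
      have h3 := condLExp_mul_left (ℙ := ℙ) (ℱ.le k) hfm (hv.measurable_moment k)
      filter_upwards [h1, h2, h3] with ω h1 h2 h3
      have hnn : 0 ≤ a k ω / S (k + 1) ω := div_nonneg (ha0 _ _) (hSpos _ _).le
      rw [h1, h3] at h2
      have h4 : f ω * q k ω ≤ ENNReal.ofReal (L * (a k ω / S (k + 1) ω)) := by
        rw [ENNReal.ofReal_mul (Nat.cast_nonneg _), ENNReal.ofReal_natCast, mul_comm]
        simp only [hf]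
        split_ifs with h
        · gcongr
        · simp
      exact (ENNReal.ofReal_le_ofReal_iff (mul_nonneg (Nat.cast_nonneg _) hnn)).1 (h2.trans h4)
    set x : ℕ → Ω → ℝ := fun k ω => z k ω - (ℙ[z k | ℱ k]) ω with hx
    have hcm : ∀ k, Measurable[ℱ k] (ℙ[z k | ℱ k]) := fun k =>
      stronglyMeasurable_condExp.measurable
    -- In the square of a small term one factor `‖v‖²` is traded for `S ^ (1 / 2)`, leaving the
    -- weight `a / S ^ (3 / 2)`.
    have hzsq := hweight (1 / 2) (by norm_num) L (fun k ω => ENNReal.ofReal (z k ω ^ 2))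
      fun k ω => by
      simp only [hz]
      by_cases h1 : q k ω ≤ L
      swap
      · simp [h1]
      by_cases h2 : ‖v k ω‖ ^ 2 ≤ S (k + 1) ω ^ (1 / 2 : ℝ)
      swap
      · rw [if_neg fun h => h2 h.2]; simp
      rw [if_pos ⟨h1, h2⟩, if_pos h1]
      have hs := hSpos (k + 1) ω
      have h3 : (a k ω * ‖v k ω‖ ^ 2 / S (k + 1) ω) ^ 2 ≤
          a k ω * S (k + 1) ω ^ (-(1 + 1 / 2) : ℝ) * ‖v k ω‖ ^ 2 := by
        have e1 : S (k + 1) ω ^ (-(1 + 1 / 2) : ℝ) =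
            S (k + 1) ω ^ (1 / 2 : ℝ) * (S (k + 1) ω ^ 2)⁻¹ := by
          rw [← Real.rpow_natCast, ← Real.rpow_neg hs.le, ← Real.rpow_add hs]
          norm_num
        rw [div_pow, div_eq_mul_inv, e1]
        have h5 : (a k ω * ‖v k ω‖ ^ 2) ^ 2 ≤
            a k ω * S (k + 1) ω ^ (1 / 2 : ℝ) * ‖v k ω‖ ^ 2 := by
          have h6 : a k ω ^ 2 ≤ a k ω := by nlinarith [ha0 k ω, ha1 k ω]
          calc (a k ω * ‖v k ω‖ ^ 2) ^ 2 = a k ω ^ 2 * ‖v k ω‖ ^ 2 * ‖v k ω‖ ^ 2 := by ring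
            _ ≤ _ := by gcongr; exact ha0 k ω
        calc _ ≤ (a k ω * S (k + 1) ω ^ (1 / 2 : ℝ) * ‖v k ω‖ ^ 2) * (S (k + 1) ω ^ 2)⁻¹ := by
              gcongr
          _ = _ := by ring
      refine (ENNReal.ofReal_le_ofReal h3).trans ?_
      rw [ENNReal.ofReal_mul (mul_nonneg (ha0 _ _) (Real.rpow_nonneg hs.le _)),
        ENNReal.ofReal_pow (norm_nonneg _), ofReal_norm]
      gcongr
      exact sq_le_one_add_rpow hβ _
    have hcsq : ∀ N, ∑ k ∈ Finset.range N, ∫⁻ ω, ENNReal.ofReal ((ℙ[z k | ℱ k]) ω ^ 2) ∂ℙ ≤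
        (L : ℝ≥0∞) ^ 2 := fun N => by
      calc _ ≤ ∑ k ∈ Finset.range N, ∫⁻ ω, (L : ℝ≥0∞) ^ 2 *
            ENNReal.ofReal (a k ω * S (k + 1) ω ^ (-(1 + 1) : ℝ)) ∂ℙ := by
            refine Finset.sum_le_sum fun k _ => lintegral_mono_ae ?_
            filter_upwards [hc0 k, hcle k] with ω h1 h2
            have e1 : S (k + 1) ω ^ (-(1 + 1) : ℝ) = (S (k + 1) ω ^ 2)⁻¹ := by
              rw [← Real.rpow_natCast, ← Real.rpow_neg (hSpos _ _).le]
              norm_num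
            rw [← ENNReal.ofReal_natCast, ← ENNReal.ofReal_pow (Nat.cast_nonneg _),
              ← ENNReal.ofReal_mul (by positivity)]
            refine ENNReal.ofReal_le_ofReal ?_
            have h6 : a k ω ^ 2 ≤ a k ω := by nlinarith [ha0 k ω, ha1 k ω]
            have hs := hSpos (k + 1) ω
            calc (ℙ[z k | ℱ k]) ω ^ 2 ≤ (L * (a k ω / S (k + 1) ω)) ^ 2 := by gcongr
              _ = L ^ 2 * (a k ω ^ 2 * (S (k + 1) ω ^ 2)⁻¹) := by field_simp
              _ ≤ _ := by rw [e1]; gcongr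
        _ = ∫⁻ ω, ∑ k ∈ Finset.range N, (L : ℝ≥0∞) ^ 2 *
            ENNReal.ofReal (a k ω * S (k + 1) ω ^ (-(1 + 1) : ℝ)) ∂ℙ := by
            rw [lintegral_finsetSum]
            refine fun k _ => Measurable.const_mul (Measurable.ennreal_ofReal ?_) _
            exact (((ha k).mul ((hSm k).pow_const _)).mono (ℱ.le k) le_rfl)
        _ ≤ ∫⁻ _, (L : ℝ≥0∞) ^ 2 * 1 ∂ℙ := by
            gcongr with ω
            rw [← Finset.mul_sum, ← ENNReal.ofReal_sum_of_nonneg fun k _ =>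
              mul_nonneg (ha0 _ _) (Real.rpow_nonneg (hSpos _ _).le _), ← ENNReal.ofReal_one]
            gcongr
            simpa using sum_mul_rpow_neg_le one_pos (fun k => a k ω) (fun k => ha0 k ω) N
        _ = (L : ℝ≥0∞) ^ 2 := by simp
    have hxsq : ∀ N, ∑ k ∈ Finset.range N, ∫⁻ ω, ‖x k ω‖ₑ ^ 2 ∂ℙ ≤
        L * ENNReal.ofReal (1 / 2 : ℝ)⁻¹ + (L : ℝ≥0∞) ^ 2 := fun N => by
      refine le_trans ?_ (add_le_add (hzsq N) (hcsq N))
      rw [← Finset.sum_add_distrib]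
      refine Finset.sum_le_sum fun k _ => ?_
      rw [← lintegral_add_left (((hzm k).mono (ℱ.le _) le_rfl).pow_const 2).ennreal_ofReal]
      refine lintegral_mono_ae ?_
      filter_upwards [hc0 k] with ω h1
      rw [Real.enorm_eq_ofReal_abs, ← ENNReal.ofReal_pow (abs_nonneg _), sq_abs,
        ← ENNReal.ofReal_add (sq_nonneg _) (sq_nonneg _)]
      refine ENNReal.ofReal_le_ofReal ?_
      simp only [hx]
      nlinarith [mul_nonneg (hz0 k ω) h1]
    have hconv := ae_exists_tendsto_sum_of_lintegral_le ℱ x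
      (fun k => (hzm k).sub ((hcm k).mono (ℱ.mono k.le_succ) le_rfl))
      (fun k => by
        have h1 := condExp_sub (hzi k) (integrable_condExp (μ := ℙ) (m := ℱ k) (f := z k)) (ℱ k)
        have h2 := condExp_of_stronglyMeasurable (μ := ℙ) (ℱ.le k)
          (stronglyMeasurable_condExp (μ := ℙ) (m := ℱ k) (f := z k)) integrable_condExp
        filter_upwards [h1] with ω h1
        refine h1.trans ?_
        rw [Pi.sub_apply, h2]
        simp)
      (ENNReal.add_ne_top.2 ⟨ENNReal.mul_ne_top (ENNReal.natCast_ne_top L) ENNReal.ofReal_ne_top,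
        ENNReal.pow_ne_top (ENNReal.natCast_ne_top L)⟩) hxsq
    filter_upwards [hconv, ae_all_iff.2 hcle] with ω ⟨c, hc⟩ h2
    obtain ⟨C, hC⟩ := kronecker_bound hc (hSmono ω) (fun k => (hSpos k ω).le) one_pos
    refine ⟨1 + |C| + L, fun N => ?_⟩
    -- Martingale part plus compensator: Kronecker's lemma bounds the first, and in the second the
    -- normalisation cancels to leave `L ∑ a_k`.
    have h3 : ∑ k ∈ Finset.range N, S (k + 1) ω * z k ω =
        ∑ k ∈ Finset.range N, S (k + 1) ω * x k ω +
          ∑ k ∈ Finset.range N, S (k + 1) ω * (ℙ[z k | ℱ k]) ω := by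
      rw [← Finset.sum_add_distrib]
      refine Finset.sum_congr rfl fun k _ => ?_
      simp only [hx]
      ring
    have h4 : ∑ k ∈ Finset.range N, S (k + 1) ω * (ℙ[z k | ℱ k]) ω ≤ L * S N ω := by
      calc _ ≤ ∑ k ∈ Finset.range N, L * a k ω := by
            refine Finset.sum_le_sum fun k _ => ?_
            calc _ ≤ S (k + 1) ω * (L * (a k ω / S (k + 1) ω)) :=
                  mul_le_mul_of_nonneg_left (h2 k) (hSpos _ _).le
              _ = L * a k ω := by
                  have := (hSpos (k + 1) ω).ne'
                  field_simp
        _ ≤ L * S N ω := by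
            rw [← Finset.mul_sum]
            gcongr
            simp only [hS]
            linarith
    have h5 := (le_abs_self _).trans (hC N)
    rw [h3]
    nlinarith [le_abs_self C, abs_nonneg C, hS1 N ω]
  filter_upwards [ae_all_iff.2 hlarge, ae_all_iff.2 hsmall, hv.ae_exists_condLExp_le]
    with ω h1 h2 ⟨L, hL⟩
  obtain ⟨C₁, hC₁⟩ := h1 L
  obtain ⟨C₂, hC₂⟩ := h2 L
  -- For this `L` every term is either small or large. The large terms were summed after division by
  -- `S (k + 1)`, and `S (k + 1) ≤ S N` pays that factor back.
  refine ⟨C₂ + C₁, fun N => ?_⟩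
  rw [add_mul]
  refine le_trans ?_ (add_le_add (hC₂ N)
    (mul_le_mul_of_nonneg_right (hC₁ N) (hSpos N ω).le))
  rw [Finset.sum_mul, ← Finset.sum_add_distrib]
  refine Finset.sum_le_sum fun k hk => ?_
  have hs := hSpos (k + 1) ω
  have hmono : S (k + 1) ω ≤ S N ω := hSmono ω (Finset.mem_range.1 hk)
  have hnn : 0 ≤ a k ω * ‖v k ω‖ ^ 2 / S (k + 1) ω :=
    div_nonneg (mul_nonneg (ha0 _ _) (sq_nonneg _)) hs.le
  have he : S (k + 1) ω * (a k ω * ‖v k ω‖ ^ 2 / S (k + 1) ω) = a k ω * ‖v k ω‖ ^ 2 :=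
    mul_div_cancel₀ _ hs.ne'
  have hqL : q k ω ≤ L := hL k
  rcases le_or_gt (‖v k ω‖ ^ 2) (S (k + 1) ω ^ (1 / 2 : ℝ)) with h | h
  · rw [if_pos ⟨hqL, h⟩, if_neg fun h' => h'.2.not_ge h, he]
    simp
  · rw [if_neg fun h' => h'.2.not_gt h, if_pos ⟨hqL, h⟩]
    nlinarith

end IsNoise

open Matrix

/-! ### Rank one updates -/

section RankOne

variable {ι : Type*} [Fintype ι]

lemma posDef_add_vecMulVec {R : Matrix ι ι ℝ} (hR : R.PosDef) (x : ι → ℝ) :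
    (R + vecMulVec x x).PosDef :=
  hR.add_posSemidef (by simpa using posSemidef_vecMulVec_self_star x)

variable [DecidableEq ι]

lemma dotProduct_inv_mulVec_nonneg {R : Matrix ι ι ℝ} (hR : R.PosDef) (x : ι → ℝ) :
    0 ≤ x ⬝ᵥ R⁻¹ *ᵥ x := by
  simpa using hR.inv.posSemidef.dotProduct_mulVec_nonneg x

/-- The **Sherman–Morrison formula** for a symmetric rank one update. -/
lemma inv_add_vecMulVec {R : Matrix ι ι ℝ} (hR : R.PosDef) (x : ι → ℝ) :
    (R + vecMulVec x x)⁻¹ =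
      R⁻¹ - (1 + x ⬝ᵥ R⁻¹ *ᵥ x)⁻¹ • (R⁻¹ * vecMulVec x x * R⁻¹) := by
  have hs : (1 + x ⬝ᵥ R⁻¹ *ᵥ x) ≠ 0 :=
    (add_pos_of_pos_of_nonneg one_pos (dotProduct_inv_mulVec_nonneg hR x)).ne'
  have hdet : IsUnit R.det := hR.det_pos.ne'.isUnit
  refine inv_eq_left_inv ?_
  set s := x ⬝ᵥ R⁻¹ *ᵥ x with hs'
  set X := vecMulVec x x with hX
  have h1 : X * R⁻¹ * X = s • X := by
    rw [hX, vecMulVec_mul, vecMulVec_mul_vecMulVec, vecMulVec_smul, ← dotProduct_mulVec]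
  have h2 : R⁻¹ * X * R⁻¹ * X = s • (R⁻¹ * X) := by
    rw [Matrix.mul_assoc, Matrix.mul_assoc, ← Matrix.mul_assoc X, h1, Matrix.mul_smul]
  rw [sub_mul, mul_add, nonsing_inv_mul _ hdet, smul_mul, mul_add, h2,
    nonsing_inv_mul_cancel_right _ _ hdet]
  have h3 : R⁻¹ * X + s • (R⁻¹ * X) = (1 + s) • (R⁻¹ * X) := by rw [add_smul, one_smul]
  rw [h3, smul_smul, inv_mul_cancel₀ hs, one_smul, add_sub_cancel_right]

lemma det_add_vecMulVec {R : Matrix ι ι ℝ} (hR : R.PosDef) (x : ι → ℝ) :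
    (R + vecMulVec x x).det = R.det * (1 + x ⬝ᵥ R⁻¹ *ᵥ x) := by
  rw [vecMulVec_eq Unit, det_add_replicateCol_mul_replicateRow (ι := Unit) hR.det_pos.ne'.isUnit,
    det_unique (n := Unit)]
  congr 1
  simp [Matrix.mul_assoc, Matrix.mul_apply, dotProduct, mulVec]

/-- The change of a quadratic form under a rank one update along a least squares step. -/
lemma quadForm_leastSquares_step {R : Matrix ι ι ℝ} (hR : R.PosDef) (x a a' : ι → ℝ) (r : ℝ)
    (ha : a' = a - r • R⁻¹ *ᵥ x) :
    a' ⬝ᵥ (R + vecMulVec x x) *ᵥ a' =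
      a ⬝ᵥ R *ᵥ a - 2 * (a' ⬝ᵥ x) * r - (x ⬝ᵥ R⁻¹ *ᵥ x) * r ^ 2 + (a' ⬝ᵥ x) ^ 2 := by
  have hdet : IsUnit R.det := hR.det_pos.ne'.isUnit
  set z := R⁻¹ *ᵥ x with hz
  have hRz : R *ᵥ z = x := by
    rw [hz, mulVec_mulVec, mul_nonsing_inv _ hdet, one_mulVec]
  have hsymm : z ⬝ᵥ R *ᵥ a' = x ⬝ᵥ a' := by
    have hT : Rᵀ = R := by simpa using hR.isHermitian.eq
    rw [dotProduct_mulVec, ← mulVec_transpose, hT, hRz]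
  have ha2 : a = a' + r • z := by rw [ha]; simp
  have h1 : a ⬝ᵥ R *ᵥ a = a' ⬝ᵥ R *ᵥ a' + 2 * r * (a' ⬝ᵥ x) + r ^ 2 * (x ⬝ᵥ z) := by
    rw [ha2, mulVec_add, mulVec_smul, hRz]
    simp only [add_dotProduct, dotProduct_add, smul_dotProduct, dotProduct_smul, hsymm,
      smul_eq_mul]
    rw [dotProduct_comm x a', dotProduct_comm z x]
    ring
  have h2 : a' ⬝ᵥ (vecMulVec x x) *ᵥ a' = (a' ⬝ᵥ x) ^ 2 := by
    rw [vecMulVec_mulVec, op_smul_eq_smul, dotProduct_smul, smul_eq_mul, dotProduct_comm x a', sq]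
  rw [add_mulVec, dotProduct_add, h1, h2]
  ring

/-- All eigenvalues are positive, so each one is at most the trace. -/
lemma log_det_le {R : Matrix ι ι ℝ} (hR : R.PosDef) :
    Real.log R.det ≤ Fintype.card ι * Real.log R.trace := by
  rcases isEmpty_or_nonempty ι with h | h
  · simp
  have hpos := hR.eigenvalues_pos
  have htr : R.trace = ∑ i, hR.isHermitian.eigenvalues i := by
    simpa using hR.isHermitian.trace_eq_sum_eigenvalues
  have hle : ∀ i, hR.isHermitian.eigenvalues i ≤ R.trace := fun i => by
    rw [htr]
    exact Finset.single_le_sum (f := fun i => hR.isHermitian.eigenvalues i)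
      (fun j _ => (hpos j).le) (Finset.mem_univ i)
  have hdet : R.det = ∏ i, hR.isHermitian.eigenvalues i := by
    simpa using hR.isHermitian.det_eq_prod_eigenvalues
  rw [← Real.log_pow]
  refine Real.log_le_log hR.det_pos ?_
  rw [hdet, ← Finset.card_univ, ← Finset.prod_const]
  exact Finset.prod_le_prod (fun i _ => (hpos i).le) fun i _ => hle i

end RankOne

/-! ### Extreme eigenvalues -/

section Eigenvalues

variable {𝕜 ι : Type*} [RCLike 𝕜] [Fintype ι] [DecidableEq ι]

lemma spectrum_real_finite {M : Matrix ι ι 𝕜} (hM : M.IsHermitian) : (spectrum ℝ M).Finite := by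
  rw [hM.spectrum_real_eq_range_eigenvalues]
  exact Set.finite_range _

open scoped MatrixOrder ComplexOrder in
lemma posSemidef_eigMax_sub {M : Matrix ι ι 𝕜} (hM : M.IsHermitian) :
    (algebraMap ℝ (Matrix ι ι 𝕜) (eigMax M) - M).PosSemidef := by
  rw [← Matrix.le_iff, le_algebraMap_iff_spectrum_le (ha := hM)]
  exact fun x hx => le_csSup (spectrum_real_finite hM).bddAbove hx

open scoped MatrixOrder ComplexOrder in
lemma posSemidef_sub_eigMin {M : Matrix ι ι 𝕜} (hM : M.IsHermitian) :
    (M - algebraMap ℝ (Matrix ι ι 𝕜) (eigMin M)).PosSemidef := by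
  rw [← Matrix.le_iff, algebraMap_le_iff_le_spectrum (ha := hM)]
  exact fun x hx => csInf_le (spectrum_real_finite hM).bddBelow hx

lemma eigMin_mul_le {M : Matrix ι ι ℝ} (hM : M.IsHermitian) (x : ι → ℝ) :
    eigMin M * (x ⬝ᵥ x) ≤ x ⬝ᵥ M *ᵥ x := by
  have h := (posSemidef_sub_eigMin hM).dotProduct_mulVec_nonneg x
  rw [sub_mulVec, dotProduct_sub, Algebra.algebraMap_eq_smul_one, smul_mulVec, one_mulVec,
    dotProduct_smul, smul_eq_mul, star_trivial] at h
  linarith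

lemma trace_le_card_mul_eigMax {M : Matrix ι ι ℝ} (hM : M.IsHermitian) :
    M.trace ≤ Fintype.card ι * eigMax M := by
  have h := (posSemidef_eigMax_sub hM).trace_nonneg
  rw [trace_sub, Algebra.algebraMap_eq_smul_one, trace_smul, trace_one, smul_eq_mul] at h
  linarith

lemma eigMin_le_eigMax [Nonempty ι] {M : Matrix ι ι 𝕜} (hM : M.IsHermitian) :
    eigMin M ≤ eigMax M := by
  have hne : (spectrum ℝ M).Nonempty := by
    rw [hM.spectrum_real_eq_range_eigenvalues]
    exact Set.range_nonempty _
  exact csInf_le_csSup hne (spectrum_real_finite hM).bddBelow (spectrum_real_finite hM).bddAbove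

end Eigenvalues

/-! ### Recursive least squares -/

/-- The recursive least squares algorithm with regressors `ψ_k`, outputs `y_k`, estimates `α_k` and
gains `P_k`. -/
structure IsLeastSquares {ι κ : Type*} [Fintype ι] (ψ : ℕ → ι → ℝ) (y : ℕ → κ → ℝ)
    (P : ℕ → Matrix ι ι ℝ) (α : ℕ → Matrix ι κ ℝ) : Prop where
  gain_succ : ∀ k, P (k + 1) =
    P k - (1 + ψ k ⬝ᵥ P k *ᵥ ψ k)⁻¹ • (P k * vecMulVec (ψ k) (ψ k) * P k)
  estimate_succ : ∀ k, α (k + 1) = α k + (1 + ψ k ⬝ᵥ P k *ᵥ ψ k)⁻¹ •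
    vecMulVec (P k *ᵥ ψ k) (fun t => y k t - ((α k)ᵀ *ᵥ ψ k) t)

/-- The information matrices `R_0 + ψ_0 ψ_0ᵀ + ⋯ + ψ_{k-1} ψ_{k-1}ᵀ`. -/
def information {ι : Type*} (R₀ : Matrix ι ι ℝ) (ψ : ℕ → ι → ℝ) (k : ℕ) : Matrix ι ι ℝ :=
  R₀ + ∑ j ∈ Finset.range k, vecMulVec (ψ j) (ψ j)

section Information

variable {ι : Type*} {R₀ : Matrix ι ι ℝ} {ψ : ℕ → ι → ℝ}

lemma information_zero : information R₀ ψ 0 = R₀ := by simp [information]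

lemma information_succ (k : ℕ) :
    information R₀ ψ (k + 1) = information R₀ ψ k + vecMulVec (ψ k) (ψ k) := by
  simp [information, Finset.sum_range_succ, add_assoc]

variable [Fintype ι]

lemma posDef_information (hR : R₀.PosDef) (k : ℕ) : (information R₀ ψ k).PosDef := by
  induction k with
  | zero => rwa [information_zero]
  | succ k ih => rw [information_succ]; exact posDef_add_vecMulVec ih _

lemma trace_information (k : ℕ) :
    (information R₀ ψ k).trace = R₀.trace + ∑ j ∈ Finset.range k, ψ j ⬝ᵥ ψ j := by
  simp [information, trace_add, trace_sum, trace_vecMulVec]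

variable [DecidableEq ι]

/-- A rank one update multiplies the determinant by `1 + s`, and `s / (1 + s) ≤ log (1 + s)`; the
logarithms telescope. -/
lemma sum_leverage_le (hR : R₀.PosDef) (N : ℕ) :
    ∑ k ∈ Finset.range N, (1 + ψ k ⬝ᵥ (information R₀ ψ k)⁻¹ *ᵥ ψ k)⁻¹ *
        (ψ k ⬝ᵥ (information R₀ ψ k)⁻¹ *ᵥ ψ k) ≤
      Real.log (information R₀ ψ N).det - Real.log R₀.det := by
  induction N with
  | zero => simp [information_zero]
  | succ N ih =>
    have hPD := posDef_information (ψ := ψ) hR N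
    have hs := dotProduct_inv_mulVec_nonneg hPD (ψ N)
    set s := ψ N ⬝ᵥ (information R₀ ψ N)⁻¹ *ᵥ ψ N with hs'
    have h1 : (1 + s)⁻¹ * s ≤ Real.log (1 + s) := by
      have h2 := Real.one_sub_inv_le_log_of_pos (x := 1 + s) (by linarith)
      have h3 : (1 + s)⁻¹ * s = 1 - (1 + s)⁻¹ := by
        have : 1 + s ≠ 0 := by linarith
        field_simp
        ring
      rwa [h3]
    rw [Finset.sum_range_succ, information_succ, det_add_vecMulVec hPD,
      Real.log_mul hPD.det_pos.ne' (by linarith)]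
    linarith

lemma log_det_le_log_det_information (hR : R₀.PosDef) (N : ℕ) :
    Real.log R₀.det ≤ Real.log (information R₀ ψ N).det := by
  have h := sum_leverage_le (ψ := ψ) hR N
  have h2 : 0 ≤ ∑ k ∈ Finset.range N, (1 + ψ k ⬝ᵥ (information R₀ ψ k)⁻¹ *ᵥ ψ k)⁻¹ *
        (ψ k ⬝ᵥ (information R₀ ψ k)⁻¹ *ᵥ ψ k) :=
    Finset.sum_nonneg fun k _ => by
      have := dotProduct_inv_mulVec_nonneg (posDef_information (ψ := ψ) hR k) (ψ k)
      positivity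
  linarith

end Information

section LeastSquares

variable {ι : Type*} [Fintype ι] [DecidableEq ι] {n : ℕ}

/-- The quadratic form `∑_t a_tᵀ R a_t` over the columns `a_t` of a matrix. -/
def columnForm (R : Matrix ι ι ℝ) (a : Matrix ι (Fin n) ℝ) : ℝ :=
  ∑ t, (fun s => a s t) ⬝ᵥ R *ᵥ (fun s => a s t)

/-- The vector `aᵀ x`. -/
def coeffApply (a : Matrix ι (Fin n) ℝ) (x : ι → ℝ) : EuclideanSpace ℝ (Fin n) :=
  WithLp.toLp 2 (aᵀ *ᵥ x)

variable {ψ : ℕ → ι → ℝ} {y : ℕ → Fin n → ℝ} {P : ℕ → Matrix ι ι ℝ}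
  {α : ℕ → Matrix ι (Fin n) ℝ} {R₀ : Matrix ι ι ℝ}

/-- The gain recursion is the Sherman–Morrison formula for the information matrix. -/
lemma IsLeastSquares.gain_eq (h : IsLeastSquares ψ y P α) (hR : R₀.PosDef) (h0 : P 0 = R₀⁻¹)
    (k : ℕ) : P k = (information R₀ ψ k)⁻¹ := by
  induction k with
  | zero => rw [h0, information_zero]
  | succ k ih => rw [h.gain_succ, information_succ, inv_add_vecMulVec (posDef_information hR k), ih]

/-- The a posteriori error is the a priori error divided by `1 + ψᵀ P ψ`. -/
lemma IsLeastSquares.posterior_eq (h : IsLeastSquares ψ y P α) (hR : R₀.PosDef)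
    (h0 : P 0 = R₀⁻¹) (k : ℕ) (t : Fin n) :
    y k t - ((α (k + 1))ᵀ *ᵥ ψ k) t =
      (1 + ψ k ⬝ᵥ P k *ᵥ ψ k)⁻¹ * (y k t - ((α k)ᵀ *ᵥ ψ k) t) := by
  have hs := dotProduct_inv_mulVec_nonneg (posDef_information (ψ := ψ) hR k) (ψ k)
  rw [← h.gain_eq hR h0] at hs
  have hα := h.estimate_succ k
  set s := ψ k ⬝ᵥ P k *ᵥ ψ k with hs'
  have h1 : ((α (k + 1))ᵀ *ᵥ ψ k) t = ((α k)ᵀ *ᵥ ψ k) t +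
      (1 + s)⁻¹ * (s * (y k t - ((α k)ᵀ *ᵥ ψ k) t)) := by
    rw [hα, transpose_add, transpose_smul, transpose_vecMulVec, add_mulVec, smul_mulVec,
      vecMulVec_mulVec, op_smul_eq_smul, dotProduct_comm, ← hs']
    simp
  rw [h1]
  have : 1 + s ≠ 0 := by linarith
  field_simp
  ring

/-- The Lyapunov identity of recursive least squares for the estimation error with respect to an
arbitrary parameter matrix `θ`. -/
lemma IsLeastSquares.columnForm_succ (h : IsLeastSquares ψ y P α) (hR : R₀.PosDef)
    (h0 : P 0 = R₀⁻¹) (θ : Matrix ι (Fin n) ℝ) (k : ℕ) (r : EuclideanSpace ℝ (Fin n))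
    (hr : ∀ t, r t = y k t - ((α (k + 1))ᵀ *ᵥ ψ k) t) :
    columnForm (information R₀ ψ (k + 1)) (θ - α (k + 1)) =
      columnForm (information R₀ ψ k) (θ - α k) -
        2 * inner ℝ (coeffApply (θ - α (k + 1)) (ψ k)) r -
        (ψ k ⬝ᵥ P k *ᵥ ψ k) * ‖r‖ ^ 2 + ‖coeffApply (θ - α (k + 1)) (ψ k)‖ ^ 2 := by
  have hPD := posDef_information (ψ := ψ) hR k
  have hcol : ∀ t, (fun s => (θ - α (k + 1)) s t) =
      (fun s => (θ - α k) s t) - r t • (information R₀ ψ k)⁻¹ *ᵥ ψ k := fun t => by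
    ext s
    rw [hr, h.posterior_eq hR h0, h.estimate_succ, ← h.gain_eq hR h0]
    simp [vecMulVec_apply]
    ring
  have key := fun t => quadForm_leastSquares_step hPD (ψ k) _ _ (r t) (hcol t)
  simp only [columnForm, information_succ, key]
  rw [EuclideanSpace.real_norm_sq_eq, EuclideanSpace.real_norm_sq_eq, PiLp.inner_apply,
    Finset.mul_sum, Finset.mul_sum, ← Finset.sum_sub_distrib, ← Finset.sum_sub_distrib,
    ← Finset.sum_add_distrib]
  refine Finset.sum_congr rfl fun t _ => ?_
  have h1 : (coeffApply (θ - α (k + 1)) (ψ k)) t = (fun s => (θ - α (k + 1)) s t) ⬝ᵥ ψ k := by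
    simp [coeffApply, mulVec, dotProduct]
  rw [h1, h.gain_eq hR h0]
  simp only [RCLike.inner_apply, conj_trivial]
  ring

/-- The a posteriori prediction error in terms of quantities known before the new output. -/
lemma IsLeastSquares.coeffApply_succ (h : IsLeastSquares ψ y P α) (hR : R₀.PosDef)
    (h0 : P 0 = R₀⁻¹) (θ : Matrix ι (Fin n) ℝ) (k : ℕ) (ν : EuclideanSpace ℝ (Fin n))
    (hν : ∀ t, y k t = (θᵀ *ᵥ ψ k) t + ν t) :
    coeffApply (θ - α (k + 1)) (ψ k) =
      (1 + ψ k ⬝ᵥ P k *ᵥ ψ k)⁻¹ • (coeffApply (θ - α k) (ψ k) -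
        (ψ k ⬝ᵥ P k *ᵥ ψ k) • ν) := by
  have hs := dotProduct_inv_mulVec_nonneg (posDef_information (ψ := ψ) hR k) (ψ k)
  rw [← h.gain_eq hR h0] at hs
  ext t
  have h1 := h.posterior_eq hR h0 k t
  set s := ψ k ⬝ᵥ P k *ᵥ ψ k with hs'
  have hs1 : 1 + s ≠ 0 := by linarith
  simp only [coeffApply, transpose_sub, sub_mulVec, Pi.sub_apply, PiLp.smul_apply,
    PiLp.sub_apply, smul_eq_mul]
  rw [hν] at h1
  field_simp at h1 ⊢
  linarith

end LeastSquares

/-! ### Least squares with martingale difference noise -/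

section Measurability

variable {Ω : Type*} {m : MeasurableSpace Ω} {ι κ : Type*} [Fintype ι] {n : ℕ}

lemma measurable_dotProduct {x y : Ω → ι → ℝ} (hx : ∀ s, Measurable fun ω => x ω s)
    (hy : ∀ s, Measurable fun ω => y ω s) : Measurable fun ω => x ω ⬝ᵥ y ω :=
  Finset.measurable_fun_sum _ fun s _ => (hx s).mul (hy s)

lemma measurable_mulVec {M : Ω → Matrix κ ι ℝ} {x : Ω → ι → ℝ}
    (hM : ∀ s t, Measurable fun ω => M ω s t) (hx : ∀ s, Measurable fun ω => x ω s) (s : κ) :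
    Measurable fun ω => (M ω *ᵥ x ω) s :=
  measurable_dotProduct (hM s) hx

lemma measurable_coeffApply {a : Ω → Matrix ι (Fin n) ℝ} {x : Ω → ι → ℝ}
    (ha : ∀ s t, Measurable fun ω => a ω s t) (hx : ∀ s, Measurable fun ω => x ω s) :
    Measurable fun ω => coeffApply (a ω) (x ω) :=
  (WithLp.measurable_toLp 2 _).comp
    (measurable_pi_lambda _ fun t => measurable_mulVec (M := fun ω => (a ω)ᵀ)
      (fun s t => ha t s) hx t)

end Measurability

variable {Ω : Type*} {m0 : MeasurableSpace Ω} {ℙ : Measure Ω}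
  {ι : Type*} [Fintype ι] [DecidableEq ι] {n : ℕ}

/-- The a posteriori error `g` depends on the current noise, but `f = g + a v`, with `a` the
leverage `s / (1 + s)`, is predictable. So `⟪g, v⟫ = ⟪f, v⟫ - a ‖v‖²`: the first term is a
martingale difference, and the second is summable up to a log-determinant. The perturbation `e` is
left in the inequality because Steps 1 and 2 treat it differently. -/
theorem ae_columnForm_add_sum_le [IsProbabilityMeasure ℙ] {ℱ : Filtration ℕ m0} {β : ℝ}
    (hβ : 2 < β) {v : ℕ → Ω → EuclideanSpace ℝ (Fin n)} (hv : IsNoise ℙ ℱ β v)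
    {ψ : ℕ → Ω → ι → ℝ} {y : ℕ → Ω → Fin n → ℝ} {P : ℕ → Ω → Matrix ι ι ℝ}
    {α : ℕ → Ω → Matrix ι (Fin n) ℝ}
    (hLS : ∀ ω, IsLeastSquares (fun k => ψ k ω) (fun k => y k ω) (fun k => P k ω)
      (fun k => α k ω))
    {R₀ : Ω → Matrix ι ι ℝ} (hR : ∀ ω, (R₀ ω).PosDef) (h0 : ∀ ω, P 0 ω = (R₀ ω)⁻¹)
    (hψ : ∀ k s, Measurable[ℱ k] fun ω => ψ k ω s)
    (hP : ∀ k s t, Measurable[ℱ k] fun ω => P k ω s t)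
    (hα : ∀ k s t, Measurable[ℱ k] fun ω => α k ω s t)
    (θ : Matrix ι (Fin n) ℝ) {e : ℕ → Ω → EuclideanSpace ℝ (Fin n)}
    (he : ∀ k, Measurable[ℱ k] (e k))
    (hy : ∀ k ω t, y k ω t = (θᵀ *ᵥ ψ k ω) t + (v k ω + e k ω) t) :
    ∀ᵐ ω ∂ℙ, ∀ ε : ℝ, 0 < ε → ∃ C : ℝ, 0 ≤ C ∧ ∀ N,
      columnForm (information (R₀ ω) (fun k => ψ k ω) N) (θ - α N ω) +
        ∑ k ∈ Finset.range N, (‖coeffApply (θ - α (k + 1) ω) (ψ k ω)‖ ^ 2 +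
          2 * inner ℝ (coeffApply (θ - α (k + 1) ω) (ψ k ω)) (e k ω)) ≤
      ε * ∑ k ∈ Finset.range N, ‖coeffApply (θ - α (k + 1) ω) (ψ k ω)‖ ^ 2 +
        C * (1 + (Real.log (information (R₀ ω) (fun k => ψ k ω) N).det -
          Real.log (R₀ ω).det)) := by
  set s : ℕ → Ω → ℝ := fun k ω => ψ k ω ⬝ᵥ P k ω *ᵥ ψ k ω with hs
  have hs0 : ∀ k ω, 0 ≤ s k ω := fun k ω => by
    simp only [hs]
    rw [(hLS ω).gain_eq (hR ω) (h0 ω)]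
    exact dotProduct_inv_mulVec_nonneg (posDef_information (hR ω) k) _
  have hsm : ∀ k, Measurable[ℱ k] (s k) := fun k =>
    measurable_dotProduct (hψ k) (measurable_mulVec (hP k) (hψ k))
  have hbm : ∀ k, Measurable[ℱ k] fun ω => (1 + s k ω)⁻¹ := fun k =>
    ((hsm k).const_add 1).inv
  set a : ℕ → Ω → ℝ := fun k ω => (1 + s k ω)⁻¹ * s k ω with ha
  have ha0 : ∀ k ω, 0 ≤ a k ω := fun k ω =>
    mul_nonneg (inv_nonneg.2 (by linarith [hs0 k ω])) (hs0 k ω)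
  have ha1 : ∀ k ω, a k ω ≤ 1 := fun k ω => by
    have := hs0 k ω
    simp only [ha]
    rw [inv_mul_le_one₀ (by linarith)]
    linarith
  set f : ℕ → Ω → EuclideanSpace ℝ (Fin n) := fun k ω =>
    (1 + s k ω)⁻¹ • (coeffApply (θ - α k ω) (ψ k ω) - s k ω • e k ω) with hf
  have hfm : ∀ k, Measurable[ℱ k] (f k) := fun k =>
    (hbm k).smul ((measurable_coeffApply (fun i t => (hα k i t).const_sub (θ i t)) (hψ k)).sub
      ((hsm k).smul (he k)))
  set g : ℕ → Ω → EuclideanSpace ℝ (Fin n) := fun k ω =>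
    coeffApply (θ - α (k + 1) ω) (ψ k ω) with hg
  have hgf : ∀ k ω, f k ω = g k ω + a k ω • v k ω := fun k ω => by
    simp only [hg, hf, ha]
    rw [(hLS ω).coeffApply_succ (hR ω) (h0 ω) θ k (v k ω + e k ω) (hy k ω)]
    simp only [smul_sub, smul_add, smul_smul, hs]
    abel
  filter_upwards [hv.ae_abs_sum_inner_le hβ f hfm,
    hv.ae_sum_mul_sq_le hβ a (fun k => (hbm k).mul (hsm k)) ha0 ha1] with ω h1 ⟨C₂, h2⟩ ε hε
  -- The inner product enters with factor `2`, and `‖f‖² ≤ 2 ‖g‖² + 2 a ‖v‖²`; so `ε / 4` here costs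
  -- exactly `ε` in front of `∑ ‖g‖²`.
  obtain ⟨C₁, h1⟩ := h1 (ε / 4) (by positivity)
  set V : ℕ → ℝ := fun N => columnForm (information (R₀ ω) (fun k => ψ k ω) N) (θ - α N ω) with hV
  set ℓ : ℕ → ℝ := fun N => Real.log (information (R₀ ω) (fun k => ψ k ω) N).det -
    Real.log (R₀ ω).det with hℓ
  have hℓ0 : ∀ N, 0 ≤ ℓ N := fun N =>
    sub_nonneg.2 (log_det_le_log_det_information (ψ := fun k => ψ k ω) (hR ω) N)
  have hsumle : ∀ N, ∑ k ∈ Finset.range N, a k ω ≤ ℓ N := fun N => by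
    have := sum_leverage_le (ψ := fun k => ψ k ω) (hR ω) N
    simp only [← (hLS ω).gain_eq (hR ω) (h0 ω)] at this
    exact this
  have hVstep : ∀ k, V (k + 1) + (‖g k ω‖ ^ 2 + 2 * inner ℝ (g k ω) (e k ω)) ≤
      V k - 2 * inner ℝ (f k ω) (v k ω) + 2 * (a k ω * ‖v k ω‖ ^ 2) := fun k => by
    have hr : ∀ t, (g k ω + (v k ω + e k ω)) t = y k ω t - ((α (k + 1) ω)ᵀ *ᵥ ψ k ω) t :=
      fun t => by
      rw [hy]
      simp [hg, coeffApply, sub_mulVec]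
      ring
    have h := (hLS ω).columnForm_succ (hR ω) (h0 ω) θ k _ hr
    have h3 : inner ℝ (f k ω) (v k ω) = inner ℝ (g k ω) (v k ω) + a k ω * ‖v k ω‖ ^ 2 := by
      rw [hgf, inner_add_left, real_inner_smul_left, real_inner_self_eq_norm_sq]
    have h4 : inner ℝ (g k ω) (g k ω + (v k ω + e k ω)) =
        ‖g k ω‖ ^ 2 + (inner ℝ (g k ω) (v k ω) + inner ℝ (g k ω) (e k ω)) := by
      rw [inner_add_right, inner_add_right, real_inner_self_eq_norm_sq]
    have h5 : 0 ≤ s k ω * ‖g k ω + (v k ω + e k ω)‖ ^ 2 := mul_nonneg (hs0 k ω) (sq_nonneg _)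
    change V (k + 1) = V k - 2 * inner ℝ (g k ω) (g k ω + (v k ω + e k ω)) -
      s k ω * ‖g k ω + (v k ω + e k ω)‖ ^ 2 + ‖g k ω‖ ^ 2 at h
    rw [h4] at h
    rw [h3]
    linarith
  have hVsum : ∀ N, V N + ∑ k ∈ Finset.range N, (‖g k ω‖ ^ 2 + 2 * inner ℝ (g k ω) (e k ω)) ≤
      V 0 - 2 * ∑ k ∈ Finset.range N, inner ℝ (f k ω) (v k ω) +
        2 * ∑ k ∈ Finset.range N, a k ω * ‖v k ω‖ ^ 2 := fun N => by
    induction N with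
    | zero => simp
    | succ N ih =>
      rw [Finset.sum_range_succ, Finset.sum_range_succ, Finset.sum_range_succ]
      linarith [hVstep N]
  have hfsq : ∀ N, ∑ k ∈ Finset.range N, ‖f k ω‖ ^ 2 ≤
      2 * ∑ k ∈ Finset.range N, ‖g k ω‖ ^ 2 +
        2 * ∑ k ∈ Finset.range N, a k ω * ‖v k ω‖ ^ 2 := fun N => by
    rw [Finset.mul_sum, Finset.mul_sum, ← Finset.sum_add_distrib]
    refine Finset.sum_le_sum fun k _ => ?_
    have h3 : ‖f k ω‖ ≤ ‖g k ω‖ + a k ω * ‖v k ω‖ := by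
      rw [hgf]
      refine (norm_add_le _ _).trans ?_
      rw [norm_smul, Real.norm_of_nonneg (ha0 k ω)]
    have h4 : (a k ω * ‖v k ω‖) ^ 2 ≤ a k ω * ‖v k ω‖ ^ 2 := by
      rw [mul_pow]
      gcongr
      nlinarith [ha0 k ω, ha1 k ω]
    nlinarith [norm_nonneg (f k ω), sq_nonneg (‖g k ω‖ - a k ω * ‖v k ω‖)]
  have hav : ∀ N, ∑ k ∈ Finset.range N, a k ω * ‖v k ω‖ ^ 2 ≤ |C₂| * (1 + ℓ N) := fun N => by
    refine (h2 N).trans ?_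
    have : 0 ≤ ∑ k ∈ Finset.range N, a k ω := Finset.sum_nonneg fun k _ => ha0 k ω
    exact mul_le_mul (le_abs_self _) (by linarith [hsumle N]) (by linarith) (abs_nonneg _)
  refine ⟨|V 0| + 2 * |C₁| + (ε + 2) * |C₂|, by positivity, fun N => ?_⟩
  have e1 := hVsum N
  have e2 := (abs_le.1 (h1 N)).1
  have e3 := hfsq N
  have e4 := hav N
  have e5 : ε / 4 * ∑ k ∈ Finset.range N, ‖f k ω‖ ^ 2 ≤ ε / 4 *
    (2 * ∑ k ∈ Finset.range N, ‖g k ω‖ ^ 2 +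
        2 * ∑ k ∈ Finset.range N, a k ω * ‖v k ω‖ ^ 2) := by gcongr
  have e6 : (ε + 2) * ∑ k ∈ Finset.range N, a k ω * ‖v k ω‖ ^ 2 ≤ (ε + 2) * (|C₂| * (1 + ℓ N)) := by
    gcongr
  have e7 := le_abs_self (V 0)
  have e8 := le_abs_self C₁
  have e9 : |V 0| + 2 * |C₁| ≤ (|V 0| + 2 * |C₁|) * (1 + ℓ N) :=
    le_mul_of_one_le_right (by positivity) (by linarith [hℓ0 N])
  change V N + ∑ k ∈ Finset.range N, (‖g k ω‖ ^ 2 + 2 * inner ℝ (g k ω) (e k ω)) ≤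
    ε * ∑ k ∈ Finset.range N, ‖g k ω‖ ^ 2 +
      (|V 0| + 2 * |C₁| + (ε + 2) * |C₂|) * (1 + ℓ N)
  have e10 : 0 ≤ ∑ k ∈ Finset.range N, ‖g k ω‖ ^ 2 := Finset.sum_nonneg fun k _ => sq_nonneg _
  have e11 : 0 ≤ ∑ k ∈ Finset.range N, a k ω * ‖v k ω‖ ^ 2 :=
    Finset.sum_nonneg fun k _ => mul_nonneg (ha0 k ω) (sq_nonneg _)
  nlinarith

/-! ### Moving averages of sequences -/

/-- The moving average `∑_{m < L} G_m x_{k-m}`. -/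
def movingAverage {a b : ℕ} (G : ℕ → Matrix (Fin a) (Fin b) ℝ) (L : ℕ)
    (x : ℤ → EuclideanSpace ℝ (Fin b)) (k : ℤ) : EuclideanSpace ℝ (Fin a) :=
  WithLp.toLp 2 (∑ m ∈ Finset.range L, G m *ᵥ x (k - m))

/-- The value `∑_{m < L} z^m G_m` of a matrix polynomial. -/
def polyEval {a b : ℕ} (G : ℕ → Matrix (Fin a) (Fin b) ℝ) (L : ℕ) (z : ℂ) :
    Matrix (Fin a) (Fin b) ℂ :=
  ∑ m ∈ Finset.range L, z ^ m • (G m).map (fun x : ℝ => (x : ℂ))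

lemma circleIntegrable_norm_sq_eval (p : Polynomial ℂ) :
    CircleIntegrable (fun z => ‖p.eval z‖ ^ 2) 0 1 :=
  ContinuousOn.circleIntegrable zero_le_one (by fun_prop)

/-- **Parseval's inequality** for moving averages: if the matrix polynomial has norm at most `γ`
on the unit circle, then the moving average has norm at most `γ` in `ℓ²`. -/
theorem sum_norm_movingAverage_sq_le {a b : ℕ} (G : ℕ → Matrix (Fin a) (Fin b) ℝ) (L : ℕ) {γ : ℝ}
    (hG : ∀ z : ℂ, ‖z‖ = 1 → ∀ x : Fin b → ℂ,
      ‖WithLp.toLp 2 (polyEval G L z *ᵥ x)‖ ≤ γ * ‖WithLp.toLp 2 x‖)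
    (x : ℤ → EuclideanSpace ℝ (Fin b)) (hx : ∀ k < 0, x k = 0) (N : ℕ) :
    ∑ k ∈ Finset.range N, ‖movingAverage G L x k‖ ^ 2 ≤
      γ ^ 2 * ∑ k ∈ Finset.range N, ‖x k‖ ^ 2 := by
  -- Causality allows the signal to be cut off at time `N`, which turns it into polynomials `X`. The
  -- coefficients of `Y`, the product of the symbol with `X`, are the moving average below `N`;
  -- those from `N` on are discarded, so only an inequality remains.
  set X : Fin b → Polynomial ℂ := fun u =>
    ∑ k ∈ Finset.range N, Polynomial.C (x k u : ℂ) * Polynomial.X ^ k with hX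
  set Y : Fin a → Polynomial ℂ := fun t =>
    ∑ u, ∑ m ∈ Finset.range L, Polynomial.C (G m t u : ℂ) * (X u * Polynomial.X ^ m) with hY
  have hXc : ∀ u k, (X u).coeff k = if k < N then (x k u : ℂ) else 0 := fun u k => by
    simp [hX, Polynomial.finsetSum_coeff, Polynomial.coeff_C_mul, Polynomial.coeff_X_pow]
  have hYc : ∀ t k, k < N → (Y t).coeff k = (movingAverage G L x k t : ℂ) := fun t k hk => by
    simp only [hY, Polynomial.finsetSum_coeff, Polynomial.coeff_C_mul, Polynomial.coeff_mul_X_pow',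
      hXc, movingAverage, Finset.sum_apply, mulVec, dotProduct]
    rw [Finset.sum_comm]
    push_cast
    refine Finset.sum_congr rfl fun m _ => Finset.sum_congr rfl fun u _ => ?_
    by_cases hm : m ≤ k
    · rw [if_pos hm, if_pos (by omega), Nat.cast_sub hm]
    · rw [if_neg hm, hx _ (by omega)]
      simp
  have hYe : ∀ z t, (Y t).eval z = (polyEval G L z *ᵥ fun u => (X u).eval z) t := fun z t => by
    simp only [hY, polyEval, Polynomial.eval_finsetSum, Polynomial.eval_mul, Polynomial.eval_C,
      Polynomial.eval_pow, Polynomial.eval_X, mulVec, dotProduct, Matrix.sum_apply,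
      Matrix.smul_apply,
      map_apply, smul_eq_mul, Finset.sum_mul]
    exact Finset.sum_congr rfl fun u _ => Finset.sum_congr rfl fun m _ => by ring
  have hYle : ∑ k ∈ Finset.range N, ‖movingAverage G L x k‖ ^ 2 ≤
      ∑ t, Real.circleAverage (fun z => ‖(Y t).eval z‖ ^ 2) 0 1 := by
    calc ∑ k ∈ Finset.range N, ‖movingAverage G L x k‖ ^ 2
        = ∑ t, ∑ k ∈ Finset.range N, ‖(Y t).coeff k‖ ^ 2 := by
          rw [Finset.sum_comm]
          refine Finset.sum_congr rfl fun k hk => ?_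
          rw [EuclideanSpace.norm_sq_eq]
          refine Finset.sum_congr rfl fun t _ => ?_
          rw [hYc t k (Finset.mem_range.1 hk), Complex.norm_real]
      _ ≤ _ := by
          refine Finset.sum_le_sum fun t _ => ?_
          rw [← Polynomial.sum_sq_norm_coeff_eq_circleAverage]
          rw [← Finset.sum_filter_add_sum_filter_not (Finset.range N) (· ∈ (Y t).support)]
          have h0 : ∑ k ∈ Finset.range N with k ∉ (Y t).support, ‖(Y t).coeff k‖ ^ 2 = 0 :=
            Finset.sum_eq_zero fun k hk => by
              simp [Polynomial.notMem_support_iff.1 (Finset.mem_filter.1 hk).2]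
          rw [h0, add_zero]
          exact Finset.sum_le_sum_of_subset_of_nonneg
            (fun k hk => (Finset.mem_filter.1 hk).2) fun _ _ _ => sq_nonneg _
  have hXeq : ∑ u, Real.circleAverage (fun z => ‖(X u).eval z‖ ^ 2) 0 1 =
      ∑ k ∈ Finset.range N, ‖x k‖ ^ 2 := by
    simp_rw [EuclideanSpace.norm_sq_eq]
    rw [Finset.sum_comm]
    refine Finset.sum_congr rfl fun u _ => ?_
    rw [← Polynomial.sum_sq_norm_coeff_eq_circleAverage]
    have hsub : (X u).support ⊆ Finset.range N := fun k hk => by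
      by_contra h
      rw [Polynomial.mem_support_iff, hXc, if_neg (by simpa using h)] at hk
      exact hk rfl
    rw [Finset.sum_subset hsub fun k _ hk => by simp [Polynomial.notMem_support_iff.1 hk]]
    refine Finset.sum_congr rfl fun k hk => ?_
    rw [hXc, if_pos (Finset.mem_range.1 hk), Complex.norm_real]
  refine hYle.trans ?_
  rw [← hXeq, ← Real.circleAverage_fun_sum fun t _ => circleIntegrable_norm_sq_eval _,
    ← Real.circleAverage_fun_sum fun t _ => circleIntegrable_norm_sq_eval _, ← smul_eq_mul,
    ← Real.circleAverage_fun_smul]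
  refine Real.circleAverage_mono (ContinuousOn.circleIntegrable zero_le_one (by fun_prop))
    (ContinuousOn.circleIntegrable zero_le_one (by fun_prop)) fun z hz => ?_
  have hz1 : ‖z‖ = 1 := by simpa using hz
  have h1 := hG z hz1 fun u => (X u).eval z
  have h2 := pow_le_pow_left₀ (norm_nonneg _) h1 2
  rw [mul_pow, EuclideanSpace.norm_sq_eq, EuclideanSpace.norm_sq_eq] at h2
  simpa only [hYe, smul_eq_mul] using h2

/-- The coefficients of the product of two matrix polynomials with `h` and `q` coefficients. -/
def polyMul {a b c : ℕ} (F : ℕ → Matrix (Fin a) (Fin b) ℝ) (h : ℕ)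
    (G : ℕ → Matrix (Fin b) (Fin c) ℝ) (q : ℕ) (m : ℕ) : Matrix (Fin a) (Fin c) ℝ :=
  ∑ i ∈ Finset.range h, ∑ j ∈ Finset.range q, if i + j = m then F i * G j else 0

lemma sum_range_sum_ite {M : Type*} [AddCommMonoid M] (h q L : ℕ) (hL : h + q ≤ L + 1)
    (f : ℕ → ℕ → ℕ → M) :
    ∑ m ∈ Finset.range L, ∑ i ∈ Finset.range h, ∑ j ∈ Finset.range q,
      (if i + j = m then f i j m else 0) =
    ∑ i ∈ Finset.range h, ∑ j ∈ Finset.range q, f i j (i + j) := by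
  rw [Finset.sum_comm]
  refine Finset.sum_congr rfl fun i hi => ?_
  rw [Finset.sum_comm]
  refine Finset.sum_congr rfl fun j hj => ?_
  rw [Finset.mem_range] at hi hj
  rw [Finset.sum_ite_eq, if_pos (Finset.mem_range.2 (by omega))]

lemma polyMul_zero {n : ℕ} {D G : ℕ → Matrix (Fin n) (Fin n) ℝ} (hD : D 0 = 1)
    (hG : G 0 = 1) (h q : ℕ) :
    polyMul D (h + 1) G (q + 1) 0 = 1 := by
  rw [polyMul, Finset.sum_eq_single 0, Finset.sum_eq_single 0]
  · simp [hD, hG]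
  · intro j _ hj
    simp [hj]
  · simp
  · intro i _ hi
    exact Finset.sum_eq_zero fun j _ => by simp [hi]
  · simp

lemma movingAverage_polyMul {a b c : ℕ} (F : ℕ → Matrix (Fin a) (Fin b) ℝ) (h : ℕ)
    (G : ℕ → Matrix (Fin b) (Fin c) ℝ) (q L : ℕ) (hL : h + q ≤ L + 1)
    (x : ℤ → EuclideanSpace ℝ (Fin c)) (k : ℤ) :
    movingAverage (polyMul F h G q) L x k = movingAverage F h (movingAverage G q x) k := by
  have h1 : ∀ m, polyMul F h G q m *ᵥ x (k - m) = ∑ i ∈ Finset.range h, ∑ j ∈ Finset.range q,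
      if i + j = m then (F i * G j) *ᵥ x (k - m) else 0 := fun m => by
    rw [polyMul, sum_mulVec]
    refine Finset.sum_congr rfl fun i _ => ?_
    rw [sum_mulVec]
    refine Finset.sum_congr rfl fun j _ => ?_
    split_ifs <;> simp
  simp only [movingAverage, h1]
  congr 1
  rw [sum_range_sum_ite h q L hL fun i j m => (F i * G j) *ᵥ x (k - m)]
  refine Finset.sum_congr rfl fun i _ => ?_
  rw [mulVec_sum]
  refine Finset.sum_congr rfl fun j _ => ?_
  rw [mulVec_mulVec]
  congr 3
  push_cast
  ring

lemma polyEval_polyMul {a b c : ℕ} (F : ℕ → Matrix (Fin a) (Fin b) ℝ) (h : ℕ)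
    (G : ℕ → Matrix (Fin b) (Fin c) ℝ) (q L : ℕ) (hL : h + q ≤ L + 1) (z : ℂ) :
    polyEval (polyMul F h G q) L z = polyEval F h z * polyEval G q z := by
  have hmap : ∀ m, (polyMul F h G q m).map (fun x : ℝ => (x : ℂ)) =
      ∑ i ∈ Finset.range h, ∑ j ∈ Finset.range q, if i + j = m then
        (F i).map (fun x : ℝ => (x : ℂ)) * (G j).map (fun x : ℝ => (x : ℂ)) else 0 := fun m => by
    ext s t
    simp only [polyMul, map_apply, Matrix.sum_apply, Complex.ofReal_sum]
    refine Finset.sum_congr rfl fun i _ => Finset.sum_congr rfl fun j _ => ?_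
    split_ifs <;> simp [mul_apply]
  have h1 : ∀ m, z ^ m • (polyMul F h G q m).map (fun x : ℝ => (x : ℂ)) =
      ∑ i ∈ Finset.range h, ∑ j ∈ Finset.range q, if i + j = m then
        z ^ m • ((F i).map (fun x : ℝ => (x : ℂ)) * (G j).map (fun x : ℝ => (x : ℂ))) else 0 :=
    fun m => by
    rw [hmap, Finset.smul_sum]
    refine Finset.sum_congr rfl fun i _ => ?_
    rw [Finset.smul_sum]
    refine Finset.sum_congr rfl fun j _ => ?_
    split_ifs <;> simp
  simp only [polyEval, h1]
  rw [sum_range_sum_ite h q L hL fun i j m =>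
    z ^ m • ((F i).map (fun x : ℝ => (x : ℂ)) * (G j).map (fun x : ℝ => (x : ℂ))),
    Matrix.sum_mul]
  refine Finset.sum_congr rfl fun i _ => ?_
  rw [Matrix.mul_sum]
  refine Finset.sum_congr rfl fun j _ => ?_
  rw [Matrix.smul_mul, Matrix.mul_smul, smul_smul, pow_add]

/-! ### Norms of the noise polynomial -/

/-- Cauchy–Schwarz for `‖A v‖² = ⟪v, Aᴴ A v⟫`, followed by division by `‖A v‖`. It is needed because
`noisePolySupNorm` is built from `C Cᴴ`, which controls the adjoint. -/
lemma norm_mulVec_le_of_conjTranspose {n : ℕ} {A : Matrix (Fin n) (Fin n) ℂ} {γ : ℝ}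
    (h : ∀ v, ‖WithLp.toLp 2 (Aᴴ *ᵥ v)‖ ≤ γ * ‖WithLp.toLp 2 v‖) (v : Fin n → ℂ) :
    ‖WithLp.toLp 2 (A *ᵥ v)‖ ≤ γ * ‖WithLp.toLp 2 v‖ := by
  rcases eq_or_ne ‖WithLp.toLp 2 (A *ᵥ v)‖ 0 with h0 | h0
  · have h1 := (norm_nonneg _).trans (h v)
    rw [h0]
    exact h1
  have h1 : inner ℂ (WithLp.toLp 2 v) (WithLp.toLp 2 (Aᴴ *ᵥ (A *ᵥ v))) =
      inner ℂ (WithLp.toLp 2 (A *ᵥ v)) (WithLp.toLp 2 (A *ᵥ v)) := by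
    rw [EuclideanSpace.inner_eq_star_dotProduct, EuclideanSpace.inner_eq_star_dotProduct]
    simp only
    rw [dotProduct_comm, dotProduct_mulVec, ← star_mulVec, dotProduct_comm]
  have h2 : ‖WithLp.toLp 2 (A *ᵥ v)‖ ^ 2 ≤
      ‖WithLp.toLp 2 v‖ * ‖WithLp.toLp 2 (Aᴴ *ᵥ (A *ᵥ v))‖ := by
    have h3 := norm_inner_le_norm (𝕜 := ℂ) (WithLp.toLp 2 v) (WithLp.toLp 2 (Aᴴ *ᵥ (A *ᵥ v)))
    rw [h1, inner_self_eq_norm_sq_to_K] at h3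
    simpa using h3
  have h4 := mul_le_mul_of_nonneg_left (h (A *ᵥ v)) (norm_nonneg (WithLp.toLp 2 v))
  have h5 : 0 < ‖WithLp.toLp 2 (A *ᵥ v)‖ := lt_of_le_of_ne (norm_nonneg _) h0.symm
  refine le_of_mul_le_mul_right ?_ h5
  nlinarith

/-- The left side is the quadratic form of `A Aᴴ` at `v`. -/
lemma norm_conjTranspose_mulVec_sq_le {n : ℕ} (A : Matrix (Fin n) (Fin n) ℂ) (v : Fin n → ℂ) :
    ‖WithLp.toLp 2 (Aᴴ *ᵥ v)‖ ^ 2 ≤ eigMax (A * Aᴴ) * ‖WithLp.toLp 2 v‖ ^ 2 := by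
  have h := (posSemidef_eigMax_sub (isHermitian_mul_conjTranspose_self A)).re_dotProduct_nonneg v
  have h1 : star v ⬝ᵥ (A * Aᴴ) *ᵥ v = ((‖WithLp.toLp 2 (Aᴴ *ᵥ v)‖ ^ 2 : ℝ) : ℂ) := by
    have h2 := inner_self_eq_norm_sq_to_K (𝕜 := ℂ) (WithLp.toLp 2 (Aᴴ *ᵥ v))
    rw [EuclideanSpace.inner_eq_star_dotProduct] at h2
    simp only at h2
    rw [← mulVec_mulVec, dotProduct_mulVec, dotProduct_comm]
    rw [star_mulVec, conjTranspose_conjTranspose] at h2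
    simpa using h2
  have h3 : star v ⬝ᵥ v = ((‖WithLp.toLp 2 v‖ ^ 2 : ℝ) : ℂ) := by
    have h2 := inner_self_eq_norm_sq_to_K (𝕜 := ℂ) (WithLp.toLp 2 v)
    rw [EuclideanSpace.inner_eq_star_dotProduct, dotProduct_comm] at h2
    simpa using h2
  rw [sub_mulVec, dotProduct_sub, h1, Algebra.algebraMap_eq_smul_one, smul_mulVec, one_mulVec,
    dotProduct_smul, h3, Complex.real_smul, ← Complex.ofReal_mul, ← Complex.ofReal_sub,
    RCLike.re_eq_complex_re, Complex.ofReal_re] at h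
  linarith

open scoped ComplexOrder in
-- The trace is visibly continuous in `z`. This shows that the eigenvalues on the unit circle are
-- bounded, so that the real supremum in `noisePolySupNorm` is a genuine upper bound.
lemma eigMax_mul_conjTranspose_le {n : ℕ} (A : Matrix (Fin n) (Fin n) ℂ) :
    eigMax (A * Aᴴ) ≤ (A * Aᴴ).trace.re := by
  have hH := isHermitian_mul_conjTranspose_self A
  have hpos : ∀ i, 0 ≤ hH.eigenvalues i := (posSemidef_self_mul_conjTranspose A).eigenvalues_nonneg
  have htr : (A * Aᴴ).trace.re = ∑ i, hH.eigenvalues i := by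
    rw [hH.trace_eq_sum_eigenvalues]
    simp
  rw [htr]
  refine Real.sSup_le (fun x hx => ?_) (Finset.sum_nonneg fun i _ => hpos i)
  rw [hH.spectrum_real_eq_range_eigenvalues] at hx
  obtain ⟨i, rfl⟩ := hx
  exact Finset.single_le_sum (fun j _ => hpos j) (Finset.mem_univ i)

section Noise

variable {n r : ℕ} (C : Fin r → Matrix (Fin n) (Fin n) ℝ)

/-- The coefficients of `C(z)`, indexed by the powers of `z`. -/
def noiseCoeff : ℕ → Matrix (Fin n) (Fin n) ℝ
  | 0 => 1
  | i + 1 => if h : i < r then C ⟨i, h⟩ else 0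

lemma polyEval_noiseCoeff (z : ℂ) : polyEval (noiseCoeff C) (r + 1) z = noisePoly C z := by
  rw [polyEval, Finset.sum_range_succ', Finset.sum_range, noisePoly, add_comm]
  congr 1
  · ext s t
    simp [noiseCoeff, Matrix.one_apply, apply_ite]
  · exact Finset.sum_congr rfl fun i _ => by simp [noiseCoeff]

lemma continuous_noisePoly : Continuous (noisePoly C) := by
  unfold noisePoly
  fun_prop

/-- On the unit circle `z⁻¹` is the conjugate of `z`, and the coefficients are real. -/
lemma transpose_noisePoly_inv {z : ℂ} (hz : ‖z‖ = 1) :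
    (noisePoly C z⁻¹)ᵀ = (noisePoly C z)ᴴ := by
  have hz' : z⁻¹ = star z := by
    rw [Complex.inv_def, Complex.normSq_eq_norm_sq, hz]
    simp
  rw [noisePoly, noisePoly, transpose_add, conjTranspose_add, transpose_sum, conjTranspose_sum]
  congr 1
  · simp
  · refine Finset.sum_congr rfl fun i _ => ?_
    rw [transpose_smul, conjTranspose_smul, hz', star_pow]
    congr 1
    ext s t
    simp

lemma noisePolySupNorm_nonneg : 0 ≤ noisePolySupNorm C := Real.sqrt_nonneg _

/-- The operator norm of `C(z)` on the unit circle is at most `‖C(z)‖_∞`. -/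
lemma norm_noisePoly_mulVec_le {z : ℂ} (hz : ‖z‖ = 1) (x : Fin n → ℂ) :
    ‖WithLp.toLp 2 (noisePoly C z *ᵥ x)‖ ≤ noisePolySupNorm C * ‖WithLp.toLp 2 x‖ := by
  refine norm_mulVec_le_of_conjTranspose (fun v => ?_) x
  have hbdd : BddAbove (Set.range fun z : {z : ℂ // ‖z‖ = 1} =>
      eigMax (noisePoly C (z : ℂ) * (noisePoly C ((z : ℂ)⁻¹)).transpose)) := by
    have hcont : Continuous fun z : ℂ => (noisePoly C z * (noisePoly C z)ᴴ).trace.re := by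
      have := continuous_noisePoly C
      fun_prop
    obtain ⟨M, hM⟩ := ((isCompact_sphere (0 : ℂ) 1).image hcont).bddAbove
    refine ⟨M, ?_⟩
    rintro _ ⟨w, rfl⟩
    simp only
    rw [transpose_noisePoly_inv C w.2]
    exact (eigMax_mul_conjTranspose_le _).trans
      (hM ⟨w, by simpa using w.2, rfl⟩)
  have h1 := le_ciSup hbdd ⟨z, hz⟩
  simp only at h1
  rw [transpose_noisePoly_inv C hz] at h1
  have h2 : ‖WithLp.toLp 2 ((noisePoly C z)ᴴ *ᵥ v)‖ ^ 2 ≤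
      (⨆ z : {z : ℂ // ‖z‖ = 1},
        eigMax (noisePoly C (z : ℂ) * (noisePoly C ((z : ℂ)⁻¹)).transpose)) *
        ‖WithLp.toLp 2 v‖ ^ 2 :=
    (norm_conjTranspose_mulVec_sq_le _ v).trans (mul_le_mul_of_nonneg_right h1 (sq_nonneg _))
  rw [noisePolySupNorm, ← Real.sqrt_sq (norm_nonneg (WithLp.toLp 2 v)),
    ← Real.sqrt_mul' _ (sq_nonneg _)]
  exact Real.le_sqrt_of_sq_le h2

lemma norm_map_mulVec_le {a b : ℕ} (M : Matrix (Fin a) (Fin b) ℝ) (v : Fin b → ℂ) :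
    ‖WithLp.toLp 2 (M.map (fun x : ℝ => (x : ℂ)) *ᵥ v)‖ ≤ frobNorm M * ‖WithLp.toLp 2 v‖ := by
  rw [frobNorm, ← Real.sqrt_sq (norm_nonneg (WithLp.toLp 2 v)), ← Real.sqrt_mul' _ (sq_nonneg _)]
  refine Real.le_sqrt_of_sq_le ?_
  rw [EuclideanSpace.norm_sq_eq, EuclideanSpace.norm_sq_eq, Finset.sum_mul]
  refine Finset.sum_le_sum fun s _ => ?_
  have h1 : ‖(M.map (fun x : ℝ => (x : ℂ)) *ᵥ v) s‖ ≤ ∑ t, |M s t| * ‖v t‖ := by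
    rw [mulVec, dotProduct]
    refine (norm_sum_le _ _).trans (Finset.sum_le_sum fun t _ => ?_)
    simp
  calc ‖(M.map (fun x : ℝ => (x : ℂ)) *ᵥ v) s‖ ^ 2 ≤ (∑ t, |M s t| * ‖v t‖) ^ 2 := by gcongr
    _ ≤ (∑ t, |M s t| ^ 2) * ∑ t, ‖v t‖ ^ 2 := Finset.sum_mul_sq_le_sq_mul_sq _ _ _
    _ = _ := by simp

variable (D : ℕ → Matrix (Fin n) (Fin n) ℝ) (h : ℕ)

/-- The coefficients of `I - F(z) C(z)`, where `F(z) = ∑_{i ≤ h} D_i z^i`. -/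
def residualCoeff (m : ℕ) : Matrix (Fin n) (Fin n) ℝ :=
  (if m = 0 then 1 else 0) - polyMul D (h + 1) (noiseCoeff C) (r + 1) m

lemma polyEval_residualCoeff (z : ℂ) : polyEval (residualCoeff C D h) (h + r + 1) z =
    1 - polyEval D (h + 1) z * noisePoly C z := by
  rw [← polyEval_noiseCoeff, ← polyEval_polyMul D (h + 1) (noiseCoeff C) (r + 1) (h + r + 1)
    (by omega), polyEval, polyEval]
  have h1 : ∀ m, z ^ m • (residualCoeff C D h m).map (fun x : ℝ => (x : ℂ)) =
      (if m = 0 then 1 else 0) - z ^ m •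
        (polyMul D (h + 1) (noiseCoeff C) (r + 1) m).map (fun x : ℝ => (x : ℂ)) := fun m => by
    rcases eq_or_ne m 0 with rfl | hm
    · ext s t
      simp [residualCoeff, Matrix.one_apply, apply_ite]
    · ext s t
      simp [residualCoeff, hm]
  simp only [h1, Finset.sum_sub_distrib]
  simp

variable {C D h}

/-- Evaluation at `z = 0`. Because of this, multiplying the system by `F` keeps the identity as
leading coefficient of both the output and the noise polynomial. -/
lemma IsInverseExpansion.apply_zero (hD : IsInverseExpansion C D) : D 0 = 1 := by
  have h0 := hD 0 (by simp)
  have h1 : HasSum (fun i : ℕ => (0 : ℂ) ^ i • (D i).map (fun x : ℝ => (x : ℂ)))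
      ((0 : ℂ) ^ 0 • (D 0).map (fun x : ℝ => (x : ℂ))) :=
    hasSum_single 0 fun i hi => by simp [hi]
  have h2 := h0.unique h1
  have h3 : noisePoly C 0 = 1 := by simp [noisePoly]
  rw [h3, inv_one, pow_zero, one_smul] at h2
  ext s t
  have := congrFun (congrFun h2 s) t
  rw [map_apply, one_apply] at this
  rw [one_apply]
  split_ifs at this ⊢ <;> exact_mod_cast this.symm

/-- This makes the perturbation at a given time depend on strictly earlier errors only, hence
predictable. -/
lemma residualCoeff_zero (hD : IsInverseExpansion C D) : residualCoeff C D h 0 = 0 := by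
  simp [residualCoeff, polyMul_zero hD.apply_zero (G := noiseCoeff C) rfl]

/-- The operator norm of `I - F(z) C(z)` on the unit circle. -/
lemma norm_residual_mulVec_le (hC : ∀ z : ℂ, ‖z‖ ≤ 1 → (noisePoly C z).det ≠ 0)
    (hD : IsInverseExpansion C D) {K ρ : ℝ} (hK : 0 < K) (hρ0 : 0 < ρ) (hρ1 : ρ < 1)
    (hDK : ∀ i : ℕ, frobNorm (D i) ≤ K * ρ ^ i) {z : ℂ} (hz : ‖z‖ = 1) (x : Fin n → ℂ) :
    ‖WithLp.toLp 2 (polyEval (residualCoeff C D h) (h + r + 1) z *ᵥ x)‖ ≤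
      K * ρ ^ (h + 1) / (1 - ρ) * noisePolySupNorm C * ‖WithLp.toLp 2 x‖ := by
  set w : Fin n → ℂ := noisePoly C z *ᵥ x with hw
  have hS : HasSum (fun i : ℕ => WithLp.toLp 2 ((z ^ i • (D i).map (fun x : ℝ => (x : ℂ))) *ᵥ w))
      (WithLp.toLp 2 ((noisePoly C z)⁻¹ *ᵥ w)) := by
    have := (hD z hz.le).map (⟨⟨fun M : Matrix (Fin n) (Fin n) ℂ => WithLp.toLp 2 (M *ᵥ w),
      by simp⟩, fun M N => by simp [add_mulVec]⟩ :
      Matrix (Fin n) (Fin n) ℂ →+ EuclideanSpace ℂ (Fin n)) (by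
        change Continuous fun M : Matrix (Fin n) (Fin n) ℂ => WithLp.toLp 2 (M *ᵥ w)
        fun_prop)
    exact this
  have hS' := (hasSum_nat_add_iff' (h + 1)).2 hS
  -- `I - F C = (C⁻¹ - F) C`: the tail of the expansion from index `h + 1` on, applied to `w = C(z)
  -- x`, is bounded by a geometric series.
  have hEq : WithLp.toLp 2 (polyEval (residualCoeff C D h) (h + r + 1) z *ᵥ x) =
      WithLp.toLp 2 ((noisePoly C z)⁻¹ *ᵥ w) - ∑ i ∈ Finset.range (h + 1),
        WithLp.toLp 2 ((z ^ i • (D i).map (fun x : ℝ => (x : ℂ))) *ᵥ w) := by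
    rw [← WithLp.toLp_sum, ← WithLp.toLp_sub, ← sum_mulVec, ← polyEval, ← sub_mulVec,
      polyEval_residualCoeff, hw, mulVec_mulVec, sub_mul,
      nonsing_inv_mul _ (hC z hz.le).isUnit]
  rw [hEq, ← hS'.tsum_eq]
  have hgeom : HasSum (fun i : ℕ => K * ρ ^ (h + 1) * ‖WithLp.toLp 2 w‖ * ρ ^ i)
      (K * ρ ^ (h + 1) * ‖WithLp.toLp 2 w‖ * (1 - ρ)⁻¹) :=
    (hasSum_geometric_of_lt_one hρ0.le hρ1).mul_left _
  refine (tsum_of_norm_bounded hgeom fun i => ?_).trans ?_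
  · rw [smul_mulVec, WithLp.toLp_smul, norm_smul, norm_pow, hz, one_pow, one_mul]
    refine (norm_map_mulVec_le _ _).trans ?_
    calc frobNorm (D (i + (h + 1))) * ‖WithLp.toLp 2 w‖
        ≤ K * ρ ^ (i + (h + 1)) * ‖WithLp.toLp 2 w‖ := by gcongr; exact hDK _
      _ = _ := by rw [pow_add]; ring
  · have h1 := norm_noisePoly_mulVec_le C hz x
    have h2 : 0 < 1 - ρ := by linarith
    calc K * ρ ^ (h + 1) * ‖WithLp.toLp 2 w‖ * (1 - ρ)⁻¹
        = K * ρ ^ (h + 1) / (1 - ρ) * ‖WithLp.toLp 2 w‖ := by ring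
      _ ≤ K * ρ ^ (h + 1) / (1 - ρ) * (noisePolySupNorm C * ‖WithLp.toLp 2 x‖) := by gcongr
      _ = _ := by ring

/-- The hypothesis is the logarithm of `ρ ^ (h + 1) < (1 - ρ) / (K Γ)`, divided by the negative
number `log ρ`. For `Γ = 0` the gain is zero whatever `h` is. -/
lemma residual_gain_lt_one {Γ K ρ : ℝ} (hΓ : 0 ≤ Γ) (hK : 0 < K) (hρ0 : 0 < ρ) (hρ1 : ρ < 1)
    (hh : Real.log (Γ⁻¹ * K⁻¹ * (1 - ρ)) / Real.log ρ - 1 < (h : ℝ)) :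
    K * ρ ^ (h + 1) / (1 - ρ) * Γ < 1 := by
  rcases hΓ.eq_or_lt with rfl | hΓ
  · simp
  have h1 : 0 < 1 - ρ := by linarith
  have hlog : Real.log ρ < 0 := Real.log_neg hρ0 hρ1
  have h2 : Real.log (Γ⁻¹ * K⁻¹ * (1 - ρ)) / Real.log ρ < ((h + 1 : ℕ) : ℝ) := by
    push_cast
    linarith
  rw [div_lt_iff_of_neg hlog, ← Real.log_pow] at h2
  have h3 := (Real.log_lt_log_iff (by positivity) (by positivity)).1 h2
  have h4 : Γ⁻¹ * K⁻¹ * (1 - ρ) * (K * Γ / (1 - ρ)) = 1 := by field_simp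
  have h5 : 0 < K * Γ / (1 - ρ) := by positivity
  calc K * ρ ^ (h + 1) / (1 - ρ) * Γ = ρ ^ (h + 1) * (K * Γ / (1 - ρ)) := by ring
    _ < Γ⁻¹ * K⁻¹ * (1 - ρ) * (K * Γ / (1 - ρ)) := by gcongr
    _ = 1 := h4

end Noise

/-! ### The system equation as a linear regression -/

section System

variable {n l p q r : ℕ}

/-- Only finitely many lags matter; thus the zero initial values of the algorithm disappear from the
regressors after finitely many steps. -/
lemma regressor_congr {y y' : ℤ → EuclideanSpace ℝ (Fin n)} {u u' : ℤ → EuclideanSpace ℝ (Fin l)}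
    {e e' : ℤ → EuclideanSpace ℝ (Fin n)} {k : ℤ}
    (hy : ∀ i < p, y (k - i) = y' (k - i)) (hu : ∀ i < q, u (k - i) = u' (k - i))
    (he : ∀ i < r, e (k - i) = e' (k - i)) :
    regressor p q r y u e k = regressor p q r y' u' e' k := by
  funext s
  rcases s with ⟨i, a⟩ | ⟨j, b⟩ | ⟨ν, c⟩
  · simp [regressor, hy i i.2]
  · simp [regressor, hu j j.2]
  · simp [regressor, he ν ν.2]

lemma dotProduct_regressor_self (y : ℤ → EuclideanSpace ℝ (Fin n))
    (u : ℤ → EuclideanSpace ℝ (Fin l)) (e : ℤ → EuclideanSpace ℝ (Fin n)) (k : ℤ) :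
    regressor p q r y u e k ⬝ᵥ regressor p q r y u e k =
      ∑ i ∈ Finset.range p, ‖y (k - i)‖ ^ 2 + (∑ j ∈ Finset.range q, ‖u (k - j)‖ ^ 2 +
        ∑ ν ∈ Finset.range r, ‖e (k - ν)‖ ^ 2) := by
  simp only [dotProduct, Fintype.sum_sum_type, Fintype.sum_prod_type, regressor,
    EuclideanSpace.real_norm_sq_eq, Finset.sum_range, ← sq]

lemma paramMatrix_transpose_mulVec_regressor (A : Fin p → Matrix (Fin n) (Fin n) ℝ)
    (B : Fin q → Matrix (Fin n) (Fin l) ℝ) (C : Fin r → Matrix (Fin n) (Fin n) ℝ)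
    (y : ℤ → EuclideanSpace ℝ (Fin n)) (u : ℤ → EuclideanSpace ℝ (Fin l))
    (e : ℤ → EuclideanSpace ℝ (Fin n)) (k : ℤ) (t : Fin n) :
    ((paramMatrix A B C)ᵀ *ᵥ regressor p q r y u e k) t =
      -(∑ i : Fin p, ((A i).mulVec (y (k - (i : ℕ)))) t) +
        (∑ j : Fin q, ((B j).mulVec (u (k - (j : ℕ)))) t +
          ∑ ν : Fin r, ((C ν).mulVec (e (k - (ν : ℕ)))) t) := by
  simp only [mulVec, dotProduct, transpose_apply, Fintype.sum_sum_type, Fintype.sum_prod_type,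
    paramMatrix, regressor, neg_mul, Finset.sum_neg_distrib]

lemma movingAverage_succ {a b : ℕ} (G : ℕ → Matrix (Fin a) (Fin b) ℝ) (L : ℕ)
    (x : ℤ → EuclideanSpace ℝ (Fin b)) (k : ℤ) (t : Fin a) :
    movingAverage G (L + 1) x (k + 1) t =
      (G 0 *ᵥ x (k + 1)) t + ∑ m : Fin L, (G (m + 1) *ᵥ x (k - (m : ℕ))) t := by
  simp only [movingAverage, Finset.sum_range_succ', Finset.sum_apply, Pi.add_apply,
    Finset.sum_range]
  rw [add_comm]
  congr 1
  · simp
  · refine Finset.sum_congr rfl fun m _ => ?_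
    rw [show k + 1 - ((m + 1 : ℕ) : ℤ) = k - (m : ℕ) by push_cast; ring]

/-- The system equation at time `k`. -/
def SystemAt (A : Fin p → Matrix (Fin n) (Fin n) ℝ)
    (B : Fin q → Matrix (Fin n) (Fin l) ℝ) (C : Fin r → Matrix (Fin n) (Fin n) ℝ)
    (y : ℤ → EuclideanSpace ℝ (Fin n)) (u : ℤ → EuclideanSpace ℝ (Fin l))
    (w : ℤ → EuclideanSpace ℝ (Fin n)) (k : ℤ) : Prop :=
  ∀ t : Fin n,
    y (k + 1) t + ∑ i : Fin p, ((A i).mulVec (y (k - (i : ℕ)))) t =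
      ∑ j : Fin q, ((B j).mulVec (u (k - (j : ℕ)))) t +
        (w (k + 1) t + ∑ ν : Fin r, ((C ν).mulVec (w (k - (ν : ℕ)))) t)

/-- The system equation as a regression on signals in which the noise `w` is replaced by `e`. -/
lemma SystemAt.regression {A : Fin p → Matrix (Fin n) (Fin n) ℝ}
    {B : Fin q → Matrix (Fin n) (Fin l) ℝ} {C : Fin r → Matrix (Fin n) (Fin n) ℝ}
    {y : ℤ → EuclideanSpace ℝ (Fin n)} {u : ℤ → EuclideanSpace ℝ (Fin l)}
    {w : ℤ → EuclideanSpace ℝ (Fin n)} {k : ℤ} (h : SystemAt A B C y u w k)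
    (e ξ : ℤ → EuclideanSpace ℝ (Fin n)) (hξ : ∀ i < r, ξ (k - i) = e (k - i) - w (k - i))
    (G : ℕ → Matrix (Fin n) (Fin n) ℝ) (hG0 : G 0 = 0) (hG : ∀ ν : Fin r, G (ν + 1) = -C ν)
    (t : Fin n) :
    y (k + 1) t = ((paramMatrix A B C)ᵀ *ᵥ regressor p q r y u e k) t +
      (w (k + 1) + movingAverage G (r + 1) ξ (k + 1)) t := by
  rw [paramMatrix_transpose_mulVec_regressor, PiLp.add_apply, movingAverage_succ, hG0]
  have h1 : ∑ m : Fin r, (G (m + 1) *ᵥ ξ (k - (m : ℕ))) t =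
      ∑ ν : Fin r, ((C ν).mulVec (w (k - (ν : ℕ)))) t -
        ∑ ν : Fin r, ((C ν).mulVec (e (k - (ν : ℕ)))) t := by
    rw [← Finset.sum_sub_distrib]
    refine Finset.sum_congr rfl fun ν _ => ?_
    rw [hG, hξ ν ν.2, WithLp.ofLp_sub, mulVec_sub, neg_mulVec, neg_mulVec, Pi.sub_apply,
      Pi.neg_apply, Pi.neg_apply]
    ring
  rw [h1]
  have h2 := h t
  simp only [zero_mulVec, Pi.zero_apply]
  linarith

/-- The coefficients of `B(z)`, indexed by the powers of `z`. -/
def inputCoeff (B : Fin q → Matrix (Fin n) (Fin l) ℝ) (j : ℕ) : Matrix (Fin n) (Fin l) ℝ :=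
  if h : j < q then B ⟨j, h⟩ else 0

/-- Multiplying the system equation from the left by `F(z) = ∑_{i ≤ h} D_i z^i`. -/
lemma systemAt_polyMul {A : Fin p → Matrix (Fin n) (Fin n) ℝ}
    {B : Fin q → Matrix (Fin n) (Fin l) ℝ} {C : Fin r → Matrix (Fin n) (Fin n) ℝ}
    {y : ℤ → EuclideanSpace ℝ (Fin n)} {u : ℤ → EuclideanSpace ℝ (Fin l)}
    {w : ℤ → EuclideanSpace ℝ (Fin n)} (hsys : IsSystem A B C y u w)
    {D : ℕ → Matrix (Fin n) (Fin n) ℝ} (hD : D 0 = 1) (h : ℕ) {k : ℤ} (hk : h ≤ k) :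
    SystemAt (fun i : Fin (p + h) => polyMul D (h + 1) (noiseCoeff A) (p + 1) (i + 1))
      (fun j : Fin (q + h) => polyMul D (h + 1) (inputCoeff B) q j)
      (fun ν : Fin (r + h) => polyMul D (h + 1) (noiseCoeff C) (r + 1) (ν + 1)) y u w k := by
  intro t
  have hbase : ∀ j : ℤ, 0 ≤ j → movingAverage (noiseCoeff A) (p + 1) y (j + 1) =
      movingAverage (inputCoeff B) q u j + movingAverage (noiseCoeff C) (r + 1) w (j + 1) := by
    intro j hj
    ext t
    rw [PiLp.add_apply, movingAverage_succ, movingAverage_succ]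
    have h1 := hsys j hj t
    have h2 : movingAverage (inputCoeff B) q u j t =
        ∑ i : Fin q, ((B i).mulVec (u (j - (i : ℕ)))) t := by
      simp only [movingAverage, Finset.sum_apply, Finset.sum_range]
      exact Finset.sum_congr rfl fun i _ => by simp [inputCoeff]
    rw [h2]
    simpa [noiseCoeff] using h1
  -- `F` reaches `h` steps into the past and the system equation holds from time `0` on; hence `h ≤
  -- k`.
  have hmul : movingAverage D (h + 1) (movingAverage (noiseCoeff A) (p + 1) y) (k + 1) =
      movingAverage D (h + 1) (movingAverage (inputCoeff B) q u) k +
        movingAverage D (h + 1) (movingAverage (noiseCoeff C) (r + 1) w) (k + 1) := by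
    ext t
    simp only [PiLp.add_apply]
    simp only [movingAverage.eq_def D, Finset.sum_apply]
    rw [← Finset.sum_add_distrib]
    refine Finset.sum_congr rfl fun m hm => ?_
    have hm' : (m : ℤ) ≤ h := by
      have := Finset.mem_range.1 hm
      omega
    rw [show k + 1 - (m : ℤ) = k - m + 1 by ring, hbase _ (by omega), WithLp.ofLp_add, mulVec_add,
      Pi.add_apply]
  rw [← movingAverage_polyMul D (h + 1) _ (p + 1) (p + h + 1) (by omega),
    ← movingAverage_polyMul D (h + 1) _ q (q + h) (by omega),
    ← movingAverage_polyMul D (h + 1) _ (r + 1) (r + h + 1) (by omega)] at hmul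
  have h3 := congrArg (fun v : EuclideanSpace ℝ (Fin n) => v t) hmul
  simp only [PiLp.add_apply] at h3
  rw [movingAverage_succ, movingAverage_succ, polyMul_zero hD rfl, polyMul_zero hD rfl,
    one_mulVec, one_mulVec] at h3
  rw [h3]
  simp only [movingAverage, Finset.sum_apply, Finset.sum_range]

end System

/-! ### Step 1 of the algorithm -/

section NoiseEstimation

variable {n l : ℕ} {p' q' r' : ℕ} {μ : ℝ} {y : ℤ → EuclideanSpace ℝ (Fin n)}
  {u : ℤ → EuclideanSpace ℝ (Fin l)}

/-- Each step writes only the value at the new time, so later states still hold the earlier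
estimates. -/
lemma noiseState_what_eq (N : ℕ) {j : ℤ} (hj : j ≤ N) :
    (noiseState p' q' r' μ y u N).what j = noiseEst p' q' r' μ y u j := by
  induction N with
  | zero =>
    have : j.toNat = 0 := by simpa using hj
    rw [noiseEst, this]
  | succ N ih =>
    rcases eq_or_ne j ((N + 1 : ℕ) : ℤ) with rfl | h
    · rw [noiseEst, Int.toNat_natCast]
    · rw [← ih (by omega), noiseState, noiseStep]
      exact Function.update_of_ne (by exact_mod_cast h) _ _

lemma noiseEst_of_nonpos {j : ℤ} (hj : j ≤ 0) : noiseEst p' q' r' μ y u j = 0 := by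
  have : j.toNat = 0 := by simpa using hj
  rw [noiseEst, this, noiseState]

lemma noiseStep_regressor_eq (N : ℕ) :
    regressor p' q' r' (dataOf y) (dataOf u) (noiseState p' q' r' μ y u N).what N =
      phi p' q' r' p' q' r' μ y u N :=
  regressor_congr (fun _ _ => rfl) (fun _ _ => rfl) fun i _ => noiseState_what_eq N (by omega)

lemma isLeastSquares_noiseState :
    IsLeastSquares (fun k => phi p' q' r' p' q' r' μ y u k)
      (fun k t => dataOf y ((k : ℤ) + 1) t)
      (fun k => (noiseState p' q' r' μ y u k).P) (fun k => (noiseState p' q' r' μ y u k).α) where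
  gain_succ k := by
    simp only [noiseState, noiseStep, noiseStep_regressor_eq]
  estimate_succ k := by
    simp only [noiseState, noiseStep, noiseStep_regressor_eq]

lemma noiseEst_succ (N : ℕ) (t : Fin n) :
    noiseEst p' q' r' μ y u ((N : ℤ) + 1) t = dataOf y ((N : ℤ) + 1) t -
      (((noiseState p' q' r' μ y u (N + 1)).α)ᵀ *ᵥ phi p' q' r' p' q' r' μ y u N) t := by
  have h : ((N : ℤ) + 1).toNat = N + 1 := by omega
  rw [noiseEst, h]
  simp only [noiseState, noiseStep, noiseStep_regressor_eq, Function.update_self]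

/-- All data at nonpositive times vanish. The update at time `0` is therefore void, which reconciles
sums starting at `0` with those starting at `1`. -/
lemma phi_zero (p q r : ℕ) : phi p q r p' q' r' μ y u 0 = 0 := by
  funext s
  rcases s with ⟨i, a⟩ | ⟨j, b⟩ | ⟨ν, c⟩
  · have h : ¬ (1 : ℤ) ≤ ((0 : ℕ) : ℤ) - (i : ℕ) := by omega
    simp only [phi, regressor, dataOf, if_neg h]
    simp
  · have h : ¬ (1 : ℤ) ≤ ((0 : ℕ) : ℤ) - (j : ℕ) := by omega
    simp only [phi, regressor, dataOf, if_neg h]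
    simp
  · simp [phi, regressor, noiseEst_of_nonpos]

/-- A delay brings in only zeros at negative times and pushes nonnegative terms out at the end. -/
lemma sum_range_shift_le {f : ℤ → ℝ} (hf : ∀ k, 0 ≤ f k) (hf0 : ∀ k < 0, f k = 0) (i N : ℕ) :
    ∑ k ∈ Finset.range N, f ((k : ℤ) - i) ≤ ∑ k ∈ Finset.range N, f k := by
  induction i with
  | zero => simp
  | succ i ih =>
    refine le_trans ?_ ih
    cases N with
    | zero => simp
    | succ N =>
      rw [Finset.sum_range_succ', Finset.sum_range_succ]
      have h1 : f (((0 : ℕ) : ℤ) - (i + 1 : ℕ)) = 0 := hf0 _ (by push_cast; omega)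
      rw [h1]
      refine add_le_add (le_of_eq (Finset.sum_congr rfl fun k _ => ?_)) (hf _)
      congr 1
      push_cast
      ring

/-- The regressors with longer memory are controlled by those with shorter memory. -/
lemma sum_phi_sq_le {p q r : ℕ} (hp : 0 < p) (hq : 0 < q) (hr : 0 < r) (P Q R N : ℕ) :
    ∑ k ∈ Finset.range N, phi P Q R p' q' r' μ y u k ⬝ᵥ phi P Q R p' q' r' μ y u k ≤
      (P + Q + R : ℕ) *
        ∑ k ∈ Finset.range N, phi p q r p' q' r' μ y u k ⬝ᵥ phi p q r p' q' r' μ y u k := by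
  have hdata : ∀ {m : ℕ} (x : ℤ → EuclideanSpace ℝ (Fin m)), ∀ k < 0, ‖dataOf x k‖ ^ 2 = 0 :=
    fun x k hk => by simp [dataOf, show ¬ (1 ≤ k) by omega]
  have hest : ∀ k < 0, ‖noiseEst p' q' r' μ y u k‖ ^ 2 = 0 := fun k hk => by
    simp [noiseEst_of_nonpos hk.le]
  have hup : ∀ (f : ℤ → ℝ), (∀ k, 0 ≤ f k) → (∀ k < 0, f k = 0) → ∀ M : ℕ,
      ∑ k ∈ Finset.range N, ∑ i ∈ Finset.range M, f ((k : ℤ) - i) ≤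
        M * ∑ k ∈ Finset.range N, f k := by
    intro f hf hf0 M
    rw [Finset.sum_comm]
    refine (Finset.sum_le_sum fun i _ => sum_range_shift_le hf hf0 i N).trans ?_
    simp
  have hlow : ∀ (f : ℤ → ℝ), (∀ k, 0 ≤ f k) → ∀ M : ℕ, 0 < M →
      ∑ k ∈ Finset.range N, f k ≤ ∑ k ∈ Finset.range N, ∑ i ∈ Finset.range M, f ((k : ℤ) - i) := by
    intro f hf M hM
    refine Finset.sum_le_sum fun k _ => ?_
    have := Finset.single_le_sum (f := fun i : ℕ => f ((k : ℤ) - i)) (fun i _ => hf _)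
      (Finset.mem_range.2 hM)
    simpa using this
  simp only [phi, dotProduct_regressor_self, Finset.sum_add_distrib]
  have y1 := hup (fun k => ‖dataOf y k‖ ^ 2) (fun k => sq_nonneg _) (hdata y) P
  have u1 := hup (fun k => ‖dataOf u k‖ ^ 2) (fun k => sq_nonneg _) (hdata u) Q
  have e1 := hup (fun k => ‖noiseEst p' q' r' μ y u k‖ ^ 2) (fun k => sq_nonneg _) hest R
  have y2 := hlow (fun k => ‖dataOf y k‖ ^ 2) (fun k => sq_nonneg _) p hp
  have u2 := hlow (fun k => ‖dataOf u k‖ ^ 2) (fun k => sq_nonneg _) q hq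
  have e2 := hlow (fun k => ‖noiseEst p' q' r' μ y u k‖ ^ 2) (fun k => sq_nonneg _) r hr
  refine (add_le_add y1 (add_le_add u1 e1)).trans ?_
  have hy0 : 0 ≤ ∑ k ∈ Finset.range N, ‖dataOf y (k : ℤ)‖ ^ 2 :=
    Finset.sum_nonneg fun k _ => sq_nonneg _
  have hu0 : 0 ≤ ∑ k ∈ Finset.range N, ‖dataOf u (k : ℤ)‖ ^ 2 :=
    Finset.sum_nonneg fun k _ => sq_nonneg _
  have he0 : 0 ≤ ∑ k ∈ Finset.range N, ‖noiseEst p' q' r' μ y u (k : ℤ)‖ ^ 2 :=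
    Finset.sum_nonneg fun k _ => sq_nonneg _
  push_cast
  calc _ ≤ ((P : ℝ) + Q + R) * (∑ k ∈ Finset.range N, ‖dataOf y (k : ℤ)‖ ^ 2) +
        (((P : ℝ) + Q + R) * (∑ k ∈ Finset.range N, ‖dataOf u (k : ℤ)‖ ^ 2) +
        ((P : ℝ) + Q + R) * ∑ k ∈ Finset.range N, ‖noiseEst p' q' r' μ y u (k : ℤ)‖ ^ 2) := by
        gcongr
        · linarith [Nat.cast_nonneg (α := ℝ) Q, Nat.cast_nonneg (α := ℝ) R]
        · linarith [Nat.cast_nonneg (α := ℝ) P, Nat.cast_nonneg (α := ℝ) R]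
        · linarith [Nat.cast_nonneg (α := ℝ) Q, Nat.cast_nonneg (α := ℝ) P]
    _ = ((P : ℝ) + Q + R) * (∑ k ∈ Finset.range N, ‖dataOf y (k : ℤ)‖ ^ 2 +
        (∑ k ∈ Finset.range N, ‖dataOf u (k : ℤ)‖ ^ 2 +
        ∑ k ∈ Finset.range N, ‖noiseEst p' q' r' μ y u (k : ℤ)‖ ^ 2)) := by ring
    _ ≤ _ := by gcongr

end NoiseEstimation

/-! ### Step 2 of the algorithm -/

section Sparse

variable {ι : Type*} [Fintype ι] [DecidableEq ι] {n : ℕ} {μ : ℝ} {lam : ℕ → ℝ} {φ : ℕ → ι → ℝ}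
  {y : ℤ → EuclideanSpace ℝ (Fin n)}

/-- Without the correction term, the estimates of Step 2 are least squares estimates. -/
lemma isLeastSquares_sparseState :
    IsLeastSquares φ (fun k t => dataOf y ((k : ℤ) + 1) t) (fun k => (sparseState μ lam φ y k).P)
      (fun k => (sparseState μ lam φ y k).Θ -
        μ • ((sparseState μ lam φ y k).P * (sparseState μ lam φ y k).Ξprev)) where
  gain_succ k := by simp only [sparseState, sparseStep]
  estimate_succ k := by
    simp only [sparseState, sparseStep]
    set S := sparseState μ lam φ y k
    set a := (1 + φ k ⬝ᵥ S.P *ᵥ φ k)⁻¹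
    -- Moving the subtracted term into the residual produces `μ P φ φᵀ P Ξprev`. After scaling by
    -- `a` this is the difference of the two gains applied to `Ξprev`, so `Ξprev` stays multiplied
    -- by the new gain and the correction `Ξ - Ξprev` telescopes.
    have h1 : vecMulVec (S.P *ᵥ φ k) (fun t => dataOf y ((k : ℤ) + 1) t -
        ((S.Θ - μ • (S.P * S.Ξprev))ᵀ *ᵥ φ k) t) =
        vecMulVec (S.P *ᵥ φ k) (fun t => dataOf y ((k : ℤ) + 1) t - (S.Θᵀ *ᵥ φ k) t) +
          μ • (S.P * vecMulVec (φ k) (φ k) * S.P * S.Ξprev) := by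
      rw [mul_vecMulVec, vecMulVec_mul, vecMulVec_mul, ← vecMulVec_smul, ← vecMulVec_add]
      congr 1
      ext t
      simp only [transpose_sub, transpose_smul, sub_mulVec, smul_mulVec, Pi.sub_apply,
        Pi.add_apply, Pi.smul_apply, smul_eq_mul, vecMul_vecMul, mulVec_transpose]
      ring
    rw [h1]
    simp only [Matrix.mul_sub, Matrix.sub_mul, smul_add, smul_sub, Matrix.smul_mul,
      smul_comm a μ]
    abel

/-- The sum over `1, …, N` gains the zero term at index `0`, giving `N + 1` terms; accordingly
`λ_min(N)` belongs to the gain `P_{N+1}`. -/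
lemma infoMatrix_eq_information (hφ : φ 0 = 0) (N : ℕ) :
    infoMatrix μ φ N = information (μ • (1 : Matrix ι ι ℝ)) φ (N + 1) := by
  rw [infoMatrix, information]
  congr 1
  induction N with
  | zero => simp [hφ]
  | succ N ih => rw [Finset.sum_Icc_succ_top (by omega), ih, ← Finset.sum_range_succ]

end Sparse

/-! ### Restarting least squares at a later time. -/

section Shift

variable {ι κ : Type*} {ψ : ℕ → ι → ℝ} {y : ℕ → κ → ℝ} {P : ℕ → Matrix ι ι ℝ}
  {α : ℕ → Matrix ι κ ℝ}

lemma IsLeastSquares.shift [Fintype ι] (h : IsLeastSquares ψ y P α) (k₀ : ℕ) :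
    IsLeastSquares (fun k => ψ (k₀ + k)) (fun k => y (k₀ + k)) (fun k => P (k₀ + k))
      (fun k => α (k₀ + k)) :=
  ⟨fun k => h.gain_succ (k₀ + k), fun k => h.estimate_succ (k₀ + k)⟩

lemma information_shift (R₀ : Matrix ι ι ℝ) (k₀ N : ℕ) :
    information (information R₀ ψ k₀) (fun k => ψ (k₀ + k)) N = information R₀ ψ (k₀ + N) := by
  simp [information, Finset.sum_range_add, add_assoc]

end Shift

/-! ### Measurability of the algorithm -/

section Measurability

variable {Ω : Type*} {m0 : MeasurableSpace Ω}

/-- The regressor of stage `k` is known at time `k`, its output only at time `k + 1`, and the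
estimate with index `k` uses outputs of earlier stages only. -/
lemma IsLeastSquares.measurable {ι κ : Type*} [Fintype ι] (ℱ : Filtration ℕ m0)
    {ψ : ℕ → Ω → ι → ℝ} {y : ℕ → Ω → κ → ℝ} {P : ℕ → Ω → Matrix ι ι ℝ} {α : ℕ → Ω → Matrix ι κ ℝ}
    (hLS : ∀ ω, IsLeastSquares (fun k => ψ k ω) (fun k => y k ω) (fun k => P k ω)
      (fun k => α k ω))
    (hψ : ∀ k s, Measurable[ℱ k] fun ω => ψ k ω s)
    (hy : ∀ k t, Measurable[ℱ (k + 1)] fun ω => y k ω t)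
    (hP : ∀ s t, Measurable[ℱ 0] fun ω => P 0 ω s t)
    (hα : ∀ s t, Measurable[ℱ 0] fun ω => α 0 ω s t) (k : ℕ) :
    (∀ s t, Measurable[ℱ k] fun ω => P k ω s t) ∧
      ∀ s t, Measurable[ℱ k] fun ω => α k ω s t := by
  induction k with
  | zero => exact ⟨hP, hα⟩
  | succ k ih =>
    obtain ⟨ihP, ihα⟩ := ih
    have hle : ℱ k ≤ ℱ (k + 1) := ℱ.mono k.le_succ
    have hb : Measurable[ℱ k] fun ω => (1 + ψ k ω ⬝ᵥ P k ω *ᵥ ψ k ω)⁻¹ :=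
      ((measurable_dotProduct (hψ k) (measurable_mulVec ihP (hψ k))).const_add 1).inv
    have hPψ : ∀ s, Measurable[ℱ k] fun ω => (P k ω *ᵥ ψ k ω) s := measurable_mulVec ihP (hψ k)
    have hψP : ∀ s, Measurable[ℱ k] fun ω => (ψ k ω ᵥ* P k ω) s := fun s =>
      measurable_dotProduct (hψ k) fun t => ihP t s
    have hαψ : ∀ t, Measurable[ℱ k] fun ω => ((α k ω)ᵀ *ᵥ ψ k ω) t :=
      measurable_mulVec (fun t s => ihα s t) (hψ k)
    refine ⟨fun s t => ?_, fun s t => ?_⟩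
    · have h1 : ∀ ω, P (k + 1) ω s t = P k ω s t - (1 + ψ k ω ⬝ᵥ P k ω *ᵥ ψ k ω)⁻¹ *
          ((P k ω *ᵥ ψ k ω) s * (ψ k ω ᵥ* P k ω) t) := fun ω => by
        rw [(hLS ω).gain_succ, mul_vecMulVec, vecMulVec_mul]
        simp [vecMulVec_apply]
      simp only [h1]
      exact ((ihP s t).sub (hb.mul ((hPψ s).mul (hψP t)))).mono hle le_rfl
    · have h1 : ∀ ω, α (k + 1) ω s t = α k ω s t + (1 + ψ k ω ⬝ᵥ P k ω *ᵥ ψ k ω)⁻¹ *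
          ((P k ω *ᵥ ψ k ω) s * (y k ω t - ((α k ω)ᵀ *ᵥ ψ k ω) t)) := fun ω => by
        rw [(hLS ω).estimate_succ]
        simp [vecMulVec_apply]
      simp only [h1]
      exact ((ihα s t).mono hle le_rfl).add ((hb.mono hle le_rfl).mul
        (((hPψ s).mono hle le_rfl).mul ((hy k t).sub ((hαψ t).mono hle le_rfl))))

variable {n l : ℕ} {y : ℤ → Ω → EuclideanSpace ℝ (Fin n)} {u : ℤ → Ω → EuclideanSpace ℝ (Fin l)}
  {w : ℤ → Ω → EuclideanSpace ℝ (Fin n)}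

lemma sigmaAlg_mono {j k : ℕ} (h : j ≤ k) : sigmaAlg y u w j ≤ sigmaAlg y u w k := by
  refine sup_le_sup (biSup_mono fun i hi => ?_)
    (sup_le_sup (biSup_mono fun i hi => ?_) (biSup_mono fun i hi => ?_)) <;>
  · rw [Set.mem_Icc] at hi ⊢
    omega

lemma sigmaAlg_le (hy : ∀ j, Measurable (y j)) (hu : ∀ j, Measurable (u j))
    (hw : ∀ j, Measurable (w j)) (k : ℕ) : sigmaAlg y u w k ≤ m0 :=
  sup_le (iSup₂_le fun j _ => (hy j).comap_le) (sup_le (iSup₂_le fun j _ => (hu j).comap_le)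
    (iSup₂_le fun j _ => (hw j).comap_le))

/-- The filtration `F_{k₀}, F_{k₀+1}, …` generated by the system. -/
def systemFiltration (hy : ∀ j, Measurable (y j)) (hu : ∀ j, Measurable (u j))
    (hw : ∀ j, Measurable (w j)) (k₀ : ℕ) : Filtration ℕ m0 where
  seq k := sigmaAlg y u w (k₀ + k)
  mono' _ _ h := sigmaAlg_mono (Nat.add_le_add_left h k₀)
  le' k := sigmaAlg_le hy hu hw (k₀ + k)

lemma measurable_output {j : ℤ} {k : ℕ} (h0 : 0 ≤ j) (hk : j ≤ k) :
    Measurable[sigmaAlg y u w k] (y j) := by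
  refine Measurable.mono (comap_measurable (y j)) ?_ le_rfl
  exact le_trans (le_iSup₂_of_le j ⟨h0, hk⟩ le_rfl) le_sup_left

lemma measurable_noise {j : ℤ} {k : ℕ} (h0 : 1 ≤ j) (hk : j ≤ k) :
    Measurable[sigmaAlg y u w k] (w j) := by
  refine Measurable.mono (comap_measurable (w j)) ?_ le_rfl
  exact le_trans (le_iSup₂_of_le j ⟨h0, hk⟩ le_rfl) (le_sup_right.trans le_sup_right)

variable {p q r p' q' r' : ℕ} {μ : ℝ}

lemma measurable_dataOf_output {j : ℤ} {k : ℕ} (hk : j ≤ k) :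
    Measurable[sigmaAlg y u w k] fun ω => dataOf (fun i => y i ω) j := by
  by_cases h : 1 ≤ j
  · simp only [dataOf, if_pos h]
    exact measurable_output (by omega) hk
  · simp only [dataOf, if_neg h]
    exact measurable_const

lemma measurable_euclidean {m : MeasurableSpace Ω} {f : Ω → EuclideanSpace ℝ (Fin n)}
    (hf : ∀ t, Measurable fun ω => f ω t) : Measurable f :=
  (WithLp.measurable_toLp 2 (Fin n → ℝ)).comp (measurable_pi_lambda (fun ω => (f ω).ofLp) hf)

lemma measurable_apply_euclidean {m : MeasurableSpace Ω} {f : Ω → EuclideanSpace ℝ (Fin n)}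
    (hf : Measurable f) (t : Fin n) : Measurable fun ω => f ω t :=
  (measurable_pi_apply t).comp ((WithLp.measurable_ofLp 2 (Fin n → ℝ)).comp hf)

/-- The input `u_k` is not among the generators at time `k`. Its measurability is read off from the
first input block of `φ_k`, which exists because `q > 0`. -/
lemma measurable_dataOf_input (hq : 0 < q)
    (hφ : ∀ k : ℕ, 1 ≤ k → Measurable[sigmaAlg y u w k]
      fun ω => phi p q r p' q' r' μ (fun j => y j ω) (fun j => u j ω) k)
    {j : ℤ} {k : ℕ} (hk : j ≤ k) :
    Measurable[sigmaAlg y u w k] fun ω => dataOf (fun i => u i ω) j := by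
  by_cases h : 1 ≤ j
  swap
  · simp only [dataOf, if_neg h]
    exact measurable_const
  obtain ⟨i, rfl⟩ := Int.eq_ofNat_of_zero_le (by omega : 0 ≤ j)
  have hm := hφ i (by omega)
  refine (measurable_euclidean fun b => ?_ : Measurable[sigmaAlg y u w i] _).mono
    (sigmaAlg_mono (by omega)) le_rfl
  have := (measurable_pi_apply (.inr (.inl (⟨0, hq⟩, b)) : Idx n l p q r)).comp hm
  simpa [Function.comp_def, phi, regressor] using this

/-- Read off from the first noise block of the regressor, as for the inputs. With those, this makes
regressors of any memory length measurable. -/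
lemma measurable_noiseEst (hr : 0 < r)
    (hφ : ∀ k : ℕ, 1 ≤ k → Measurable[sigmaAlg y u w k]
      fun ω => phi p q r p' q' r' μ (fun j => y j ω) (fun j => u j ω) k)
    {j : ℤ} {k : ℕ} (hk : j ≤ k) :
    Measurable[sigmaAlg y u w k]
      fun ω => noiseEst p' q' r' μ (fun i => y i ω) (fun i => u i ω) j := by
  by_cases h : 1 ≤ j
  swap
  · simp only [noiseEst_of_nonpos (show j ≤ 0 by omega)]
    exact measurable_const
  obtain ⟨i, rfl⟩ := Int.eq_ofNat_of_zero_le (by omega : 0 ≤ j)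
  have hm := hφ i (by omega)
  refine (measurable_euclidean fun b => ?_ : Measurable[sigmaAlg y u w i] _).mono
    (sigmaAlg_mono (by omega)) le_rfl
  have := (measurable_pi_apply (.inr (.inr (⟨0, hr⟩, b)) : Idx n l p q r)).comp hm
  simpa [Function.comp_def, phi, regressor] using this

lemma measurable_phi (hq : 0 < q) (hr : 0 < r)
    (hφ : ∀ k : ℕ, 1 ≤ k → Measurable[sigmaAlg y u w k]
      fun ω => phi p q r p' q' r' μ (fun j => y j ω) (fun j => u j ω) k)
    (P Q R k : ℕ) (s : Idx n l P Q R) :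
    Measurable[sigmaAlg y u w k]
      fun ω => phi P Q R p' q' r' μ (fun j => y j ω) (fun j => u j ω) k s := by
  rcases s with ⟨i, a⟩ | ⟨j, b⟩ | ⟨ν, c⟩
  · exact measurable_apply_euclidean (measurable_dataOf_output (by omega)) a
  · exact measurable_apply_euclidean (measurable_dataOf_input hq hφ (by omega)) b
  · exact measurable_apply_euclidean (measurable_noiseEst hr hφ (by omega)) c

end Measurability

/-! ### Least squares estimates of the system -/

/-- The error of the noise estimates. -/
def noiseError {n l : ℕ} (p' q' r' : ℕ) (μ : ℝ) (y : ℤ → EuclideanSpace ℝ (Fin n))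
    (u : ℤ → EuclideanSpace ℝ (Fin l)) (w : ℤ → EuclideanSpace ℝ (Fin n)) (j : ℤ) :
    EuclideanSpace ℝ (Fin n) :=
  if 1 ≤ j then noiseEst p' q' r' μ y u j - w j else 0

section Energy

variable {Ω : Type*} {m0 : MeasurableSpace Ω} {ℙ : Measure Ω}
  {n l : ℕ} {y : ℤ → Ω → EuclideanSpace ℝ (Fin n)} {u : ℤ → Ω → EuclideanSpace ℝ (Fin l)}
  {w : ℤ → Ω → EuclideanSpace ℝ (Fin n)} {p q r p' q' r' : ℕ} {μ : ℝ}

lemma isNoise_systemFiltration (hy : ∀ j, Measurable (y j)) (hu : ∀ j, Measurable (u j))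
    (hw : ∀ j, Measurable (w j)) (hint : ∀ k : ℕ, 1 ≤ k → Integrable (w (k + 1)) ℙ)
    (hmds : ∀ k : ℕ, 1 ≤ k → ℙ[w (k + 1) | sigmaAlg y u w k] =ᵐ[ℙ] 0) {β : ℝ}
    (hmom : ∀ᵐ ω ∂ℙ, (⨆ (k : ℕ) (_ : 1 ≤ k),
      condLExp (sigmaAlg y u w k) ℙ (fun ω' => ‖w (k + 1) ω'‖ₑ ^ β) ω) < ∞)
    {k₀ : ℕ} (hk₀ : 1 ≤ k₀) :
    IsNoise ℙ (systemFiltration hy hu hw k₀) β fun k => w ((k₀ + k : ℕ) + 1) where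
  meas k := measurable_noise (by omega) (by push_cast; omega)
  integrable k := hint (k₀ + k) (by omega)
  condExp_eq_zero k := hmds (k₀ + k) (by omega)
  moment := by
    filter_upwards [hmom] with ω hω
    refine lt_of_le_of_lt (iSup_le fun k => ?_) hω
    exact le_iSup₂_of_le (k₀ + k) (by omega) le_rfl

/-- The energy inequality of a least squares algorithm whose regressors contain estimates of the
noise. -/
theorem ae_energy_le [IsProbabilityMeasure ℙ] (hy : ∀ j, Measurable (y j))
    (hu : ∀ j, Measurable (u j))
    (hw : ∀ j, Measurable (w j)) (hint : ∀ k : ℕ, 1 ≤ k → Integrable (w (k + 1)) ℙ)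
    (hmds : ∀ k : ℕ, 1 ≤ k → ℙ[w (k + 1) | sigmaAlg y u w k] =ᵐ[ℙ] 0) {β : ℝ} (hβ : 2 < β)
    (hmom : ∀ᵐ ω ∂ℙ, (⨆ (k : ℕ) (_ : 1 ≤ k),
      condLExp (sigmaAlg y u w k) ℙ (fun ω' => ‖w (k + 1) ω'‖ₑ ^ β) ω) < ∞)
    (hq : 0 < q) (hr : 0 < r) (hμ : 0 < μ)
    (hφ : ∀ k : ℕ, 1 ≤ k → Measurable[sigmaAlg y u w k]
      fun ω => phi p q r p' q' r' μ (fun j => y j ω) (fun j => u j ω) k)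
    {P Q R k₀ : ℕ} (hk₀ : 1 ≤ k₀) (hP : P ≤ k₀) (hQ : Q ≤ k₀) (hR : R ≤ k₀)
    {A : Fin P → Matrix (Fin n) (Fin n) ℝ} {B : Fin Q → Matrix (Fin n) (Fin l) ℝ}
    {C : Fin R → Matrix (Fin n) (Fin n) ℝ}
    (hsys : ∀ ω, ∀ k : ℕ, k₀ ≤ k →
      SystemAt A B C (fun j => y j ω) (fun j => u j ω) (fun j => w j ω) k)
    {G : ℕ → Matrix (Fin n) (Fin n) ℝ} (hG0 : G 0 = 0) (hG : ∀ ν : Fin R, G (ν + 1) = -C ν)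
    {Pm : ℕ → Ω → Matrix (Idx n l P Q R) (Idx n l P Q R) ℝ}
    {α : ℕ → Ω → Matrix (Idx n l P Q R) (Fin n) ℝ}
    (hLS : ∀ ω, IsLeastSquares
      (fun k => phi P Q R p' q' r' μ (fun j => y j ω) (fun j => u j ω) k)
      (fun k t => dataOf (fun j => y j ω) ((k : ℤ) + 1) t) (fun k => Pm k ω) (fun k => α k ω))
    (hPm : ∀ ω, Pm 0 ω = μ⁻¹ • (1 : Matrix _ _ ℝ)) (hα : ∀ ω, α 0 ω = 0) :
    ∀ᵐ ω ∂ℙ, ∀ ε : ℝ, 0 < ε → ∃ c : ℝ, 0 ≤ c ∧ ∀ N,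
      columnForm (information (μ • (1 : Matrix _ _ ℝ))
          (phi P Q R p' q' r' μ (fun j => y j ω) (fun j => u j ω)) (k₀ + N))
          (paramMatrix A B C - α (k₀ + N) ω) +
        ∑ k ∈ Finset.range N, (‖coeffApply (paramMatrix A B C - α (k₀ + k + 1) ω)
            (phi P Q R p' q' r' μ (fun j => y j ω) (fun j => u j ω) (k₀ + k))‖ ^ 2 +
          2 * inner ℝ (coeffApply (paramMatrix A B C - α (k₀ + k + 1) ω)
            (phi P Q R p' q' r' μ (fun j => y j ω) (fun j => u j ω) (k₀ + k)))
            (movingAverage G (R + 1) (noiseError p' q' r' μ (fun j => y j ω) (fun j => u j ω)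
              (fun j => w j ω)) ((k₀ + k : ℕ) + 1))) ≤
      ε * ∑ k ∈ Finset.range N, ‖coeffApply (paramMatrix A B C - α (k₀ + k + 1) ω)
          (phi P Q R p' q' r' μ (fun j => y j ω) (fun j => u j ω) (k₀ + k))‖ ^ 2 +
        c * (1 + (Real.log (information (μ • (1 : Matrix _ _ ℝ))
          (phi P Q R p' q' r' μ (fun j => y j ω) (fun j => u j ω)) (k₀ + N)).det -
          Real.log (information (μ • (1 : Matrix _ _ ℝ))
          (phi P Q R p' q' r' μ (fun j => y j ω) (fun j => u j ω)) k₀).det)) := by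
  set ψ : ℕ → Ω → Idx n l P Q R → ℝ := fun k ω =>
    phi P Q R p' q' r' μ (fun j => y j ω) (fun j => u j ω) k with hψ
  have hψm : ∀ k s, Measurable[sigmaAlg y u w k] fun ω => ψ k ω s := fun k s =>
    measurable_phi hq hr hφ P Q R k s
  have hpd : (μ • (1 : Matrix (Idx n l P Q R) (Idx n l P Q R) ℝ)).PosDef :=
    PosDef.one.smul hμ
  have hinv : (μ • (1 : Matrix (Idx n l P Q R) (Idx n l P Q R) ℝ))⁻¹ =
      μ⁻¹ • (1 : Matrix _ _ ℝ) := by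
    refine inv_eq_left_inv ?_
    rw [Matrix.smul_mul, Matrix.mul_smul, Matrix.one_mul, smul_smul, inv_mul_cancel₀ hμ.ne',
      one_smul]
  have hmeas := IsLeastSquares.measurable (systemFiltration hy hu hw 0) (ψ := ψ) hLS
    (fun k s => by
      change Measurable[sigmaAlg y u w (0 + k)] _
      rw [zero_add]
      exact hψm k s)
    (fun k t => by
      change Measurable[sigmaAlg y u w (0 + (k + 1))] _
      rw [zero_add]
      exact measurable_apply_euclidean (measurable_dataOf_output (by push_cast; omega)) t)
    (fun s t => by simp only [hPm]; exact measurable_const)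
    (fun s t => by simp only [hα]; exact measurable_const)
  have hmeas' : ∀ k, (∀ s t, Measurable[sigmaAlg y u w k] fun ω => Pm k ω s t) ∧
      ∀ s t, Measurable[sigmaAlg y u w k] fun ω => α k ω s t := fun k => by
    have h := hmeas k
    change (∀ s t, Measurable[sigmaAlg y u w (0 + k)] _) ∧
      ∀ s t, Measurable[sigmaAlg y u w (0 + k)] _ at h
    rwa [zero_add] at h
  set ξ : Ω → ℤ → EuclideanSpace ℝ (Fin n) := fun ω =>
    noiseError p' q' r' μ (fun j => y j ω) (fun j => u j ω) (fun j => w j ω) with hξ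
  have hξm : ∀ (k : ℕ) (j : ℤ), j ≤ k → Measurable[sigmaAlg y u w k] fun ω => ξ ω j :=
    fun k j hj => by
    simp only [hξ, noiseError]
    split_ifs with h
    · exact (measurable_noiseEst hr hφ hj).sub (measurable_noise h hj)
    · exact measurable_const
  -- Since `G 0 = 0`, the moving average at time `k₀ + k + 1` uses errors up to time `k₀ + k` only.
  have hem : ∀ k : ℕ, Measurable[sigmaAlg y u w (k₀ + k)] fun ω =>
      movingAverage G (R + 1) (ξ ω) ((k₀ + k : ℕ) + 1) := fun k => by
    refine measurable_euclidean fun t => ?_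
    simp only [movingAverage_succ, hG0, zero_mulVec, Pi.zero_apply, zero_add]
    refine Finset.measurable_fun_sum _ fun m _ => ?_
    exact measurable_mulVec (M := fun _ => G (m + 1)) (fun _ _ => measurable_const)
      (fun s => measurable_apply_euclidean (hξm (k₀ + k) _ (by omega)) s) t
  have hreg : ∀ (k : ℕ) (ω : Ω) (t : Fin n),
      dataOf (fun j => y j ω) (((k₀ + k : ℕ) : ℤ) + 1) t =
        ((paramMatrix A B C)ᵀ *ᵥ ψ (k₀ + k) ω) t + (w ((k₀ + k : ℕ) + 1) ω +
          movingAverage G (R + 1) (ξ ω) ((k₀ + k : ℕ) + 1)) t := fun k ω t => by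
    -- The lags are smaller than `k₀`, so every time involved is at least `1` and the data are the
    -- true signals.
    have h1 : ψ (k₀ + k) ω = regressor P Q R (fun j => y j ω) (fun j => u j ω)
        (noiseEst p' q' r' μ (fun j => y j ω) (fun j => u j ω)) ((k₀ + k : ℕ) : ℤ) :=
      regressor_congr (fun i hi => if_pos (by omega)) (fun i hi => if_pos (by omega))
        fun _ _ => rfl
    rw [h1, dataOf, if_pos (by omega)]
    refine (hsys ω (k₀ + k) (by omega)).regression _ (ξ ω) (fun i hi => ?_) G hG0 hG t
    exact if_pos (by omega)
  have key := ae_columnForm_add_sum_le hβ (isNoise_systemFiltration hy hu hw hint hmds hmom hk₀)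
    (ψ := fun k => ψ (k₀ + k)) (P := fun k => Pm (k₀ + k)) (α := fun k => α (k₀ + k))
    (fun ω => (hLS ω).shift k₀)
    (R₀ := fun ω => information (μ • (1 : Matrix _ _ ℝ)) (fun k => ψ k ω) k₀)
    (fun ω => posDef_information hpd k₀)
    (fun ω => (hLS ω).gain_eq hpd (by rw [hPm, hinv]) k₀)
    (fun k s => hψm (k₀ + k) s) (fun k => (hmeas' (k₀ + k)).1) (fun k => (hmeas' (k₀ + k)).2)
    (paramMatrix A B C) (e := fun k ω => movingAverage G (R + 1) (ξ ω) ((k₀ + k : ℕ) + 1))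
    hem hreg
  filter_upwards [key] with ω hω ε hε
  obtain ⟨c, hc0, hc⟩ := hω ε hε
  refine ⟨c, hc0, fun N => ?_⟩
  have := hc N
  rw [information_shift] at this
  exact this

end Energy

/-! ### Consequences of the energy inequality -/

section Abstract

variable {E : Type*} [NormedAddCommGroup E] [InnerProductSpace ℝ E]

/-- A small gain argument: if `ξ = g + e` with `e` controlled by `ξ` with gain `γ < 1`, then an
energy inequality for `g` controls `ξ`. -/
lemma exists_sum_norm_sq_le_of_gain_lt_one {ξ : ℕ → E} {g e : ℕ → E} {k₀ : ℕ} {γ : ℝ}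
    (hγ0 : 0 ≤ γ) (hγ : γ < 1) (hξ : ∀ k, ξ (k₀ + k) = g k + e k)
    (he : ∀ N, ∑ k ∈ Finset.range N, ‖e k‖ ^ 2 ≤
      γ ^ 2 * ∑ k ∈ Finset.range (k₀ + N), ‖ξ k‖ ^ 2) {L : ℕ → ℝ} (hL : ∀ N, 1 ≤ L N)
    (hg : ∀ ε : ℝ, 0 < ε → ∃ c : ℝ, 0 ≤ c ∧ ∀ N,
      ∑ k ∈ Finset.range N, (‖g k‖ ^ 2 + 2 * inner ℝ (g k) (e k)) ≤
        ε * ∑ k ∈ Finset.range N, ‖g k‖ ^ 2 + c * L N) :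
    ∃ c : ℝ, 0 ≤ c ∧ ∀ N, ∑ k ∈ Finset.range (k₀ + N), ‖ξ k‖ ^ 2 ≤ c * L N := by
  have hγ2 : γ ^ 2 < 1 := by nlinarith
  -- In total `∑ ‖g‖²` is at most `4 ∑ ‖ξ‖²`, so this choice costs half of the gap `1 - γ²` and
  -- leaves the other half.
  obtain ⟨c, hc0, hc⟩ := hg ((1 - γ ^ 2) / 8) (by linarith)
  set S₀ := ∑ k ∈ Finset.range k₀, ‖ξ k‖ ^ 2 with hS₀
  have hS₀0 : 0 ≤ S₀ := Finset.sum_nonneg fun _ _ => sq_nonneg _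
  refine ⟨2 / (1 - γ ^ 2) * (S₀ + c), by have := sub_pos.2 hγ2; positivity, fun N => ?_⟩
  have h1 := hc N
  have h2 := he N
  set X := ∑ k ∈ Finset.range N, ‖ξ (k₀ + k)‖ ^ 2 with hX
  set Y := ∑ k ∈ Finset.range N, ‖e k‖ ^ 2 with hY
  have hS : ∑ k ∈ Finset.range (k₀ + N), ‖ξ k‖ ^ 2 = S₀ + X := Finset.sum_range_add _ _ _
  -- Completing the square with `ξ = g + e`.
  have h3 : ∑ k ∈ Finset.range N, (‖g k‖ ^ 2 + 2 * inner ℝ (g k) (e k)) = X - Y := by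
    rw [hX, hY, ← Finset.sum_sub_distrib]
    refine Finset.sum_congr rfl fun k _ => ?_
    rw [hξ, norm_add_sq_real]
    ring
  have h4 : ∑ k ∈ Finset.range N, ‖g k‖ ^ 2 ≤ 2 * X + 2 * Y := by
    rw [hX, hY, Finset.mul_sum, Finset.mul_sum, ← Finset.sum_add_distrib]
    refine Finset.sum_le_sum fun k _ => ?_
    have h5 : ‖g k‖ ≤ ‖ξ (k₀ + k)‖ + ‖e k‖ := by
      rw [eq_sub_of_add_eq (hξ k).symm]
      exact norm_sub_le _ _
    nlinarith [norm_nonneg (g k), sq_nonneg (‖ξ (k₀ + k)‖ - ‖e k‖)]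
  rw [hS] at h2 ⊢
  rw [h3] at h1
  have hX0 : 0 ≤ X := Finset.sum_nonneg fun _ _ => sq_nonneg _
  have h6 : X - Y ≤ (1 - γ ^ 2) / 8 * (2 * X + 2 * Y) + c * L N :=
    h1.trans (by gcongr)
  have h7 : Y ≤ S₀ + X := h2.trans (mul_le_of_le_one_left (by linarith) hγ2.le)
  have h8 : (1 - γ ^ 2) / 8 * (2 * X + 2 * Y) ≤ (1 - γ ^ 2) / 8 * (4 * (S₀ + X)) :=
    mul_le_mul_of_nonneg_left (by linarith) (by linarith)
  have h9 : S₀ ≤ S₀ * L N := le_mul_of_one_le_right hS₀0 (hL N)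
  rw [div_mul_eq_mul_div, div_mul_eq_mul_div, le_div_iff₀ (by linarith)]
  nlinarith

/-- By Young's inequality `2 ⟪g, e⟫ ≥ -‖g‖² / 2 - 2 ‖e‖²`; the remaining `‖g‖² / 2` cancels the
right-hand side. No smallness of `e` is required, only a bound on its energy. -/
lemma add_half_le_of_energy_le {g e : ℕ → E} {N : ℕ} {V b : ℝ}
    (h : V + ∑ k ∈ Finset.range N, (‖g k‖ ^ 2 + 2 * inner ℝ (g k) (e k)) ≤
      1 / 2 * ∑ k ∈ Finset.range N, ‖g k‖ ^ 2 + b) :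
    V ≤ 2 * ∑ k ∈ Finset.range N, ‖e k‖ ^ 2 + b := by
  have h1 : 1 / 2 * ∑ k ∈ Finset.range N, ‖g k‖ ^ 2 - 2 * ∑ k ∈ Finset.range N, ‖e k‖ ^ 2 ≤
      ∑ k ∈ Finset.range N, (‖g k‖ ^ 2 + 2 * inner ℝ (g k) (e k)) := by
    rw [Finset.mul_sum, Finset.mul_sum, ← Finset.sum_sub_distrib]
    refine Finset.sum_le_sum fun k _ => ?_
    have := abs_le.1 (abs_real_inner_le_norm (g k) (e k))
    nlinarith [sq_nonneg (‖g k‖ - 2 * ‖e k‖)]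
  linarith

end Abstract

/-! ### Logarithmic bounds for the errors of Steps 1 and 2. -/

section Estimates

lemma columnForm_nonneg {ι : Type*} [Fintype ι] {n : ℕ} {R : Matrix ι ι ℝ} (hR : R.PosSemidef)
    (a : Matrix ι (Fin n) ℝ) : 0 ≤ columnForm R a :=
  Finset.sum_nonneg fun t _ => by simpa using hR.dotProduct_mulVec_nonneg fun s => a s t

lemma eigMin_mul_frobNorm_sq_le {ι : Type*} [Fintype ι] [DecidableEq ι] {n : ℕ}
    {R : Matrix ι ι ℝ} (hR : R.IsHermitian) (a : Matrix ι (Fin n) ℝ) :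
    eigMin R * frobNorm a ^ 2 ≤ columnForm R a := by
  have h0 : 0 ≤ ∑ s, ∑ t, a s t ^ 2 :=
    Finset.sum_nonneg fun _ _ => Finset.sum_nonneg fun _ _ => sq_nonneg _
  rw [frobNorm, Real.sq_sqrt h0, Finset.sum_comm, Finset.mul_sum]
  refine Finset.sum_le_sum fun t _ => ?_
  simpa [dotProduct, sq] using eigMin_mul_le hR fun s => a s t

lemma posDef_smul_one {ι : Type*} [Fintype ι] [DecidableEq ι] {μ : ℝ} (hμ : 0 < μ) :
    (μ • (1 : Matrix ι ι ℝ)).PosDef :=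
  PosDef.one.smul hμ

/-- The log-determinant of the information matrix of long regressors is controlled by the largest
eigenvalue of that of short regressors. -/
lemma exists_log_det_le {n l p q r p' q' r' : ℕ} {μ : ℝ} (hn : 0 < n) (hp : 0 < p) (hq : 0 < q)
    (hr : 0 < r) (hμ : 0 < μ) {P : ℕ} (hP : 0 < P) (Q R : ℕ) :
    ∃ a b : ℝ, 0 ≤ a ∧ 0 ≤ b ∧ ∀ (y : ℤ → EuclideanSpace ℝ (Fin n))
      (u : ℤ → EuclideanSpace ℝ (Fin l)) (N : ℕ),
      Real.log (information (μ • (1 : Matrix _ _ ℝ)) (phi P Q R p' q' r' μ y u) N).det ≤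
        a + b * Real.log (eigMax (information (μ • (1 : Matrix _ _ ℝ))
          (phi p q r p' q' r' μ y u) N)) := by
  have hne : Nonempty (Idx n l p q r) := ⟨.inl (⟨0, hp⟩, ⟨0, hn⟩)⟩
  have hne' : Nonempty (Idx n l P Q R) := ⟨.inl (⟨0, hP⟩, ⟨0, hn⟩)⟩
  set d : ℝ := ((Fintype.card (Idx n l p q r) : ℕ) : ℝ) with hd
  set d' : ℝ := ((Fintype.card (Idx n l P Q R) : ℕ) : ℝ) with hd'
  have hd0 : 0 < d := by rw [hd]; exact_mod_cast Fintype.card_pos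
  have hd'0 : 0 < d' := by rw [hd']; exact_mod_cast Fintype.card_pos
  -- `d' / d` compares the traces of the two initial matrices, `P + Q + R` the energies of the two
  -- regressors.
  set κ : ℝ := d' / d + (P + Q + R : ℕ) with hκ
  have hκ0 : 0 < κ := add_pos_of_pos_of_nonneg (div_pos hd'0 hd0) (Nat.cast_nonneg _)
  refine ⟨|d' * Real.log (κ * d)|, d', abs_nonneg _, hd'0.le, fun y u N => ?_⟩
  set R₁ := information (μ • (1 : Matrix _ _ ℝ)) (phi p q r p' q' r' μ y u) N with hR₁
  have hpd₁ : R₁.PosDef := posDef_information (posDef_smul_one hμ) N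
  set R₂ := information (μ • (1 : Matrix _ _ ℝ)) (phi P Q R p' q' r' μ y u) N with hR₂
  have hpd₂ : R₂.PosDef := posDef_information (posDef_smul_one hμ) N
  have h1 := log_det_le hpd₂
  have ht1 : R₁.trace = μ * d + ∑ j ∈ Finset.range N, phi p q r p' q' r' μ y u j ⬝ᵥ
      phi p q r p' q' r' μ y u j := by
    rw [hR₁, trace_information, trace_smul, trace_one, smul_eq_mul]
  have ht2 : R₂.trace = μ * d' + ∑ j ∈ Finset.range N, phi P Q R p' q' r' μ y u j ⬝ᵥ
      phi P Q R p' q' r' μ y u j := by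
    rw [hR₂, trace_information, trace_smul, trace_one, smul_eq_mul]
  have hs := sum_phi_sq_le (p' := p') (q' := q') (r' := r') (μ := μ) (y := y) (u := u)
    hp hq hr P Q R N
  set s₁ := ∑ j ∈ Finset.range N, phi p q r p' q' r' μ y u j ⬝ᵥ phi p q r p' q' r' μ y u j
  have hs₁ : 0 ≤ s₁ := Finset.sum_nonneg fun j _ =>
    Finset.sum_nonneg fun i _ => mul_self_nonneg _
  have htr : R₂.trace ≤ κ * R₁.trace := by
    rw [ht1, ht2, hκ]
    have e1 : d' / d * (μ * d) = μ * d' := by field_simp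
    have e2 : 0 ≤ d' / d * s₁ := by positivity
    have e3 : (0 : ℝ) ≤ (P + Q + R : ℕ) * (μ * d) := by positivity
    linear_combination hs + e2 + e3 - e1
  have htr1 : R₁.trace ≤ d * eigMax R₁ := trace_le_card_mul_eigMax hpd₁.isHermitian
  have hpos1 : 0 < R₁.trace := hpd₁.trace_pos
  have hmax : 0 < eigMax R₁ := pos_of_mul_pos_right (hpos1.trans_le htr1) hd0.le
  have h2 : Real.log R₂.trace ≤ Real.log (κ * d) + Real.log (eigMax R₁) := by
    rw [← Real.log_mul (by positivity) hmax.ne']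
    refine Real.log_le_log hpd₂.trace_pos (htr.trans ?_)
    rw [mul_assoc]
    gcongr
  calc _ ≤ d' * Real.log R₂.trace := h1
    _ ≤ d' * (Real.log (κ * d) + Real.log (eigMax R₁)) := by gcongr
    _ ≤ _ := by rw [mul_add]; gcongr; exact le_abs_self _

variable {Ω : Type*} {m0 : MeasurableSpace Ω} {ℙ : Measure Ω} [IsProbabilityMeasure ℙ]
  {n l p q r h : ℕ} {y : ℤ → Ω → EuclideanSpace ℝ (Fin n)} {u : ℤ → Ω → EuclideanSpace ℝ (Fin l)}
  {w : ℤ → Ω → EuclideanSpace ℝ (Fin n)} {μ : ℝ}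
  {A : Fin p → Matrix (Fin n) (Fin n) ℝ} {B : Fin q → Matrix (Fin n) (Fin l) ℝ}
  {C : Fin r → Matrix (Fin n) (Fin n) ℝ}

lemma smul_one_inv {ι : Type*} [Fintype ι] [DecidableEq ι] {μ : ℝ} (hμ : 0 < μ) :
    (μ • (1 : Matrix ι ι ℝ))⁻¹ = μ⁻¹ • (1 : Matrix ι ι ℝ) := by
  refine inv_eq_left_inv ?_
  rw [Matrix.smul_mul, Matrix.mul_smul, Matrix.one_mul, smul_smul, inv_mul_cancel₀ hμ.ne',
    one_smul]

/-- The noise estimates of Step 1 have an error of logarithmic energy. -/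
theorem ae_sum_noiseError_sq_le (hy : ∀ j, Measurable (y j)) (hu : ∀ j, Measurable (u j))
    (hw : ∀ j, Measurable (w j))
    (hsys : ∀ ω, IsSystem A B C (fun j => y j ω) (fun j => u j ω) (fun j => w j ω))
    (hint : ∀ k : ℕ, 1 ≤ k → Integrable (w (k + 1)) ℙ)
    (hmds : ∀ k : ℕ, 1 ≤ k → ℙ[w (k + 1) | sigmaAlg y u w k] =ᵐ[ℙ] 0) {β : ℝ} (hβ : 2 < β)
    (hmom : ∀ᵐ ω ∂ℙ, (⨆ (k : ℕ) (_ : 1 ≤ k),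
      condLExp (sigmaAlg y u w k) ℙ (fun ω' => ‖w (k + 1) ω'‖ₑ ^ β) ω) < ∞)
    (hq : 0 < q) (hr : 0 < r) (hμ : 0 < μ)
    (hC : ∀ z : ℂ, ‖z‖ ≤ 1 → (noisePoly C z).det ≠ 0)
    {D : ℕ → Matrix (Fin n) (Fin n) ℝ} (hD : IsInverseExpansion C D)
    {K ρ : ℝ} (hK : 0 < K) (hρ0 : 0 < ρ) (hρ1 : ρ < 1)
    (hDK : ∀ i : ℕ, frobNorm (D i) ≤ K * ρ ^ i)
    (hh : Real.log ((noisePolySupNorm C)⁻¹ * K⁻¹ * (1 - ρ)) / Real.log ρ - 1 < (h : ℝ))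
    (hφ : ∀ k : ℕ, 1 ≤ k → Measurable[sigmaAlg y u w k]
      fun ω => phi p q r (p + h) (q + h) (r + h) μ (fun j => y j ω) (fun j => u j ω) k)
    {k₀ : ℕ} (hPk : p + h ≤ k₀) (hQk : q + h ≤ k₀) (hRk : r + h ≤ k₀) :
    ∀ᵐ ω ∂ℙ, ∃ c : ℝ, 0 ≤ c ∧ ∀ N : ℕ, ∑ k ∈ Finset.range (k₀ + 1 + N),
      ‖noiseError (p + h) (q + h) (r + h) μ (fun j => y j ω) (fun j => u j ω) (fun j => w j ω)
        k‖ ^ 2 ≤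
      c * (1 + (Real.log (information (μ • (1 : Matrix _ _ ℝ))
          (phi (p + h) (q + h) (r + h) (p + h) (q + h) (r + h) μ (fun j => y j ω)
            (fun j => u j ω)) (k₀ + N)).det -
          Real.log (information (μ • (1 : Matrix _ _ ℝ))
          (phi (p + h) (q + h) (r + h) (p + h) (q + h) (r + h) μ (fun j => y j ω)
            (fun j => u j ω)) k₀).det)) := by
  have hG : ∀ ν : Fin (r + h), residualCoeff C D h (ν + 1) =
      -polyMul D (h + 1) (noiseCoeff C) (r + 1) (ν + 1) := fun ν => by simp [residualCoeff]
  have hsys' : ∀ ω, ∀ k : ℕ, k₀ ≤ k → SystemAt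
      (fun i : Fin (p + h) => polyMul D (h + 1) (noiseCoeff A) (p + 1) (i + 1))
      (fun j : Fin (q + h) => polyMul D (h + 1) (inputCoeff B) q j)
      (fun ν : Fin (r + h) => polyMul D (h + 1) (noiseCoeff C) (r + 1) (ν + 1))
      (fun j => y j ω) (fun j => u j ω) (fun j => w j ω) k := fun ω k hk =>
    systemAt_polyMul (hsys ω) hD.apply_zero h (by omega)
  filter_upwards [ae_energy_le hy hu hw hint hmds hβ hmom hq hr hμ hφ (by omega) hPk hQk hRk hsys'
    (residualCoeff_zero hD) hG
    (Pm := fun k ω => (noiseState (p + h) (q + h) (r + h) μ (fun j => y j ω)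
      (fun j => u j ω) k).P)
    (α := fun k ω => (noiseState (p + h) (q + h) (r + h) μ (fun j => y j ω)
      (fun j => u j ω) k).α) (fun ω => isLeastSquares_noiseState) (fun ω => rfl)
    (fun ω => rfl)] with ω hω
  set ψ := phi (p + h) (q + h) (r + h) (p + h) (q + h) (r + h) μ (fun j => y j ω)
    (fun j => u j ω) with hψ
  set ξ := noiseError (p + h) (q + h) (r + h) μ (fun j => y j ω) (fun j => u j ω)
    (fun j => w j ω) with hξ
  set θ := paramMatrix (fun i : Fin (p + h) => polyMul D (h + 1) (noiseCoeff A) (p + 1) (i + 1))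
      (fun j : Fin (q + h) => polyMul D (h + 1) (inputCoeff B) q j)
      (fun ν : Fin (r + h) => polyMul D (h + 1) (noiseCoeff C) (r + 1) (ν + 1)) with hθ
  set α := fun k => (noiseState (p + h) (q + h) (r + h) μ (fun j => y j ω)
      (fun j => u j ω) k).α with hα
  set γ := K * ρ ^ (h + 1) / (1 - ρ) * noisePolySupNorm C with hγ
  have hγ1 : γ < 1 := residual_gain_lt_one (noisePolySupNorm_nonneg C) hK hρ0 hρ1 hh
  have hγ0 : 0 ≤ γ := by
    have := noisePolySupNorm_nonneg C
    have : 0 < 1 - ρ := by linarith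
    positivity
  have hξneg : ∀ k < 0, ξ k = 0 := fun k hk => if_neg (by omega)
  have hpars := sum_norm_movingAverage_sq_le (residualCoeff C D h) (r + h + 1) (γ := γ)
    (fun z hz x => by
      rw [show r + h + 1 = h + r + 1 by omega]
      exact norm_residual_mulVec_le hC hD hK hρ0 hρ1 hDK hz x) ξ hξneg
  refine exists_sum_norm_sq_le_of_gain_lt_one (ξ := fun k : ℕ => ξ k) (k₀ := k₀ + 1)
    (g := fun k => coeffApply (θ - α (k₀ + k + 1)) (ψ (k₀ + k)))
    (e := fun k => movingAverage (residualCoeff C D h) (r + h + 1) ξ ((k₀ + k : ℕ) + 1))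
    hγ0 hγ1 (fun k => ?_) (fun N => ?_) (fun N => ?_) (fun ε hε => ?_)
  -- `ŵ` is the a posteriori residual and the output is `θᵀ ψ + w + e`; subtracting `w` leaves `(θ -
  -- α)ᵀ ψ + e`.
  · ext t
    have h1 : ψ (k₀ + k) = regressor (p + h) (q + h) (r + h) (fun j => y j ω) (fun j => u j ω)
        (noiseEst (p + h) (q + h) (r + h) μ (fun j => y j ω) (fun j => u j ω))
        ((k₀ + k : ℕ) : ℤ) :=
      regressor_congr (fun i hi => if_pos (by omega)) (fun i hi => if_pos (by omega))
        fun _ _ => rfl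
    have h2 := (hsys' ω (k₀ + k) (by omega)).regression
      (noiseEst (p + h) (q + h) (r + h) μ (fun j => y j ω) (fun j => u j ω)) ξ
      (fun i hi => if_pos (by omega)) (residualCoeff C D h) (residualCoeff_zero hD) hG t
    rw [← h1] at h2
    have h3 := noiseEst_succ (p' := p + h) (q' := q + h) (r' := r + h) (μ := μ)
      (y := fun j => y j ω) (u := fun j => u j ω) (k₀ + k) t
    rw [dataOf, if_pos (by omega), h2] at h3
    have h4 : ξ ((k₀ + 1 + k : ℕ) : ℤ) = noiseEst (p + h) (q + h) (r + h) μ (fun j => y j ω)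
        (fun j => u j ω) (((k₀ + k : ℕ) : ℤ) + 1) - w (((k₀ + k : ℕ) : ℤ) + 1) ω := by
      rw [show ((k₀ + 1 + k : ℕ) : ℤ) = ((k₀ + k : ℕ) : ℤ) + 1 by push_cast; ring]
      exact if_pos (by omega)
    simp only [h4, PiLp.sub_apply, PiLp.add_apply, h3, coeffApply, transpose_sub, sub_mulVec,
      Pi.sub_apply]
    simp only [hα, hψ, hθ]
    ring
  · have h1 := hpars (k₀ + 1 + N)
    refine le_trans ?_ h1
    rw [Finset.sum_range_add]
    refine le_add_of_nonneg_of_le (Finset.sum_nonneg fun _ _ => sq_nonneg _)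
      (le_of_eq (Finset.sum_congr rfl fun k _ => ?_))
    rw [show ((k₀ + 1 + k : ℕ) : ℤ) = ((k₀ + k : ℕ) : ℤ) + 1 by push_cast; ring]
  · have := log_det_le_log_det_information (ψ := fun k => ψ (k₀ + k))
      (posDef_information (ψ := ψ) (posDef_smul_one hμ) k₀) N
    rw [information_shift] at this
    linarith
  · obtain ⟨c, hc0, hc⟩ := hω ε hε
    refine ⟨c, hc0, fun N => le_trans ?_ (hc N)⟩
    exact le_add_of_nonneg_left (columnForm_nonneg
      (posDef_information (posDef_smul_one hμ) _).posSemidef _)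

/-- The least squares estimates that underlie Step 2. -/
theorem ae_columnForm_le (hy : ∀ j, Measurable (y j)) (hu : ∀ j, Measurable (u j))
    (hw : ∀ j, Measurable (w j))
    (hsys : ∀ ω, IsSystem A B C (fun j => y j ω) (fun j => u j ω) (fun j => w j ω))
    (hint : ∀ k : ℕ, 1 ≤ k → Integrable (w (k + 1)) ℙ)
    (hmds : ∀ k : ℕ, 1 ≤ k → ℙ[w (k + 1) | sigmaAlg y u w k] =ᵐ[ℙ] 0) {β : ℝ} (hβ : 2 < β)
    (hmom : ∀ᵐ ω ∂ℙ, (⨆ (k : ℕ) (_ : 1 ≤ k),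
      condLExp (sigmaAlg y u w k) ℙ (fun ω' => ‖w (k + 1) ω'‖ₑ ^ β) ω) < ∞)
    (hq : 0 < q) (hr : 0 < r) (hμ : 0 < μ)
    (hφ : ∀ k : ℕ, 1 ≤ k → Measurable[sigmaAlg y u w k]
      fun ω => phi p q r (p + h) (q + h) (r + h) μ (fun j => y j ω) (fun j => u j ω) k)
    {k₀ : ℕ} (hPk : p ≤ k₀) (hQk : q ≤ k₀) (hRk : r ≤ k₀)
    {Pm : ℕ → Ω → Matrix (Idx n l p q r) (Idx n l p q r) ℝ}
    {α : ℕ → Ω → Matrix (Idx n l p q r) (Fin n) ℝ}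
    (hLS : ∀ ω, IsLeastSquares
      (fun k => phi p q r (p + h) (q + h) (r + h) μ (fun j => y j ω) (fun j => u j ω) k)
      (fun k t => dataOf (fun j => y j ω) ((k : ℤ) + 1) t) (fun k => Pm k ω) (fun k => α k ω))
    (hPm : ∀ ω, Pm 0 ω = μ⁻¹ • (1 : Matrix _ _ ℝ)) (hα : ∀ ω, α 0 ω = 0) :
    ∀ᵐ ω ∂ℙ, ∃ c : ℝ, 0 ≤ c ∧ ∀ N : ℕ,
      columnForm (information (μ • (1 : Matrix _ _ ℝ))
        (phi p q r (p + h) (q + h) (r + h) μ (fun j => y j ω) (fun j => u j ω)) (k₀ + N))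
        (paramMatrix A B C - α (k₀ + N) ω) ≤
      c * (∑ k ∈ Finset.range (k₀ + 1 + N), ‖noiseError (p + h) (q + h) (r + h) μ
          (fun j => y j ω) (fun j => u j ω) (fun j => w j ω) k‖ ^ 2 +
        (1 + (Real.log (information (μ • (1 : Matrix _ _ ℝ))
          (phi p q r (p + h) (q + h) (r + h) μ (fun j => y j ω)
            (fun j => u j ω)) (k₀ + N)).det -
          Real.log (information (μ • (1 : Matrix _ _ ℝ))
          (phi p q r (p + h) (q + h) (r + h) μ (fun j => y j ω)
            (fun j => u j ω)) k₀).det))) := by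
  -- The symbol is now `I - C`. Its gain `1 + ‖C‖_∞` may exceed `1`, which is harmless because the
  -- energy of `ξ` is already bounded.
  set G : ℕ → Matrix (Fin n) (Fin n) ℝ := fun m => (if m = 0 then 1 else 0) - noiseCoeff C m
    with hGdef
  have hG0 : G 0 = 0 := by simp [hGdef, noiseCoeff]
  have hG : ∀ ν : Fin r, G (ν + 1) = -C ν := fun ν => by simp [hGdef, noiseCoeff]
  have hnorm : ∀ z : ℂ, ‖z‖ = 1 → ∀ x : Fin n → ℂ, ‖WithLp.toLp 2 (polyEval G (r + 1) z *ᵥ x)‖ ≤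
      (1 + noisePolySupNorm C) * ‖WithLp.toLp 2 x‖ := fun z hz x => by
    have h1 : polyEval G (r + 1) z = 1 - noisePoly C z := by
      rw [← polyEval_noiseCoeff, polyEval, polyEval]
      have h2 : ∀ m, z ^ m • (G m).map (fun x : ℝ => (x : ℂ)) = (if m = 0 then 1 else 0) -
          z ^ m • (noiseCoeff C m).map (fun x : ℝ => (x : ℂ)) := fun m => by
        rcases eq_or_ne m 0 with rfl | hm
        · ext s t
          simp [hGdef, Matrix.one_apply, apply_ite]
        · ext s t
          simp [hGdef, hm]
      simp only [h2, Finset.sum_sub_distrib]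
      simp
    rw [h1, sub_mulVec, one_mulVec, WithLp.toLp_sub]
    refine (norm_sub_le _ _).trans ?_
    linarith [norm_noisePoly_mulVec_le C hz x]
  filter_upwards [ae_energy_le hy hu hw hint hmds hβ hmom hq hr hμ hφ (by omega) hPk hQk hRk
    (fun ω k _ => hsys ω k (by omega)) hG0 hG hLS hPm hα] with ω hω
  set ξ := noiseError (p + h) (q + h) (r + h) μ (fun j => y j ω) (fun j => u j ω)
    (fun j => w j ω) with hξ
  have hξneg : ∀ k < 0, ξ k = 0 := fun k hk => if_neg (by omega)
  have hpars := sum_norm_movingAverage_sq_le G (r + 1) hnorm ξ hξneg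
  obtain ⟨c, hc0, hc⟩ := hω (1 / 2) (by norm_num)
  refine ⟨2 * (1 + noisePolySupNorm C) ^ 2 + c, by positivity, fun N => ?_⟩
  refine (add_half_le_of_energy_le (hc N)).trans ?_
  have h1 : ∑ k ∈ Finset.range N, ‖movingAverage G (r + 1) ξ ((k₀ + k : ℕ) + 1)‖ ^ 2 ≤
      (1 + noisePolySupNorm C) ^ 2 * ∑ k ∈ Finset.range (k₀ + 1 + N), ‖ξ k‖ ^ 2 := by
    refine le_trans ?_ (hpars (k₀ + 1 + N))
    rw [Finset.sum_range_add]
    refine le_add_of_nonneg_of_le (Finset.sum_nonneg fun _ _ => sq_nonneg _)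
      (le_of_eq (Finset.sum_congr rfl fun k _ => ?_))
    rw [show ((k₀ + 1 + k : ℕ) : ℤ) = ((k₀ + k : ℕ) : ℤ) + 1 by push_cast; ring]
  have h2 := log_det_le_log_det_information (ψ := fun k => phi p q r (p + h) (q + h) (r + h) μ
    (fun j => y j ω) (fun j => u j ω) (k₀ + k))
      (posDef_information (ψ := phi p q r (p + h) (q + h) (r + h) μ
    (fun j => y j ω) (fun j => u j ω)) (posDef_smul_one hμ) k₀) N
  rw [information_shift] at h2
  set S := ∑ k ∈ Finset.range (k₀ + 1 + N), ‖ξ k‖ ^ 2 with hS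
  have hS0 : 0 ≤ S := Finset.sum_nonneg fun _ _ => sq_nonneg _
  have h3 : 0 ≤ c * S := by positivity
  rw [add_mul, mul_add, mul_add]
  have h4 := mul_nonneg (sq_nonneg (1 + noisePolySupNorm C)) (add_nonneg zero_le_one
    (sub_nonneg.2 h2))
  linarith

end Estimates

/-! ### The Frobenius norm -/

section Frobenius

variable {ι κ : Type*} [Fintype ι] [Fintype κ]

lemma frobNorm_eq_norm (X : Matrix ι κ ℝ) :
    frobNorm X = ‖WithLp.toLp 2 (fun st : ι × κ => X st.1 st.2)‖ := by
  simp [frobNorm, EuclideanSpace.norm_eq, Fintype.sum_prod_type]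

lemma frobNorm_nonneg (X : Matrix ι κ ℝ) : 0 ≤ frobNorm X := Real.sqrt_nonneg _

lemma frobNorm_sq (X : Matrix ι κ ℝ) : frobNorm X ^ 2 = ∑ s, ∑ t, X s t ^ 2 :=
  Real.sq_sqrt (Finset.sum_nonneg fun _ _ => Finset.sum_nonneg fun _ _ => sq_nonneg _)

lemma frobNorm_add_le (X Y : Matrix ι κ ℝ) : frobNorm (X + Y) ≤ frobNorm X + frobNorm Y := by
  simp only [frobNorm_eq_norm]
  exact norm_add_le (WithLp.toLp 2 (fun st : ι × κ => X st.1 st.2))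
    (WithLp.toLp 2 (fun st : ι × κ => Y st.1 st.2))

lemma frobNorm_smul (c : ℝ) (X : Matrix ι κ ℝ) : frobNorm (c • X) = |c| * frobNorm X := by
  simp only [frobNorm_eq_norm]
  exact norm_smul c (WithLp.toLp 2 (fun st : ι × κ => X st.1 st.2))

lemma abs_apply_le_frobNorm (X : Matrix ι κ ℝ) (s : ι) (t : κ) : |X s t| ≤ frobNorm X := by
  rw [frobNorm_eq_norm]
  exact PiLp.norm_apply_le (WithLp.toLp 2 (fun st : ι × κ => X st.1 st.2)) (s, t)

lemma frobNorm_le_sum_abs (X : Matrix ι κ ℝ) : frobNorm X ≤ ∑ st : ι × κ, |X st.1 st.2| := by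
  refine Real.sqrt_le_iff.2 ⟨Finset.sum_nonneg fun _ _ => abs_nonneg _, ?_⟩
  rw [← Fintype.sum_prod_type']
  have := Finset.sum_sq_le_sq_sum_of_nonneg (s := Finset.univ)
    (f := fun st : ι × κ => |X st.1 st.2|) fun _ _ => abs_nonneg _
  simpa using this

lemma frobNorm_mono {X Y : Matrix ι κ ℝ} (h : ∀ s t, |X s t| ≤ |Y s t|) :
    frobNorm X ≤ frobNorm Y :=
  Real.sqrt_le_sqrt (Finset.sum_le_sum fun s _ => Finset.sum_le_sum fun t _ =>
    sq_le_sq.2 (h s t))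

/-- The operator norm of the inverse of a positive definite matrix. -/
lemma eigMin_mul_frobNorm_inv_mul_le [DecidableEq ι] {n : ℕ} {R : Matrix ι ι ℝ} (hR : R.PosDef)
    (hpos : 0 < eigMin R) (X : Matrix ι (Fin n) ℝ) :
    eigMin R * frobNorm (R⁻¹ * X) ≤ frobNorm X := by
  set Y := R⁻¹ * X with hY
  have hRY : R * Y = X := by
    rw [hY, ← Matrix.mul_assoc, mul_nonsing_inv _ hR.det_pos.ne'.isUnit, Matrix.one_mul]
  have h1 : columnForm R Y = ∑ s, ∑ t, Y s t * X s t := by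
    rw [Finset.sum_comm, columnForm]
    refine Finset.sum_congr rfl fun t _ => Finset.sum_congr rfl fun s _ => ?_
    rw [← hRY]
    rfl
  have h2 := eigMin_mul_frobNorm_sq_le hR.isHermitian Y
  have h3 : 2 * (eigMin R * columnForm R Y) ≤ eigMin R ^ 2 * frobNorm Y ^ 2 + frobNorm X ^ 2 := by
    rw [h1, frobNorm_sq, frobNorm_sq]
    simp only [Finset.mul_sum, ← Finset.sum_add_distrib]
    refine Finset.sum_le_sum fun s _ => Finset.sum_le_sum fun t _ => ?_
    nlinarith [sq_nonneg (eigMin R * Y s t - X s t)]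
  refine le_of_sq_le_sq ?_ (frobNorm_nonneg _)
  have h4 := mul_le_mul_of_nonneg_left h2 hpos.le
  rw [mul_pow]
  nlinarith

end Frobenius

/-! ### Thresholding -/

section Threshold

lemma abs_sgn_mul (x a : ℝ) : |sgn x * a| = |a| := by
  unfold sgn
  split_ifs <;> simp

lemma sgn_mul_abs (x : ℝ) : sgn x * |x| = x := by
  unfold sgn
  split_ifs with h
  · rw [abs_of_nonneg h, one_mul]
  · rw [abs_of_neg (not_le.1 h)]
    ring

lemma abs_add_sgn_mul {x ρ : ℝ} (hρ : 0 ≤ ρ) : |x + sgn x * ρ| = |x| + ρ := by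
  nth_rewrite 1 [← sgn_mul_abs x]
  rw [← mul_add, abs_sgn_mul, abs_of_nonneg (by positivity)]

/-- Soft thresholding with a data dependent threshold keeps the rate of convergence and eventually
detects whether the limit vanishes. -/
lemma isBigO_threshold {x ρ lam s : ℕ → ℝ} {θ μ : ℝ} (hμ : 0 < μ) (hρ0 : ∀ᶠ N in atTop, 0 < ρ N)
    (hρ : Tendsto ρ atTop (𝓝 0)) (hlam : ∀ᶠ N in atTop, 0 < lam N) (hlam1 : lam =O[atTop] ρ)
    (hlam2 : (fun N => ρ N ^ 2) =o[atTop] lam) (hx : (fun N => x N - θ) =O[atTop] ρ)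
    (hs : ∀ N, s N = sgn (x N) * max (|x N| - lam N / (μ * |x N + sgn (x N) * ρ N|)) 0) :
    ((fun N => s N - θ) =O[atTop] ρ) ∧ ∀ᶠ N in atTop, s N = 0 ↔ θ = 0 := by
  obtain ⟨c, hc0, hc⟩ := hx.exists_pos
  have hc := hc.bound
  rcases eq_or_ne θ 0 with rfl | hθ
  · have hev : ∀ᶠ N in atTop, s N = 0 := by
      -- From `|x| ≤ c ρ` follows `|x| (|x| + ρ) ≤ c (c + 1) ρ²`. With this constant, `ρ²` is small
      -- enough against `lam` for the threshold to reach `|x|`.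
      have h2 := hlam2.bound (c := (μ * (c * (c + 1)))⁻¹) (by positivity)
      filter_upwards [hc, h2, hρ0, hlam] with N h1 h2 h3 h4
      rw [sub_zero, Real.norm_eq_abs, Real.norm_of_nonneg h3.le] at h1
      rw [Real.norm_of_nonneg (sq_nonneg _), Real.norm_of_nonneg h4.le, inv_mul_eq_div,
        le_div_iff₀ (by positivity)] at h2
      have hpos : 0 < |x N| + ρ N := by positivity
      rw [hs, abs_add_sgn_mul h3.le, max_eq_right, mul_zero]
      rw [sub_nonpos, le_div_iff₀ (by positivity)]
      have h5 : |x N| * (|x N| + ρ N) ≤ c * ρ N * ((c + 1) * ρ N) :=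
        mul_le_mul h1 (by linarith) hpos.le (by positivity)
      nlinarith
    refine ⟨?_, hev.mono fun N h => by simp [h]⟩
    refine IsBigO.of_bound 1 (hev.mono fun N h => by simp [h])
  · have hθ0 : 0 < |θ| := abs_pos.2 hθ
    have hxlim : Tendsto x atTop (𝓝 θ) := by
      have := (hx.trans_tendsto hρ).add_const θ
      simpa using this
    have hxabs : ∀ᶠ N in atTop, |θ| / 2 < |x N| :=
      hxlim.abs.eventually (lt_mem_nhds (by linarith))
    have hlam0 : Tendsto lam atTop (𝓝 0) := hlam1.trans_tendsto hρ
    have hsmall : ∀ᶠ N in atTop, lam N < |θ| / 2 * (μ * (|θ| / 2)) :=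
      hlam0.eventually (gt_mem_nhds (by positivity))
    -- Once `|x|` exceeds `|θ| / 2`, the threshold is at most a fixed multiple of `lam`, which tends
    -- to zero.
    have hev : ∀ᶠ N in atTop, s N ≠ 0 ∧ |s N - x N| ≤ (μ * (|θ| / 2))⁻¹ * |lam N| := by
      filter_upwards [hxabs, hsmall, hρ0, hlam] with N h1 h2 h3 h4
      have hτ : lam N / (μ * |x N + sgn (x N) * ρ N|) ≤ lam N / (μ * (|θ| / 2)) := by
        rw [abs_add_sgn_mul h3.le]
        gcongr
        linarith
      have hτ0 : 0 ≤ lam N / (μ * |x N + sgn (x N) * ρ N|) := by positivity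
      have hτ1 : lam N / (μ * (|θ| / 2)) < |θ| / 2 := by
        rw [div_lt_iff₀ (by positivity)]
        exact h2
      have hs' := hs N
      set τ := lam N / (μ * |x N + sgn (x N) * ρ N|) with hτdef
      rw [max_eq_left (by linarith)] at hs'
      constructor
      · have h5 : |s N| = |x N| - τ := by
          rw [hs', abs_sgn_mul, abs_of_nonneg (by linarith)]
        intro h6
        rw [h6, abs_zero] at h5
        linarith
      · have h5 : s N - x N = -(sgn (x N) * τ) := by
          rw [hs', mul_sub, sgn_mul_abs]
          ring
        rw [h5, abs_neg, abs_sgn_mul, abs_of_nonneg hτ0, abs_of_pos h4, inv_mul_eq_div]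
        exact hτ
    constructor
    · have h1 : (fun N => s N - x N) =O[atTop] ρ :=
        (IsBigO.of_bound _ (hev.mono fun N h => h.2)).trans hlam1
      refine (h1.add hx).congr_left fun N => ?_
      ring
    · exact hev.mono fun N h => iff_of_false h.1 hθ

/-- The bound `max (T N₀) (2 M)` is preserved by the recursion. -/
lemma exists_forall_le_of_le_add_half {T : ℕ → ℝ} {M : ℝ} {N₀ : ℕ}
    (h : ∀ N, N₀ ≤ N → T (N + 1) ≤ M + 1 / 2 * T N) : ∃ B, ∀ N, N₀ ≤ N → T N ≤ B := by
  refine ⟨max (T N₀) (2 * M), fun N hN => ?_⟩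
  induction N, hN using Nat.le_induction with
  | base => exact le_max_left _ _
  | succ N hN ih =>
    have := le_max_right (T N₀) (2 * M)
    linarith [h N hN]

end Threshold

/-! ### The sparse estimates -/

section SparseEstimates

variable {ι : Type*} [Fintype ι] [DecidableEq ι] {n : ℕ} {μ : ℝ} {lam : ℕ → ℝ} {φ : ℕ → ι → ℝ}
  {y : ℤ → EuclideanSpace ℝ (Fin n)}

/-- Thresholding shrinks every entry. This closes the feedback loop of the correction term: it is
bounded by the previous estimate itself. -/
lemma frobNorm_Ξ_le (hμ : 0 < μ) {N : ℕ} (hlam : 0 < lam N) :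
    frobNorm (sparseState μ lam φ y (N + 1)).Ξ ≤ frobNorm (sparseState μ lam φ y (N + 1)).Θ := by
  refine frobNorm_mono fun s t => ?_
  simp only [sparseState, sparseStep]
  rw [abs_sgn_mul, abs_of_nonneg (le_max_right _ _)]
  refine max_le (sub_le_self _ (by positivity)) (abs_nonneg _)

/-- Consistency of the sparse estimates, given the rate of the underlying least squares
estimates. -/
theorem isBigO_sparseState (hμ : 0 < μ) (hφ : φ 0 = 0) (hlam : ∀ N, 1 ≤ N → 0 < lam N)
    (θ : Matrix ι (Fin n) ℝ)
    (hmin : Tendsto (fun N => lamMin μ φ N) atTop atTop)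
    (hmax : Tendsto (fun N => lamMax μ φ N) atTop atTop)
    (hexc : Tendsto (fun N => Real.log (lamMax μ φ N) / lamMin μ φ N) atTop (𝓝 0))
    (hlam1 : lam =O[atTop] fun N => √(Real.log (lamMax μ φ N) / lamMin μ φ N))
    (hlam2 : (fun N => Real.log (lamMax μ φ N) / lamMin μ φ N) =o[atTop] lam)
    (hLS : (fun N => frobNorm (θ - ((sparseState μ lam φ y (N + 1)).Θ -
        μ • ((sparseState μ lam φ y (N + 1)).P * (sparseState μ lam φ y (N + 1)).Ξprev))))
      =O[atTop] fun N => √(Real.log (lamMax μ φ N) / lamMin μ φ N)) :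
    ((fun N => frobNorm ((sparseState μ lam φ y (N + 1)).Ξ - θ))
      =O[atTop] fun N => √(Real.log (lamMax μ φ N) / lamMin μ φ N)) ∧
    ∃ N₀, ∀ N, N₀ ≤ N → zeroSet (sparseState μ lam φ y (N + 1)).Ξ = zeroSet θ := by
  set ρ : ℕ → ℝ := fun N => √(Real.log (lamMax μ φ N) / lamMin μ φ N) with hρdef
  set S := sparseState μ lam φ y with hS
  set E : ℕ → Matrix ι (Fin n) ℝ := fun N => θ - ((S (N + 1)).Θ -
    μ • ((S (N + 1)).P * (S (N + 1)).Ξprev)) with hE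
  have hlog : ∀ᶠ N in atTop, 1 ≤ Real.log (lamMax μ φ N) :=
    (Real.tendsto_log_atTop.comp hmax).eventually_ge_atTop 1
  have hρ : Tendsto ρ atTop (𝓝 0) := by
    have := (Real.continuous_sqrt.tendsto 0).comp hexc
    rwa [Real.sqrt_zero] at this
  -- When `λ_min` and `log λ_max` are at least `1`, `λ_min⁻² ≤ λ_min⁻¹ ≤ log λ_max / λ_min`.
  have hinv : ∀ᶠ N in atTop, 0 < (lamMin μ φ N)⁻¹ ∧ (lamMin μ φ N)⁻¹ ≤ ρ N := by
    filter_upwards [hlog, hmin.eventually_ge_atTop 1] with N h1 h2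
    have h3 : 0 < lamMin μ φ N := by linarith
    refine ⟨inv_pos.2 h3, Real.le_sqrt_of_sq_le ?_⟩
    rw [sq, div_eq_mul_inv]
    refine mul_le_mul_of_nonneg_right ?_ (inv_pos.2 h3).le
    exact (inv_le_one_of_one_le₀ h2).trans h1
  have hρ0 : ∀ᶠ N in atTop, 0 < ρ N := hinv.mono fun N h => h.1.trans_le h.2
  have hρsq : ∀ᶠ N in atTop, Real.log (lamMax μ φ N) / lamMin μ φ N = ρ N ^ 2 := by
    filter_upwards [hlog, hmin.eventually_ge_atTop 1] with N h1 h2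
    exact (Real.sq_sqrt (div_nonneg (by linarith) (by linarith))).symm
  have hgain : ∀ N, (S (N + 1)).P = (infoMatrix μ φ N)⁻¹ := fun N => by
    rw [infoMatrix_eq_information hφ]
    exact isLeastSquares_sparseState.gain_eq (posDef_smul_one hμ)
      (by rw [smul_one_inv hμ]; rfl) (N + 1)
  have hpd : ∀ N, (infoMatrix μ φ N).PosDef := fun N => by
    rw [infoMatrix_eq_information hφ]
    exact posDef_information (posDef_smul_one hμ) _
  have hΘ : ∀ N, (S (N + 1)).Θ - θ = μ • ((infoMatrix μ φ N)⁻¹ * (S N).Ξ) - E N := fun N => by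
    rw [hE]
    simp only [← hgain]
    rw [show (S (N + 1)).Ξprev = (S N).Ξ from rfl]
    abel
  have hcorr : ∀ᶠ N in atTop, frobNorm ((S (N + 1)).Θ - θ) ≤
      μ * (lamMin μ φ N)⁻¹ * frobNorm (S N).Θ + frobNorm (E N) := by
    -- `Ξ` at index `N` was thresholded with `lam (N - 1)`, whose positivity is known for `N ≥ 2`.
    filter_upwards [hmin.eventually_gt_atTop 0, eventually_ge_atTop 2] with N h1 h2
    obtain ⟨M, rfl⟩ : ∃ M, N = M + 1 := ⟨N - 1, by omega⟩
    rw [hΘ, sub_eq_add_neg]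
    refine (frobNorm_add_le _ _).trans (add_le_add ?_ (le_of_eq ?_))
    · rw [frobNorm_smul, abs_of_pos hμ, mul_assoc]
      refine mul_le_mul_of_nonneg_left ?_ hμ.le
      rw [inv_mul_eq_div, le_div_iff₀' h1]
      exact (eigMin_mul_frobNorm_inv_mul_le (hpd _) h1 _).trans
        (frobNorm_Ξ_le hμ (hlam M (by omega)))
    · simpa using frobNorm_smul (-1) (E (M + 1))
  -- The feedback gain `μ / λ_min` tends to zero, so the recursion for the norm eventually contracts
  -- by `1 / 2`.
  have hbdd : ∃ B, ∀ᶠ N in atTop, frobNorm (S N).Θ ≤ B := by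
    have h1 : ∀ᶠ N in atTop, frobNorm (E N) ≤ 1 := by
      have := hLS.trans_tendsto hρ
      exact this.eventually (ge_mem_nhds one_pos)
    have h2 : ∀ᶠ N in atTop, μ * (lamMin μ φ N)⁻¹ ≤ 1 / 2 := by
      have := (tendsto_inv_atTop_zero.comp hmin).const_mul μ
      rw [mul_zero] at this
      exact this.eventually (ge_mem_nhds (by norm_num))
    obtain ⟨N₀, hN₀⟩ := eventually_atTop.1 ((hcorr.and h1).and h2)
    obtain ⟨B, hB⟩ := exists_forall_le_of_le_add_half (T := fun N => frobNorm (S N).Θ)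
      (M := frobNorm θ + 1) (N₀ := N₀) fun N hN => by
        obtain ⟨⟨h3, h4⟩, h5⟩ := hN₀ N hN
        have h6 := frobNorm_add_le θ ((S (N + 1)).Θ - θ)
        rw [add_sub_cancel] at h6
        have h7 := mul_le_mul_of_nonneg_right h5 (frobNorm_nonneg (S N).Θ)
        linarith
    exact ⟨B, eventually_atTop.2 ⟨N₀, hB⟩⟩
  obtain ⟨B, hB⟩ := hbdd
  have hrate : (fun N => frobNorm ((S (N + 1)).Θ - θ)) =O[atTop] ρ := by
    have h1 : (fun N => μ * B * ρ N + frobNorm (E N)) =O[atTop] ρ :=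
      (isBigO_const_mul_self (μ * B) ρ atTop).add hLS
    refine IsBigO.trans (IsBigO.of_bound 1 ?_) h1
    filter_upwards [hcorr, hB, hinv] with N h2 h3 h4
    rw [Real.norm_of_nonneg (frobNorm_nonneg _), one_mul]
    refine (h2.trans ?_).trans (le_abs_self _)
    refine add_le_add_left ?_ _
    rw [mul_assoc, mul_assoc, mul_comm B]
    have := frobNorm_nonneg (S N).Θ
    gcongr
    exact h4.2
  have hentry : ∀ st : ι × Fin n,
      ((fun N => (S (N + 1)).Ξ st.1 st.2 - θ st.1 st.2) =O[atTop] ρ) ∧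
        ∀ᶠ N in atTop, (S (N + 1)).Ξ st.1 st.2 = 0 ↔ θ st.1 st.2 = 0 := fun st => by
    refine isBigO_threshold (x := fun N => (S (N + 1)).Θ st.1 st.2) hμ hρ0 hρ
      (eventually_atTop.2 ⟨1, hlam⟩) hlam1 (hlam2.congr' hρsq EventuallyEq.rfl) ?_ fun N => rfl
    refine IsBigO.trans (IsBigO.of_bound 1 (Eventually.of_forall fun N => ?_)) hrate
    rw [one_mul, Real.norm_of_nonneg (frobNorm_nonneg _)]
    exact abs_apply_le_frobNorm ((S (N + 1)).Θ - θ) st.1 st.2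
  constructor
  · have h1 : (fun N => ∑ st : ι × Fin n, |((S (N + 1)).Ξ - θ) st.1 st.2|) =O[atTop] ρ :=
      IsBigO.fun_sum fun st _ => (hentry st).1.abs_left
    refine IsBigO.trans (IsBigO.of_bound 1 (Eventually.of_forall fun N => ?_)) h1
    rw [one_mul, Real.norm_of_nonneg (frobNorm_nonneg _)]
    exact (frobNorm_le_sum_abs _).trans (le_abs_self _)
  · obtain ⟨N₀, hN₀⟩ := eventually_atTop.1 (eventually_all.2 fun st => (hentry st).2)
    exact ⟨N₀, fun N hN => Set.ext fun st => hN₀ N hN st⟩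

end SparseEstimates

/-! ### Rate of convergence -/

/-- `λ_min ‖E‖²` is at most the quadratic form, and `a` is absorbed into the logarithm once the
latter is at least `1`. -/
lemma isBigO_frobNorm_of_columnForm_le {ι : Type*} [Fintype ι] [DecidableEq ι] {n : ℕ}
    {R : ℕ → Matrix ι ι ℝ} (hR : ∀ N, (R N).PosDef) {E : ℕ → Matrix ι (Fin n) ℝ} {a b : ℝ}
    (ha : 0 ≤ a) (hb : 0 ≤ b)
    (h : ∀ᶠ N in atTop, columnForm (R N) (E N) ≤ a + b * Real.log (eigMax (R N)))
    (hmin : Tendsto (fun N => eigMin (R N)) atTop atTop)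
    (hmax : Tendsto (fun N => eigMax (R N)) atTop atTop) :
    (fun N => frobNorm (E N)) =O[atTop] fun N => √(Real.log (eigMax (R N)) / eigMin (R N)) := by
  refine IsBigO.of_bound √(a + b) ?_
  filter_upwards [h, hmin.eventually_gt_atTop 0,
    (Real.tendsto_log_atTop.comp hmax).eventually_ge_atTop 1] with N h1 h2 h3
  simp only [Function.comp_apply] at h3
  rw [Real.norm_of_nonneg (frobNorm_nonneg _), Real.norm_of_nonneg (Real.sqrt_nonneg _),
    ← Real.sqrt_mul (by positivity)]
  refine Real.le_sqrt_of_sq_le ?_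
  rw [← mul_div_assoc, le_div_iff₀' h2]
  refine (eigMin_mul_frobNorm_sq_le (hR N).isHermitian _).trans (h1.trans ?_)
  nlinarith

section Main

variable {Ω : Type*} {m0 : MeasurableSpace Ω} {ℙ : Measure Ω} [IsProbabilityMeasure ℙ]
  {n l p q r h : ℕ} {y : ℤ → Ω → EuclideanSpace ℝ (Fin n)} {u : ℤ → Ω → EuclideanSpace ℝ (Fin l)}
  {w : ℤ → Ω → EuclideanSpace ℝ (Fin n)} {μ : ℝ}
  {A : Fin p → Matrix (Fin n) (Fin n) ℝ} {B : Fin q → Matrix (Fin n) (Fin l) ℝ}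
  {C : Fin r → Matrix (Fin n) (Fin n) ℝ}

/-- The quadratic form of the error of least squares estimates with estimated noise grows at most
logarithmically. -/
theorem ae_columnForm_le_log (hn : 0 < n) (hy : ∀ j, Measurable (y j)) (hu : ∀ j, Measurable (u j))
    (hw : ∀ j, Measurable (w j))
    (hsys : ∀ ω, IsSystem A B C (fun j => y j ω) (fun j => u j ω) (fun j => w j ω))
    (hint : ∀ k : ℕ, 1 ≤ k → Integrable (w (k + 1)) ℙ)
    (hmds : ∀ k : ℕ, 1 ≤ k → ℙ[w (k + 1) | sigmaAlg y u w k] =ᵐ[ℙ] 0) {β : ℝ} (hβ : 2 < β)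
    (hmom : ∀ᵐ ω ∂ℙ, (⨆ (k : ℕ) (_ : 1 ≤ k),
      condLExp (sigmaAlg y u w k) ℙ (fun ω' => ‖w (k + 1) ω'‖ₑ ^ β) ω) < ∞)
    (hp : 0 < p) (hq : 0 < q) (hr : 0 < r) (hμ : 0 < μ)
    (hC : ∀ z : ℂ, ‖z‖ ≤ 1 → (noisePoly C z).det ≠ 0)
    {D : ℕ → Matrix (Fin n) (Fin n) ℝ} (hD : IsInverseExpansion C D)
    {K ρ : ℝ} (hK : 0 < K) (hρ0 : 0 < ρ) (hρ1 : ρ < 1)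
    (hDK : ∀ i : ℕ, frobNorm (D i) ≤ K * ρ ^ i)
    (hh : Real.log ((noisePolySupNorm C)⁻¹ * K⁻¹ * (1 - ρ)) / Real.log ρ - 1 < (h : ℝ))
    (hφ : ∀ k : ℕ, 1 ≤ k → Measurable[sigmaAlg y u w k]
      fun ω => phi p q r (p + h) (q + h) (r + h) μ (fun j => y j ω) (fun j => u j ω) k)
    {Pm : ℕ → Ω → Matrix (Idx n l p q r) (Idx n l p q r) ℝ}
    {α : ℕ → Ω → Matrix (Idx n l p q r) (Fin n) ℝ}
    (hLS : ∀ ω, IsLeastSquares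
      (fun k => phi p q r (p + h) (q + h) (r + h) μ (fun j => y j ω) (fun j => u j ω) k)
      (fun k t => dataOf (fun j => y j ω) ((k : ℤ) + 1) t) (fun k => Pm k ω) (fun k => α k ω))
    (hPm : ∀ ω, Pm 0 ω = μ⁻¹ • (1 : Matrix _ _ ℝ)) (hα : ∀ ω, α 0 ω = 0) :
    ∀ᵐ ω ∂ℙ, ∃ a b : ℝ, 0 ≤ a ∧ 0 ≤ b ∧ ∀ᶠ N in atTop,
      columnForm (infoMatrix μ
        (phi p q r (p + h) (q + h) (r + h) μ (fun j => y j ω) (fun j => u j ω)) N)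
        (paramMatrix A B C - α (N + 1) ω) ≤
      a + b * Real.log (eigMax (infoMatrix μ
        (phi p q r (p + h) (q + h) (r + h) μ (fun j => y j ω) (fun j => u j ω)) N)) := by
  -- Any starting time beyond all enlarged orders will do.
  set k₀ := p + q + r + h with hk₀
  obtain ⟨a₁, b₁, ha₁, hb₁, h₁⟩ := exists_log_det_le (l := l) (p' := p + h) (q' := q + h)
    (r' := r + h) hn hp hq hr hμ (P := p + h) (by omega) (q + h) (r + h)
  obtain ⟨a₂, b₂, ha₂, hb₂, h₂⟩ := exists_log_det_le (l := l) (p' := p + h) (q' := q + h)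
    (r' := r + h) hn hp hq hr hμ hp q r
  filter_upwards [ae_sum_noiseError_sq_le hy hu hw hsys hint hmds hβ hmom hq hr hμ hC hD hK hρ0
    hρ1 hDK hh hφ (k₀ := k₀) (by omega) (by omega) (by omega),
    ae_columnForm_le hy hu hw hsys hint hmds hβ hmom hq hr hμ hφ (k₀ := k₀) (by omega) (by omega)
    (by omega) hLS hPm hα] with ω hω₁ hω₂
  obtain ⟨c₁, hc₁, h₃⟩ := hω₁
  obtain ⟨c₂, hc₂, h₄⟩ := hω₂
  set φ := phi p q r (p + h) (q + h) (r + h) μ (fun j => y j ω) (fun j => u j ω) with hφdef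
  set ψ := phi (p + h) (q + h) (r + h) (p + h) (q + h) (r + h) μ (fun j => y j ω)
    (fun j => u j ω) with hψdef
  set d₁ := Real.log (information (μ • (1 : Matrix _ _ ℝ)) ψ k₀).det
  set d₂ := Real.log (information (μ • (1 : Matrix _ _ ℝ)) φ k₀).det
  refine ⟨c₂ * (c₁ * (1 + (a₁ + |d₁|)) + (1 + (a₂ + |d₂|))), c₂ * (c₁ * b₁ + b₂),
    by positivity, by positivity, ?_⟩
  filter_upwards [eventually_ge_atTop k₀] with N hN
  obtain ⟨M, hM⟩ : ∃ M, N + 1 = k₀ + M := ⟨N + 1 - k₀, by omega⟩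
  rw [infoMatrix_eq_information (phi_zero p q r), hM]
  refine (h₄ M).trans ?_
  have e₁ := h₁ (fun j => y j ω) (fun j => u j ω) (k₀ + M)
  have e₂ := h₂ (fun j => y j ω) (fun j => u j ω) (k₀ + M)
  set Λ := Real.log (eigMax (information (μ • (1 : Matrix _ _ ℝ)) φ (k₀ + M)))
  have e₃ := h₃ M
  calc _ ≤ c₂ * (c₁ * (1 + ((a₁ + b₁ * Λ) + |d₁|)) + (1 + ((a₂ + b₂ * Λ) + |d₂|))) := by
        refine mul_le_mul_of_nonneg_left (add_le_add (e₃.trans ?_) ?_) hc₂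
        · refine mul_le_mul_of_nonneg_left ?_ hc₁
          linarith [neg_abs_le d₁]
        · linarith [neg_abs_le d₂]
    _ = _ := by ring

end Main

end SparseARMAX

end

theorem theorem2
    {Ω : Type*} [MeasurableSpace Ω] (ℙ : Measure Ω) [IsProbabilityMeasure ℙ]
    -- the ARMAX system
    (n l p q r : ℕ) (hp : 0 < p) (hq : 0 < q) (hr : 0 < r)
    (A : Fin p → Matrix (Fin n) (Fin n) ℝ) (B : Fin q → Matrix (Fin n) (Fin l) ℝ)
    (C : Fin r → Matrix (Fin n) (Fin n) ℝ)
    (y : ℤ → Ω → EuclideanSpace ℝ (Fin n)) (u : ℤ → Ω → EuclideanSpace ℝ (Fin l))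
    (w : ℤ → Ω → EuclideanSpace ℝ (Fin n))
    (hy : ∀ j, Measurable (y j)) (hu : ∀ j, Measurable (u j)) (hw : ∀ j, Measurable (w j))
    (hsys : ∀ ω, SparseARMAX.IsSystem A B C (fun j => y j ω) (fun j => u j ω) (fun j => w j ω))
    -- the noise is a martingale difference sequence with bounded conditional moments
    (hint : ∀ k : ℕ, 1 ≤ k → Integrable (w (k + 1)) ℙ)
    (hmds : ∀ k : ℕ, 1 ≤ k → ℙ[w (k + 1) | SparseARMAX.sigmaAlg y u w k] =ᵐ[ℙ] 0)
    (β : ℝ) (hβ : 2 < β)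
    (hmom : ∀ᵐ ω ∂ℙ, (⨆ (k : ℕ) (_ : 1 ≤ k),
      condLExp (SparseARMAX.sigmaAlg y u w k) ℙ (fun ω' => ‖w (k + 1) ω'‖ₑ ^ β) ω) < ∞)
    -- stability of the noise polynomial
    (hC : ∀ z : ℂ, ‖z‖ ≤ 1 → (SparseARMAX.noisePoly C z).det ≠ 0)
    -- the orders `p + h`, `q + h`, `r + h` used for the estimation of the noise
    (D : ℕ → Matrix (Fin n) (Fin n) ℝ) (hD : SparseARMAX.IsInverseExpansion C D)
    (K ρ : ℝ) (hK : 0 < K) (hρ0 : 0 < ρ) (hρ1 : ρ < 1)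
    (hDK : ∀ i : ℕ, SparseARMAX.frobNorm (D i) ≤ K * ρ ^ i)
    (h : ℕ) (hh0 : 0 < h)
    (hh : Real.log ((SparseARMAX.noisePolySupNorm C)⁻¹ * K⁻¹ * (1 - ρ)) / Real.log ρ - 1 < (h : ℝ))
    -- the parameters of the algorithm
    (μ : ℝ) (hμ : 0 < μ)
    (lam : ℕ → Ω → ℝ) (hlam : ∀ N : ℕ, 1 ≤ N → ∀ ω, 0 < lam N ω)
    -- the regression vectors that the algorithm forms, and their eigenvalues
    (φ : ℕ → Ω → SparseARMAX.Idx n l p q r → ℝ)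
    (hφ : ∀ k ω, φ k ω =
      SparseARMAX.phi p q r (p + h) (q + h) (r + h) μ (fun j => y j ω) (fun j => u j ω) k)
    (lmax lmin : ℕ → Ω → ℝ)
    (hlmax : ∀ N ω, lmax N ω = SparseARMAX.lamMax μ (fun k => φ k ω) N)
    (hlmin : ∀ N ω, lmin N ω = SparseARMAX.lamMin μ (fun k => φ k ω) N)
    (hφm : ∀ k : ℕ, 1 ≤ k → Measurable[SparseARMAX.sigmaAlg y u w k] (φ k))
    -- excitation
    (hexc : ∀ᵐ ω ∂ℙ, Tendsto (fun N => lmin N ω) atTop atTop ∧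
      Tendsto (fun N => Real.log (lmax N ω) / lmin N ω) atTop (𝓝 0))
    -- rate of the regularization coefficients
    (hrate : ∀ᵐ ω ∂ℙ,
      (fun N => lam N ω) =O[atTop] (fun N => Real.sqrt (Real.log (lmax N ω) / lmin N ω)) ∧
      (fun N => Real.log (lmax N ω) / lmin N ω) =o[atTop] (fun N => lam N ω))
    -- the sparse estimates
    (Ξ : ℕ → Ω → Matrix (SparseARMAX.Idx n l p q r) (Fin n) ℝ)
    (hΞ : ∀ N ω, Ξ N ω = SparseARMAX.sparseEst p q r (p + h) (q + h) (r + h) μ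
      (fun k => lam k ω) (fun j => y j ω) (fun j => u j ω) N) :
    (∀ᵐ ω ∂ℙ,
      (fun N : ℕ => SparseARMAX.frobNorm (Ξ (N + 1) ω - SparseARMAX.paramMatrix A B C)) =O[atTop]
        (fun N : ℕ => Real.sqrt (Real.log (lmax N ω) / lmin N ω))) ∧
    (∀ᵐ ω ∂ℙ, ∃ N₀ : ℕ, ∀ N : ℕ, N₀ ≤ N →
      SparseARMAX.zeroSet (Ξ (N + 1) ω) =
        SparseARMAX.zeroSet (SparseARMAX.paramMatrix A B C)) := by
  -- For `n = 0` the matrices have no columns, so both claims are trivial. Otherwise the index type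
  -- is nonempty, which is needed for `λ_min ≤ λ_max`.
  obtain rfl | hn := n.eq_zero_or_pos
  · refine ⟨ae_of_all _ fun ω => ?_, ae_of_all _ fun ω => ⟨0, fun N _ => ?_⟩⟩
    · refine (Asymptotics.isBigO_zero _ _).congr_left fun N => ?_
      simp [SparseARMAX.frobNorm]
    · ext ⟨s, t⟩
      exact t.elim0
  have hφm' : ∀ k : ℕ, 1 ≤ k → Measurable[SparseARMAX.sigmaAlg y u w k] fun ω =>
      SparseARMAX.phi p q r (p + h) (q + h) (r + h) μ (fun j => y j ω) (fun j => u j ω) k :=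
    fun k hk => by
      have h1 := hφm k hk
      rwa [show φ k = _ from funext (hφ k)] at h1
  have hφ' : ∀ ω, (fun k => φ k ω) =
      SparseARMAX.phi p q r (p + h) (q + h) (r + h) μ (fun j => y j ω) (fun j => u j ω) :=
    fun ω => funext fun k => hφ k ω
  simp only [hφ'] at hlmax hlmin
  simp only [hlmax, hlmin] at hexc hrate ⊢
  have key := SparseARMAX.ae_columnForm_le_log hn hy hu hw hsys hint hmds hβ hmom hp hq hr hμ hC
    hD hK hρ0 hρ1 hDK hh hφm'
    (fun ω => SparseARMAX.isLeastSquares_sparseState (μ := μ) (lam := fun k => lam k ω))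
    (fun ω => rfl) (fun ω => by simp [SparseARMAX.sparseState])
  have hmain : ∀ᵐ ω ∂ℙ,
      (fun N : ℕ => SparseARMAX.frobNorm (Ξ (N + 1) ω - SparseARMAX.paramMatrix A B C)) =O[atTop]
        (fun N : ℕ => Real.sqrt (Real.log (SparseARMAX.lamMax μ (SparseARMAX.phi p q r (p + h)
          (q + h) (r + h) μ (fun j => y j ω) (fun j => u j ω)) N) / SparseARMAX.lamMin μ
          (SparseARMAX.phi p q r (p + h) (q + h) (r + h) μ (fun j => y j ω) (fun j => u j ω)) N)) ∧
      ∃ N₀ : ℕ, ∀ N : ℕ, N₀ ≤ N → SparseARMAX.zeroSet (Ξ (N + 1) ω) =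
        SparseARMAX.zeroSet (SparseARMAX.paramMatrix A B C) := by
    filter_upwards [key, hexc, hrate] with ω h1 h2 h3
    obtain ⟨a, b, ha, hb, h1⟩ := h1
    have hne : Nonempty (SparseARMAX.Idx n l p q r) := ⟨.inl (⟨0, hp⟩, ⟨0, hn⟩)⟩
    have hpd : ∀ N, (SparseARMAX.infoMatrix μ (SparseARMAX.phi p q r (p + h) (q + h) (r + h) μ
        (fun j => y j ω) (fun j => u j ω)) N).PosDef := fun N => by
      rw [SparseARMAX.infoMatrix_eq_information (SparseARMAX.phi_zero p q r)]
      exact SparseARMAX.posDef_information (SparseARMAX.posDef_smul_one hμ) _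
    have hmax : Tendsto (fun N => SparseARMAX.lamMax μ (SparseARMAX.phi p q r (p + h) (q + h)
        (r + h) μ (fun j => y j ω) (fun j => u j ω)) N) atTop atTop :=
      tendsto_atTop_mono (fun N => SparseARMAX.eigMin_le_eigMax (hpd N).isHermitian) h2.1
    simp only [hΞ]
    exact SparseARMAX.isBigO_sparseState hμ (SparseARMAX.phi_zero p q r)
      (fun N hN => hlam N hN ω) (SparseARMAX.paramMatrix A B C) h2.1 hmax h2.2 h3.1 h3.2
      (SparseARMAX.isBigO_frobNorm_of_columnForm_le hpd ha hb h1 h2.1 hmax)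
  exact ⟨hmain.mono fun ω h1 => h1.1, hmain.mono fun ω h1 => h1.2⟩
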